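/- Let $N\ge 1$ and let $P=(p_{i,j})$ be an irreducible stochastic $N\times N$ matrix with stationary distribution $\tilde\pi=(\pi_1,\dots,\pi_N)^T$. Let $a\in(0,1)$, $p_1,p_2,p_3\in(0,1)$ with $p_1+p_2+p_3=1$. Consider $$W_{n+1}=\max\{V_nW_n+S_n-A_{n+1},\,0\},\qquad W_0\ge 0,$$ where $P(V_n=1)=p_1$, $P(V_n=a)=p_2$, $P(V_n<0)=p_3$, the $V_n$ are identically distributed, $V_n$ is independent of the past and of $(S_n,A_{n+1},Z_{n+1})$, and, given the past up to time $n$ with $Z_n=i$, one has $Z_{n+1}=j$, $S_n\in dy$, $A_{n+1}\in dx$ with probability $p_{i,j}F_{S,i}(dy)G_{A,j}(dx)$; $F_{S,i}$ and $G_{A,j}$ are laws on $[0,\infty)$ with rational Laplace–Stieltjes transforms $N_{B,i}(s)/D_{B,i}(s)$ and $N_{A,j}(s)/D_{A,j}(s)$ for $\mathrm{Re}\,s\ge0$, where $D_{B,i}(s)=\prod_{k=1}^{m_i}(s-t_{k,i})$, $D_{A,j}(s)=\prod_{r=1}^{l_j}(s-s_{r,j})$, $\mathrm{Re}\,t_{k,i}<0$,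 $\mathrm{Re}\,s_{r,j}<0$. Assume that the limits $\Phi_i(s)=\lim_{n}E(e^{-sW_n}1_{\{Z_n=i\}})$ exist for $\mathrm{Re}\,s\ge0$, and put $\Phi=(\Phi_1,\dots,\Phi_N)^T$. Let $H_{i,j}(s)=\frac{N_{B,i}(s)N_{A,j}(-s)}{D_{B,i}(s)D_{A,j}(-s)}$, let $F(s)$ be the matrix with $(j,i)$ entry $p_{i,j}H_{i,j}(s)$, let $L_j=l_j+\sum_k m_k$ and $d_j(s)=D_{A,j}(-s)\prod_kD_{B,k}(s)$. Let $\Omega$ be the set of $s$ with $\mathrm{Re}\,s\ge0$, $D_{A,j}(-s)\ne0$ for all $j$, and $\det(I-p_1F(s))\ne0$. Let $K(s)=\mathrm{diag}(D_{A,j}(-s))\,(I-p_1F(s))\,\mathrm{diag}(D_{B,i}(s))$, a polynomial matrix. (i) $\det K$ is not identically zero and has exactly $\sum_jl_j$ roots, counted with multiplicity, in $\mathrm{Re}\,s>0$. (Away from the poles of $F$ these are the roots of $\det(I-p_1F(s))$.) (ii) There are constants $c_{\omega,j}$, $1\le j\le N$, $0\le\omega\le L_j$, with $c_{0,j}=\pi_jp_3d_j(0)$,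 such that, with $\tilde v_j(s)=\sum_{\omega=0}^{L_j}c_{\omega,j}s^\omega/d_j(s)$, $\tilde V(s)=(I-p_1F(s))^{-1}\tilde v(s)$ and $R(s)=p_2(I-p_1F(s))^{-1}F(s)$: - for $\mathrm{Re}\,s\ge0$ outside the poles of $F$, $\Phi_j(s)-\sum_ip_{i,j}H_{i,j}(s)[p_1\Phi_i(s)+p_2\Phi_i(as)]=\tilde v_j(s)$ for all $j$; - $\Phi(s)=R(s)\Phi(as)+\tilde V(s)$ for $s\in\Omega$; - $\Phi(s)=\sum_{k\ge0}\Big(\prod_{m=0}^{k-1}R(a^ms)\Big)\tilde V(a^ks)$, a convergent series with the factors ordered $R(s)R(as)\cdots R(a^{k-1}s)$, for every $s$ with $a^ks\in\Omega$ for all $k\ge0$; - whenever $\mathrm{Re}\,\delta\ge0$, $\delta$ is not a pole of $F$ and the row vector $\zeta$ satisfies $\zeta(I-p_1F(\delta))=0$, one has $p_2\,\zeta F(\delta)\Phi(a\delta)=-\zeta\tilde v(\delta)$. (iii) Let $G_{j,i}(s)=p_{i,j}N_{B,i}(s)N_{A,j}(-s)\prod_{\nu\ne i}D_{B,\nu}(s)$,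 so that $G_{j,i}=d_jF_{j,i}$. The constants satisfy the following system: $c_{0,j}=\pi_jp_3d_j(0)$; for every root $\delta$ of $\det K$ with $\mathrm{Re}\,\delta>0$ and every row vector $\zeta$ with $\zeta K(\delta)=0$, $$p_2\,\zeta\, G(\delta)\Phi(a\delta)=-\sum_j\zeta_j\sum_{\omega}c_{\omega,j}\delta^\omega;$$ and for every $t=t_{k,i}$ and every $j$, $$p_3\sum_{i'}G_{j,i'}(t)\int_{(-\infty,0)}\Phi_{i'}(ty)\,P(V\in dy\mid V<0)=\sum_\omega c_{\omega,j}t^\omega .$$ (iv) Suppose that the roots of $\det K$ in $\mathrm{Re}\,s>0$ are simple, that the $t_{k,i}$ are pairwise distinct over all $(k,i)$, that $a^{k}\delta\in\Omega$ for all $k\ge1$ and all such roots $\delta$, and that, for every $t=t_{k,i}$, almost surely on $\{V<0\}$, $a^mtV\in\Omega$ for all $m\ge0$. Replace $\Phi$ in the system (iii) by the series in (ii), so that (iii) becomes a linear system in the unknowns $c_{\omega,j}$ alone. Then the constants in (ii) are its unique solution. -/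

import Mathlib

open MeasureTheory ProbabilityTheory Filter Topology Polynomial
open scoped Matrix ENNReal

noncomputable section

/-- The parameters of the recursion `W (n+1) = max 0 (V n * W n + S n - A (n+1))` modulated by an
irreducible Markov chain on `Fin N`: the transition matrix `P`, the law `lawV` of the multiplier,
the law `lawS i` of `S n` given `Z n = i`, the law `lawA j` of `A (n+1)` given `Z (n+1) = j`.
The Laplace–Stieltjes transforms of `lawS i` and `lawA j` are rational, with denominators
`∏ (X - t i k)` and `∏ (X - u j r)` whose roots lie in the open left half-plane. -/
structure ModelI (N : ℕ) where
  P : Matrix (Fin N) (Fin N) ℝ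
  P_irreducible : P.IsIrreducible
  P_row : ∀ i, ∑ j, P i j = 1
  p₁ : ℝ
  p₂ : ℝ
  a : ℝ
  p₁_pos : 0 < p₁
  p₂_pos : 0 < p₂
  p_lt : p₁ + p₂ < 1
  a_pos : 0 < a
  a_lt : a < 1
  lawV : Measure ℝ
  lawV_prob : IsProbabilityMeasure lawV
  lawV_one : lawV {1} = ENNReal.ofReal p₁
  lawV_a : lawV {a} = ENNReal.ofReal p₂
  lawV_neg : lawV (Set.Iio 0) = ENNReal.ofReal (1 - p₁ - p₂)
  lawS : Fin N → Measure ℝ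
  lawS_prob : ∀ i, IsProbabilityMeasure (lawS i)
  lawS_nonneg : ∀ i, lawS i (Set.Iio 0) = 0
  lawA : Fin N → Measure ℝ
  lawA_prob : ∀ j, IsProbabilityMeasure (lawA j)
  lawA_nonneg : ∀ j, lawA j (Set.Iio 0) = 0
  m : Fin N → ℕ
  t : ∀ i, Fin (m i) → ℂ
  t_re : ∀ i k, (t i k).re < 0
  l : Fin N → ℕ
  u : ∀ j, Fin (l j) → ℂ
  u_re : ∀ j r, (u j r).re < 0
  NB : Fin N → ℂ[X]
  NA : Fin N → ℂ[X]
  lst_S : ∀ i (s : ℂ), 0 ≤ s.re →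
    ∫ x : ℝ, Complex.exp (-s * x) ∂(lawS i) = (NB i).eval s / (∏ k, (X - C (t i k))).eval s
  lst_A : ∀ j (s : ℂ), 0 ≤ s.re →
    ∫ x : ℝ, Complex.exp (-s * x) ∂(lawA j) = (NA j).eval s / (∏ r, (X - C (u j r))).eval s

namespace ModelI

variable {N : ℕ} (M : ModelI N)

/-- The probability that the multiplier is negative. -/
def p₃ : ℝ := 1 - M.p₁ - M.p₂

/-- Denominator of the transform of `lawS i`. -/
def DB (i : Fin N) : ℂ[X] := ∏ k, (X - C (M.t i k))

/-- Denominator of the transform of `lawA j`. -/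
def DA (j : Fin N) : ℂ[X] := ∏ r, (X - C (M.u j r))

/-- The transform of `S n - A (n+1)` given `Z n = i`, `Z (n+1) = j`, as a rational function. -/
def H (s : ℂ) : Matrix (Fin N) (Fin N) ℂ :=
  Matrix.of fun i j =>
    ((M.NB i).eval s * (M.NA j).eval (-s)) / ((M.DB i).eval s * (M.DA j).eval (-s))

/-- The matrix with `(j, i)` entry `P i j * H i j s`. -/
def F (s : ℂ) : Matrix (Fin N) (Fin N) ℂ :=
  (M.P.map (fun x : ℝ => (x : ℂ)))ᵀ ⊙ (M.H s)ᵀ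

/-- The points of the closed right half-plane at which no `H i j` has a pole. -/
def regular : Set ℂ := {s | 0 ≤ s.re ∧ ∀ j, (M.DA j).eval (-s) ≠ 0}

/-- The regular points at which `I - p₁ F(s)` is invertible. -/
def Om : Set ℂ := {s | s ∈ M.regular ∧ (1 - (M.p₁ : ℂ) • M.F s).det ≠ 0}

/-- Degree of the `j`-th numerator polynomial. -/
def deg (j : Fin N) : ℕ := M.l j + ∑ k, M.m k

/-- Families of coefficients of the numerator polynomials. -/
abbrev Coeffs : Type := ∀ j : Fin N, Fin (M.deg j + 1) → ℂ

/-- The `j`-th numerator polynomial. -/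
def num (c : M.Coeffs) (j : Fin N) (s : ℂ) : ℂ := ∑ w, c j w * s ^ (w : ℕ)

/-- The `j`-th common denominator `D_{A,j}(-s) ∏ₖ D_{B,k}(s)`. -/
def den (j : Fin N) (s : ℂ) : ℂ := (M.DA j).eval (-s) * ∏ k, (M.DB k).eval s

/-- The vector `ṽ(s)`. -/
def v (c : M.Coeffs) (s : ℂ) : Fin N → ℂ := fun j => M.num c j s / M.den j s

/-- The matrix `R(s)`. -/
def R (s : ℂ) : Matrix (Fin N) (Fin N) ℂ :=
  (M.p₂ : ℂ) • ((1 - (M.p₁ : ℂ) • M.F s)⁻¹ * M.F s)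

/-- The vector `Ṽ(s)`. -/
def Vt (c : M.Coeffs) (s : ℂ) : Fin N → ℂ := (1 - (M.p₁ : ℂ) • M.F s)⁻¹ *ᵥ M.v c s

/-- The ordered product `R(s) R(a s) ⋯ R(a^(k-1) s)`. -/
def prodR (s : ℂ) : ℕ → Matrix (Fin N) (Fin N) ℂ
  | 0 => 1
  | k + 1 => prodR s k * M.R ((M.a : ℂ) ^ k * s)

/-- The `k`-th term of the series. -/
def term (c : M.Coeffs) (s : ℂ) (k : ℕ) : Fin N → ℂ :=
  M.prodR s k *ᵥ M.Vt c ((M.a : ℂ) ^ k * s)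

/-- The sum of the series. -/
def series (c : M.Coeffs) (s : ℂ) : Fin N → ℂ := ∑' k, M.term c s k

/-- The polynomial matrix `diag(D_{A,j}(-s)) (I - p₁ F(s)) diag(D_{B,i}(s))`, that is,
`I - p₁ F(s)` with its denominators cleared. -/
def kernel : Matrix (Fin N) (Fin N) ℂ[X] :=
  Matrix.of fun j i =>
    (if i = j then (M.DA j).comp (-X) * M.DB i else 0)
      - C ((M.p₁ : ℂ) * (M.P i j : ℂ)) * (M.NB i * (M.NA j).comp (-X))

/-- The polynomial matrix with `(j, i)` entry
`p_{i,j} N_{B,i}(s) N_{A,j}(-s) ∏_{ν ≠ i} D_{B,ν}(s)`, evaluated at `s`;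
it is `F(s)` with row `j` multiplied by `D_{A,j}(-s) ∏ₖ D_{B,k}(s)`. -/
def G (s : ℂ) : Matrix (Fin N) (Fin N) ℂ :=
  Matrix.of fun j i =>
    (M.P i j : ℂ) * ((M.NB i).eval s * (M.NA j).eval (-s))
      * ∏ k ∈ Finset.univ.erase i, (M.DB k).eval s

/-- The determinant `det(I - p₁ F(s))`, multiplied by `∏ⱼ D_{A,j}(-s) ∏ᵢ D_{B,i}(s)`. -/
def kernelDet : ℂ[X] := M.kernel.det

/-- The roots in the open right half-plane. -/
def IsRightRoot (δ : ℂ) : Prop := 0 < δ.re ∧ M.kernelDet.eval δ = 0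

/-- The equations for the coefficients `c`, where `Ψ` stands for the transform vector:
the value of `c j 0`; one equation for every root `δ` in the open right half-plane and every left
null vector `ζ`; one equation for every pole `t i k` and every `j`, in which the integral is with
respect to the law of the multiplier conditioned on being negative. -/
structure System (π : Fin N → ℝ) (Ψ : ℂ → Fin N → ℂ) (c : M.Coeffs) : Prop where
  zero : ∀ j, c j 0 = (π j : ℂ) * (M.p₃ : ℂ) * M.den j 0
  right : ∀ δ, M.IsRightRoot δ → ∀ ζ : Fin N → ℂ, ζ ᵥ* (M.kernel.map (eval δ)) = 0 →
    (M.p₂ : ℂ) * (ζ ⬝ᵥ (M.G δ *ᵥ Ψ ((M.a : ℂ) * δ))) = -(ζ ⬝ᵥ fun j => M.num c j δ)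
  left : ∀ i k j,
    (M.p₃ : ℂ) * ∑ i', M.G (M.t i k) j i' *
        ∫ y : ℝ, Ψ (M.t i k * (y : ℂ)) i' ∂(ProbabilityTheory.cond M.lawV (Set.Iio 0))
      = M.num c j (M.t i k)

/-- The roots in the right half-plane and the poles `t i k` are simple, and every point at which
the series enters the equations for the coefficients is one at which all its terms are defined. -/
structure Generic : Prop where
  simple_roots : ∀ δ, M.IsRightRoot δ → M.kernelDet.rootMultiplicity δ = 1
  simple_poles : Function.Injective fun q : Σ i, Fin (M.m i) => M.t q.1 q.2
  right_Om : ∀ δ, M.IsRightRoot δ → ∀ k : ℕ, (M.a : ℂ) ^ k * ((M.a : ℂ) * δ) ∈ M.Om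
  left_Om : ∀ i r, ∀ᵐ y : ℝ ∂M.lawV, y < 0 →
    ∀ k : ℕ, (M.a : ℂ) ^ k * (M.t i r * (y : ℂ)) ∈ M.Om

/-- A realization of the model on a probability space: `V n` has law `lawV` and is independent of
the past and of `(S n, A (n+1), Z (n+1))`; given the past with `Z n = i`, one has `Z (n+1) = j` with
probability `P i j`, and then `S n` and `A (n+1)` are independent with laws `lawS i`, `lawA j`. -/
structure Realization {Ω : Type*} [mΩ : MeasurableSpace Ω] (μ : Measure Ω) where
  W : ℕ → Ω → ℝ
  V : ℕ → Ω → ℝ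
  S : ℕ → Ω → ℝ
  A : ℕ → Ω → ℝ
  Z : ℕ → Ω → Fin N
  past : Filtration ℕ mΩ
  W_zero_meas : Measurable[past 0] (W 0)
  Z_meas : ∀ n, Measurable[past n] (Z n)
  V_meas : ∀ n, Measurable[past (n + 1)] (V n)
  S_meas : ∀ n, Measurable[past (n + 1)] (S n)
  A_meas : ∀ n, Measurable[past (n + 1)] (A (n + 1))
  W_zero_nonneg : ∀ ω, 0 ≤ W 0 ω
  recursion : ∀ n ω, W (n + 1) ω = max (V n ω * W n ω + (S n ω - A (n + 1) ω)) 0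
  joint_law : ∀ (n : ℕ) (B : Set Ω), MeasurableSet[past n] B → ∀ (i j : Fin N) (b₁ b₂ b₃ : Set ℝ),
    MeasurableSet b₁ → MeasurableSet b₂ → MeasurableSet b₃ →
    μ {ω | ω ∈ B ∧ Z n ω = i ∧ V n ω ∈ b₁ ∧ S n ω ∈ b₂ ∧ A (n + 1) ω ∈ b₃ ∧ Z (n + 1) ω = j}
      = μ {ω | ω ∈ B ∧ Z n ω = i} *
          (M.lawV b₁ * (ENNReal.ofReal (M.P i j) * (M.lawS i b₂ * M.lawA j b₃)))

variable {M}

/-- The transform `E[exp(-s W n); Z n = i]`. -/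
def Realization.transform {Ω : Type*} [MeasurableSpace Ω] {μ : Measure Ω} (X : M.Realization μ)
    (n : ℕ) (s : ℂ) (i : Fin N) : ℂ :=
  ∫ ω in {ω | X.Z n ω = i}, Complex.exp (-s * (X.W n ω : ℂ)) ∂μ

end ModelI

end

/-!
The transforms `Φ` are limits of transforms of the laws of `W n`, and one step of the recursion acts
on these laws by a random affine map followed by reflection at `0`. After multiplication by the common
denominators, the equation for one step has a side that is holomorphic in the right half-plane and a
side that is holomorphic in the left one, so by Liouville's theorem both sides are one polynomial of
degree at most `deg j` (`exists_polynomial_stepMax`). In the limit these polynomials become the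
numerators `num c j` (`exists_coeffs`). Their value at `0` comes from the total masses, their values at
the poles `t i k` from the left-hand side, and the equations at the right roots from solvability.

On the imaginary axis the entries of `H` are products of characteristic functions. Hence `F` is bounded
by `1` there in the norm of operators on `ℓ¹`, and nearly so near `0` and near infinity, so the functional
equation `Φ(s) = R(s)Φ(as) + Ṽ(s)` contracts in these regions by a factor less than `1`. Near `0` this
gives the convergence of the series, and its equality with every bounded solution
(`eq_series_of_bounded`). For the determinant it means that no root crosses the axis or comes from
infinity along the homotopy that replaces `p₁` by `r ∈ [0, p₁]`; at `r = 0` the determinant is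
`∏ D_{A,j}(-s) ∏ D_{B,i}(s)`, whose right roots are counted directly
(`kernelDet_ne_zero_and_rightCount`).

The uniqueness of the coefficients has three parts. First, the equations at the simple right roots say
that the numerators in Cramer's rule vanish there, so the series continues to a bounded holomorphic
function `Ψ` in the right half-plane (`exists_extension`, `exists_bound_of_recursion`). Let `Ψ` now be
the difference of two such functions. Second, `Ψ` is the transform of a complex measure on `[0, ∞)` in
each state (`exists_quadLst_nonneg`): on the axis the rational inhomogeneity is the transform of a
complex measure by partial fractions, and the functional equation is solved by a geometric series of
measures. Third, the equations at the poles `t i k` make the complex measures invariant under the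
reflected recursion, up to their masses, which vanish. An invariant family is determined by its masses
(`eq_of_add_stepMax_eq`), since all nontrivial positive ones charge a common atom at `0`; so `Ψ` and
with it the inhomogeneity are zero (`coeffs_eq_zero_of_homogeneous`).
-/

noncomputable section

/-! ### Entire functions and polynomials -/

/-- An entire function of polynomial growth is a polynomial: by Cauchy's estimates its Taylor
coefficients of order greater than `n` vanish. -/
theorem Complex.eq_polynomial_of_norm_le {f : ℂ → ℂ} (hf : Differentiable ℂ f) {n : ℕ} {M : ℝ}
    (hC : ∀ s, ‖f s‖ ≤ M * (1 + ‖s‖) ^ n) :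
    ∃ p : ℂ[X], p.natDegree ≤ n ∧ ∀ s, f s = p.eval s := by
  have hC0 : 0 ≤ M := by simpa using (norm_nonneg _).trans (hC 0)
  have hvanish : ∀ k, n < k → iteratedDeriv k f 0 = 0 := by
    intro k hk
    have hb : ∀ R : ℝ, 1 ≤ R → ‖iteratedDeriv k f 0‖ ≤ k.factorial * (M * 2 ^ n) / R := by
      intro R hR
      have hR0 : 0 < R := by linarith
      have := Complex.norm_iteratedDeriv_le_of_forall_mem_sphere_norm_le (c := 0) (F := ℂ) k hR0
        hf.diffContOnCl (C := M * (2 * R) ^ n) (fun z hz => by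
          refine (hC z).trans ?_
          have : ‖z‖ = R := by simpa using hz
          rw [this]; gcongr; linarith)
      refine this.trans ?_
      rw [div_le_div_iff₀ (by positivity) hR0]
      have : R ^ (n + 1) ≤ R ^ k := pow_le_pow_right₀ hR hk
      calc k.factorial * (M * (2 * R) ^ n) * R = k.factorial * (M * 2 ^ n) * R ^ (n + 1) := by ring
        _ ≤ _ := by gcongr
    have hlim : Tendsto (fun R : ℝ => k.factorial * (M * 2 ^ n) / R) atTop (𝓝 0) :=
      tendsto_const_nhds.div_atTop tendsto_id
    have := ge_of_tendsto hlim ((eventually_ge_atTop 1).mono hb)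
    exact norm_le_zero_iff.1 this
  refine ⟨∑ k ∈ Finset.range (n + 1), C ((k.factorial : ℂ)⁻¹ * iteratedDeriv k f 0) * X ^ k, ?_, ?_⟩
  · refine natDegree_sum_le_of_forall_le _ _ fun k hk => ?_
    exact (natDegree_C_mul_X_pow_le _ _).trans (by simp at hk; omega)
  · intro s
    have h := Complex.hasSum_taylorSeries_of_entire hf 0 s
    rw [← h.tsum_eq, tsum_eq_sum (s := Finset.range (n + 1)) (fun k hk => by
      rw [hvanish k (by simp at hk; omega)]; simp), eval_finsetSum]
    refine Finset.sum_congr rfl fun k _ => ?_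
    simp only [sub_zero, smul_eq_mul, eval_mul, eval_C, eval_pow, eval_X]
    ring

/-- Cauchy's theorem for a rectangle with one side on the imaginary axis, for a function that is
holomorphic off the axis and only continuous on it. -/
theorem Complex.integral_rect_eq_zero_of_halfPlane {h : ℂ → ℂ} (hc : Continuous h)
    (hr : DifferentiableOn ℂ h {s | 0 < s.re}) (hl : DifferentiableOn ℂ h {s | s.re < 0})
    (a c d : ℝ) :
    (∫ x : ℝ in a..0, h (x + c * Complex.I)) - (∫ x : ℝ in a..0, h (x + d * Complex.I)) +
      Complex.I • (∫ y : ℝ in c..d, h ((0 : ℝ) + y * Complex.I)) -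
      Complex.I • (∫ y : ℝ in c..d, h (a + y * Complex.I)) = 0 := by
  have := Complex.integral_boundary_rect_eq_zero_of_continuousOn_of_differentiableOn h
    (a + c * Complex.I) ((0 : ℝ) + d * Complex.I) hc.continuousOn ?_
  · simpa using this
  · simp only [Complex.add_re, Complex.ofReal_re, Complex.mul_re, Complex.I_re, mul_zero,
      Complex.ofReal_im, Complex.I_im, mul_one, sub_self, add_zero]
    rcases le_total a 0 with ha | ha
    · refine hl.mono fun z hz => ?_
      have := hz.1.2
      simpa [ha] using this
    · refine hr.mono fun z hz => ?_
      have := hz.1.1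
      simpa [ha] using this

/-- Painlevé's theorem for the imaginary axis: continuity across the axis suffices for removability.
A rectangle is cut along the axis, and Morera's theorem applies. -/
theorem Complex.differentiable_of_halfPlanes {h : ℂ → ℂ} (hc : Continuous h)
    (hr : DifferentiableOn ℂ h {s | 0 < s.re}) (hl : DifferentiableOn ℂ h {s | s.re < 0}) :
    Differentiable ℂ h := by
  have hcons : Complex.IsConservativeOn h Set.univ := by
    intro z w _
    rw [eq_neg_iff_add_eq_zero, Complex.wedgeIntegral_add_wedgeIntegral_eq]
    have h1 := Complex.integral_rect_eq_zero_of_halfPlane hc hr hl z.re z.im w.im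
    have h2 := Complex.integral_rect_eq_zero_of_halfPlane hc hr hl w.re z.im w.im
    have hi : ∀ (c a b : ℝ), IntervalIntegrable (fun x : ℝ => h (x + c * Complex.I)) volume a b :=
      fun c a b => Continuous.intervalIntegrable (by fun_prop) _ _
    rw [← intervalIntegral.integral_add_adjacent_intervals (hi z.im z.re 0) (hi z.im 0 w.re),
      ← intervalIntegral.integral_add_adjacent_intervals (hi w.im z.re 0) (hi w.im 0 w.re),
      intervalIntegral.integral_symm w.re 0 (f := fun x : ℝ => h (x + z.im * Complex.I)),
      intervalIntegral.integral_symm w.re 0 (f := fun x : ℝ => h (x + w.im * Complex.I))]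
    linear_combination h1 - h2
  exact differentiableOn_univ.1
    ((hcons.isExactOn_univ hc).differentiableOn isOpen_univ)

/-- Liouville's theorem for two half-planes: two functions of polynomial growth, holomorphic in the
right and in the left half-plane, that agree on the imaginary axis are one polynomial. This is the
Wiener–Hopf step of all the arguments below. -/
theorem Complex.exists_polynomial_of_halfPlanes {f g : ℂ → ℂ} {n : ℕ} {M : ℝ}
    (hf : ContinuousOn f {s | 0 ≤ s.re}) (hf' : DifferentiableOn ℂ f {s | 0 < s.re})
    (hg : ContinuousOn g {s | s.re ≤ 0}) (hg' : DifferentiableOn ℂ g {s | s.re < 0})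
    (hfg : ∀ s : ℂ, s.re = 0 → f s = g s)
    (hfC : ∀ s : ℂ, 0 ≤ s.re → ‖f s‖ ≤ M * (1 + ‖s‖) ^ n)
    (hgC : ∀ s : ℂ, s.re ≤ 0 → ‖g s‖ ≤ M * (1 + ‖s‖) ^ n) :
    ∃ p : ℂ[X], p.natDegree ≤ n ∧ (∀ s : ℂ, 0 ≤ s.re → f s = p.eval s) ∧
      ∀ s : ℂ, s.re ≤ 0 → g s = p.eval s := by
  classical
  set h : ℂ → ℂ := fun s => if 0 ≤ s.re then f s else g s with hh
  have h_r : Set.EqOn h f {s | 0 ≤ s.re} := fun s hs => if_pos hs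
  have h_l : Set.EqOn h g {s | s.re ≤ 0} := by
    intro s hs
    by_cases h0 : 0 ≤ s.re
    · rw [h_r h0]; exact hfg s (le_antisymm hs h0)
    · simp [hh, h0]
  have hc : Continuous h := by
    rw [← continuousOn_univ]
    have := (hf.congr h_r).union_of_isClosed (hg.congr h_l)
      (isClosed_le continuous_const Complex.continuous_re)
      (isClosed_le Complex.continuous_re continuous_const)
    refine this.mono fun s _ => le_total 0 s.re
  have hd : Differentiable ℂ h := Complex.differentiable_of_halfPlanes hc
    (hf'.congr fun s (hs : 0 < s.re) => h_r hs.le) (hg'.congr fun s (hs : s.re < 0) => h_l hs.le)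
  obtain ⟨p, hp, hps⟩ := Complex.eq_polynomial_of_norm_le hd (n := n) (M := M) fun s => by
    rcases le_total 0 s.re with h0 | h0
    · rw [h_r h0]; exact hfC s h0
    · rw [h_l h0]; exact hgC s h0
  exact ⟨p, hp, fun s hs => (h_r hs).symm.trans (hps s), fun s hs => (h_l hs).symm.trans (hps s)⟩

/-- A quotient `g / p` is holomorphic if `g` vanishes at the zeros of `p` and these are simple; the
value there is the one of l'Hôpital's rule. -/
theorem Complex.exists_differentiableOn_div {U : Set ℂ} (hU : IsOpen U) {p : ℂ[X]}
    (hp : p ≠ 0) {g : ℂ → ℂ} (hg : DifferentiableOn ℂ g U)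
    (hs : ∀ z ∈ U, p.eval z = 0 → p.rootMultiplicity z = 1 ∧ g z = 0) :
    DifferentiableOn ℂ (fun z => if p.eval z = 0 then deriv g z / p.derivative.eval z
      else g z / p.eval z) U := by
  intro z hz
  by_cases h0 : p.eval z = 0
  · obtain ⟨hm, hgz⟩ := hs z hz h0
    obtain ⟨q, hq, hqz⟩ := Polynomial.exists_eq_pow_rootMultiplicity_mul_and_not_dvd p hp z
    rw [hm, pow_one] at hq
    have hqz' : q.eval z ≠ 0 := fun h => hqz (dvd_iff_isRoot.2 h)
    have hder : p.derivative.eval z = q.eval z := by rw [hq]; simp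
    have hds : DifferentiableAt ℂ (dslope g z) z :=
      (((Complex.differentiableOn_dslope (hU.mem_nhds hz)).2 hg) z hz).differentiableAt
        (hU.mem_nhds hz)
    have hquot : DifferentiableAt ℂ (fun w => dslope g z w / q.eval w) z :=
      hds.div q.differentiable.differentiableAt hqz'
    refine (hquot.congr_of_eventuallyEq ?_).differentiableWithinAt
    have hqne : ∀ᶠ w in 𝓝 z, q.eval w ≠ 0 := q.continuous.continuousAt.eventually_ne hqz'
    filter_upwards [hqne] with w hw
    by_cases hwz : w = z
    · subst hwz
      rw [if_pos h0, dslope_same, hder]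
    · have hpw : p.eval w = (w - z) * q.eval w := by rw [hq]; simp
      have hne : w - z ≠ 0 := sub_ne_zero.2 hwz
      rw [if_neg (by rw [hpw]; exact mul_ne_zero hne hw), dslope_of_ne _ hwz, slope_def_field,
        hgz, hpw]
      field_simp; ring
  · have hq : DifferentiableAt ℂ (fun w => g w / p.eval w) z :=
      ((hg z hz).differentiableAt (hU.mem_nhds hz)).div p.differentiable.differentiableAt h0
    refine (hq.congr_of_eventuallyEq ?_).differentiableWithinAt
    filter_upwards [p.continuous.continuousAt.eventually_ne h0] with w hw
    rw [if_neg hw]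

theorem Polynomial.exists_norm_eval_le (p : ℂ[X]) {n : ℕ} (hp : p.natDegree ≤ n) :
    ∃ C, 0 ≤ C ∧ ∀ s : ℂ, ‖p.eval s‖ ≤ C * (1 + ‖s‖) ^ n := by
  refine ⟨∑ k ∈ Finset.range (n + 1), ‖p.coeff k‖, by positivity, fun s => ?_⟩
  rw [eval_eq_sum_range' (Nat.lt_succ_of_le hp), Finset.sum_mul]
  refine (norm_sum_le _ _).trans (Finset.sum_le_sum fun k hk => ?_)
  rw [norm_mul, norm_pow]
  have h1 : ‖s‖ ^ k ≤ (1 + ‖s‖) ^ k := pow_le_pow_left₀ (norm_nonneg _) (by linarith) _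
  have h2 : (1 + ‖s‖) ^ k ≤ (1 + ‖s‖) ^ n :=
    pow_le_pow_right₀ (by linarith [norm_nonneg s]) (by simp at hk; omega)
  gcongr
  exact h1.trans h2

theorem Polynomial.tendsto_eval_div_pow (p : ℂ[X]) {n : ℕ} (hp : p.natDegree ≤ n) :
    Tendsto (fun s : ℂ => p.eval s / s ^ n) (Bornology.cobounded ℂ) (𝓝 (p.coeff n)) := by
  have h1 : Tendsto (fun s : ℂ => ∑ k ∈ Finset.range (n + 1), p.coeff k * s⁻¹ ^ (n - k))
      (Bornology.cobounded ℂ) (𝓝 (∑ k ∈ Finset.range (n + 1), p.coeff k * 0 ^ (n - k))) :=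
    tendsto_finsetSum _ fun k _ => (tendsto_inv₀_cobounded.pow _).const_mul _
  have h2 : ∑ k ∈ Finset.range (n + 1), p.coeff k * (0 : ℂ) ^ (n - k) = p.coeff n := by
    rw [Finset.sum_range_succ, Finset.sum_eq_zero]
    · simp
    · intro k hk
      rw [zero_pow (by simp at hk; omega), mul_zero]
  rw [h2] at h1
  refine h1.congr' ?_
  filter_upwards [Bornology.eventually_ne_cobounded (0 : ℂ)] with s hs
  rw [eval_eq_sum_range' (Nat.lt_succ_of_le hp), Finset.sum_div]
  refine Finset.sum_congr rfl fun k hk => ?_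
  have : s ^ n = s ^ k * s ^ (n - k) := by rw [← pow_add]; congr 1; simp at hk; omega
  rw [this, inv_pow]
  field_simp

theorem Complex.tendsto_ofReal_cobounded :
    Tendsto (fun r : ℝ => (r : ℂ)) atTop (Bornology.cobounded ℂ) := by
  rw [← tendsto_norm_atTop_iff_cobounded]
  simpa using tendsto_abs_atTop_atTop

theorem Polynomial.natDegree_le_of_norm_le {f g : ℂ[X]}
    (h : ∀ r : ℝ, 0 ≤ r → ‖f.eval (r : ℂ)‖ ≤ ‖g.eval (r : ℂ)‖) : f.natDegree ≤ g.natDegree := by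
  by_contra! hlt
  have h1 := ((f.tendsto_eval_div_pow le_rfl).comp Complex.tendsto_ofReal_cobounded).norm
  have h2 := ((g.tendsto_eval_div_pow hlt.le).comp Complex.tendsto_ofReal_cobounded).norm
  rw [coeff_eq_zero_of_natDegree_lt hlt] at h2
  have h3 := le_of_tendsto_of_tendsto h1 h2 ((eventually_ge_atTop 0).mono fun r hr => by
    simp only [Function.comp, norm_div]
    gcongr
    exact h r hr)
  have h4 : f = 0 := by simpa using h3
  simp [h4] at hlt

theorem Polynomial.eq_zero_of_tendsto_zero {f : ℂ[X]}
    (h : Tendsto (fun r : ℝ => ‖f.eval (r : ℂ)‖) atTop (𝓝 0)) : f = 0 := by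
  by_cases hd : 0 < f.degree
  · exact absurd h (not_tendsto_nhds_of_tendsto_atTop (f.tendsto_norm_atTop hd
      (tendsto_norm_atTop_iff_cobounded.2 Complex.tendsto_ofReal_cobounded)) _)
  · rw [eq_C_of_degree_le_zero (not_lt.1 hd)] at h ⊢
    simp only [eval_C] at h
    have := tendsto_nhds_unique h tendsto_const_nhds
    simp [norm_eq_zero.1 this.symm]

/-- If polynomials of bounded degree converge pointwise on the right half-plane, then they converge
everywhere, to a polynomial: they are Lagrange interpolants of their values at `0, 1, …, L`. -/
theorem Polynomial.exists_tendsto_eval {p : ℕ → ℂ[X]} {L : ℕ} (hp : ∀ n, (p n).natDegree ≤ L)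
    {f : ℂ → ℂ} (hf : ∀ s : ℂ, 0 ≤ s.re → Tendsto (fun n => (p n).eval s) atTop (𝓝 (f s))) :
    ∃ q : ℂ[X], q.natDegree ≤ L ∧ ∀ s, Tendsto (fun n => (p n).eval s) atTop (𝓝 (q.eval s)) := by
  classical
  set v : ℕ → ℂ := fun k => (k : ℂ) with hv
  have hinj : Set.InjOn v (Finset.range (L + 1)) := fun a _ b _ h => Nat.cast_injective h
  refine ⟨Lagrange.interpolate (Finset.range (L + 1)) v (fun k => f k), ?_, fun s => ?_⟩
  · have := Lagrange.degree_interpolate_lt (fun k : ℕ => f k) hinj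
    simp only [Finset.card_range] at this
    by_cases h0 : Lagrange.interpolate (Finset.range (L + 1)) v (fun k => f k) = 0
    · rw [h0]; simp
    · exact Nat.lt_succ_iff.1 ((natDegree_lt_iff_degree_lt h0).2 this)
  · have hrep : ∀ n, p n = Lagrange.interpolate (Finset.range (L + 1)) v
        (fun k => (p n).eval (v k)) := by
      intro n
      refine Lagrange.eq_interpolate hinj ?_
      rw [Finset.card_range]
      exact (degree_le_natDegree).trans_lt (by exact_mod_cast Nat.lt_succ_of_le (hp n))
    simp_rw [Lagrange.interpolate_apply] at hrep ⊢
    have : ∀ n, (p n).eval s = ∑ k ∈ Finset.range (L + 1),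
        (p n).eval (v k) * (Lagrange.basis (Finset.range (L + 1)) v k).eval s := by
      intro n
      conv_lhs => rw [hrep n]
      simp [eval_finsetSum]
    simp_rw [this, eval_finsetSum, eval_mul, eval_C]
    exact tendsto_finsetSum _ fun k _ => (hf k (by simp)).mul_const _

/-- A weak form of partial fractions: an algebra that contains the functions `1 / (σ - z k)` contains
every rational function of `σ` with these poles that is bounded at infinity. -/
theorem Subalgebra.eval_div_prod_mem {ι : Type*} (A : Subalgebra ℂ (ι → ℂ)) (σ : ι → ℂ)
    {κ : Type*} (K : Finset κ) (z : κ → ℂ) (hz : ∀ k ∈ K, ∀ x, σ x ≠ z k)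
    (hA : ∀ k ∈ K, (fun x => (σ x - z k)⁻¹) ∈ A) :
    ∀ f : ℂ[X], f.natDegree ≤ K.card → (fun x => f.eval (σ x) / ∏ k ∈ K, (σ x - z k)) ∈ A := by
  classical
  induction K using Finset.induction_on with
  | empty =>
    intro f hf
    obtain ⟨c, rfl⟩ : ∃ c, f = C c := ⟨_, eq_C_of_natDegree_le_zero (by simpa using hf)⟩
    have := A.algebraMap_mem c
    convert this using 1
    funext x
    simp
  | insert k K hk ih =>
    intro f hf
    have ih' := ih (fun k hk => hz k (Finset.mem_insert_of_mem hk))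
      (fun k hk => hA k (Finset.mem_insert_of_mem hk))
    have h1 := hA k (Finset.mem_insert_self _ _)
    have h2 := ih' (C (f.eval (z k))) (by simp)
    have h3 := ih' (f.divByMonic (X - C (z k))) (by
      rw [natDegree_divByMonic _ (monic_X_sub_C _), natDegree_X_sub_C]
      rw [Finset.card_insert_of_notMem hk] at hf
      omega)
    have := A.add_mem (A.mul_mem h1 h2) h3
    convert this using 1
    funext x
    have hx := sub_ne_zero.2 (hz k (Finset.mem_insert_self _ _) x)
    have hf' := congrArg (eval (σ x)) (mul_divByMonic_eq_iff_isRoot (p := f - C (f.eval (z k)))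
      (a := z k) |>.2 (by simp))
    have hmod : f = (X - C (z k)) * (f /ₘ (X - C (z k))) + C (f.eval (z k)) := by
      conv_lhs => rw [← modByMonic_add_div f (X - C (z k)), modByMonic_X_sub_C_eq_C_eval, add_comm]
    have hx' : f.eval (σ x) = (σ x - z k) * (f /ₘ (X - C (z k))).eval (σ x) + f.eval (z k) := by
      conv_lhs => rw [hmod]
      simp
    rw [Finset.prod_insert hk, hx']
    simp only [Pi.add_apply, Pi.mul_apply, eval_C]
    have hprod : ∏ k ∈ K, (σ x - z k) ≠ 0 := Finset.prod_ne_zero_iff.2 fun k hk =>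
      sub_ne_zero.2 (hz k (Finset.mem_insert_of_mem hk) x)
    field_simp
    ring

/-! ### Laplace–Stieltjes transforms of real and complex measures -/

/-- The Laplace–Stieltjes transform `∫ e^{-sx} m(dx)`. -/
def lst (m : Measure ℝ) (s : ℂ) : ℂ := ∫ x : ℝ, Complex.exp (-s * x) ∂m

theorem norm_exp_neg_mul_ofReal (s : ℂ) (x : ℝ) :
    ‖Complex.exp (-s * x)‖ = Real.exp (-s.re * x) := by
  rw [Complex.norm_exp]; simp

theorem norm_exp_neg_mul_ofReal_le_one {s : ℂ} {x : ℝ} (h : 0 ≤ s.re * x) :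
    ‖Complex.exp (-s * x)‖ ≤ 1 := by
  rw [norm_exp_neg_mul_ofReal]; exact Real.exp_le_one_iff.2 (by linarith)

theorem ae_nonneg_of_Iio {m : Measure ℝ} (hm : m (Set.Iio 0) = 0) : ∀ᵐ x ∂m, 0 ≤ x := by
  rw [ae_iff]; simpa [Set.Iio] using hm

theorem integrable_exp_neg_mul {m : Measure ℝ} [IsFiniteMeasure m] {s : ℂ}
    (h : ∀ᵐ x ∂m, 0 ≤ s.re * x) : Integrable (fun x : ℝ => Complex.exp (-s * x)) m := by
  refine Integrable.of_bound (C := 1) (Continuous.aestronglyMeasurable (by fun_prop)) ?_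
  exact h.mono fun x hx => norm_exp_neg_mul_ofReal_le_one hx

theorem norm_lst_le {m : Measure ℝ} [IsFiniteMeasure m] {s : ℂ}
    (h : ∀ᵐ x ∂m, 0 ≤ s.re * x) : ‖lst m s‖ ≤ m.real Set.univ := by
  have := norm_integral_le_of_norm_le_const (C := 1)
    (h.mono fun x hx => norm_exp_neg_mul_ofReal_le_one hx)
  simpa [lst] using this

theorem ae_re_mul_nonneg {m : Measure ℝ} (hm : m (Set.Iio 0) = 0) {s : ℂ} (hs : 0 ≤ s.re) :
    ∀ᵐ x ∂m, 0 ≤ s.re * x :=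
  (ae_nonneg_of_Iio hm).mono fun _ hx => mul_nonneg hs hx

theorem ae_re_mul_nonneg_of_re_eq_zero (m : Measure ℝ) {s : ℂ} (hs : s.re = 0) :
    ∀ᵐ x ∂m, 0 ≤ s.re * x := by simp [hs]

theorem continuousOn_lst {m : Measure ℝ} [IsFiniteMeasure m] (hm : m (Set.Iio 0) = 0) :
    ContinuousOn (lst m) {s | 0 ≤ s.re} := by
  refine continuousOn_of_dominated (bound := fun _ => 1) ?_ ?_ (integrable_const _) ?_
  · exact fun s _ => Continuous.aestronglyMeasurable (by fun_prop)
  · exact fun s hs => (ae_re_mul_nonneg hm hs).mono fun x hx => norm_exp_neg_mul_ofReal_le_one hx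
  · exact Eventually.of_forall fun x => Continuous.continuousOn (by fun_prop)

theorem differentiableOn_lst {m : Measure ℝ} [IsFiniteMeasure m] (hm : m (Set.Iio 0) = 0) :
    DifferentiableOn ℂ (lst m) {s | 0 < s.re} := by
  have hsub : Set.Iio (0 : ℝ) ⊆ interior (integrableExpSet id m) := by
    refine interior_maximal (fun r hr => ?_) isOpen_Iio
    refine Integrable.of_bound (C := 1) (Continuous.aestronglyMeasurable (by fun_prop)) ?_
    filter_upwards [ae_nonneg_of_Iio hm] with x hx
    rw [Real.norm_eq_abs, Real.abs_exp]
    exact Real.exp_le_one_iff.2 (mul_nonpos_of_nonpos_of_nonneg (le_of_lt hr) hx)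
  have h := (differentiableOn_complexMGF (X := id) (μ := m)).comp
    (f := fun s : ℂ => -s) (s := {s | 0 < s.re}) (by fun_prop)
    (fun s (hs : 0 < s.re) => hsub (by simpa using hs))
  exact h

theorem lst_map_neg (m : Measure ℝ) (s : ℂ) : lst (m.map (fun x => -x)) s = lst m (-s) := by
  rw [lst, integral_map (by fun_prop) (Continuous.aestronglyMeasurable (by fun_prop))]
  simp [lst]

theorem map_neg_Iio {m : Measure ℝ} (hm : m (Set.Ioi 0) = 0) :
    (m.map (fun x => -x)) (Set.Iio 0) = 0 := by
  rw [Measure.map_apply (by fun_prop) measurableSet_Iio]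
  simpa using hm

theorem continuousOn_lst_left {m : Measure ℝ} [IsFiniteMeasure m] (hm : m (Set.Ioi 0) = 0) :
    ContinuousOn (lst m) {s | s.re ≤ 0} := by
  have h := (continuousOn_lst (map_neg_Iio hm)).comp (f := fun s : ℂ => -s) (s := {s | s.re ≤ 0})
    (by fun_prop) (fun s (hs : s.re ≤ 0) => by simpa using hs)
  refine h.congr fun s _ => ?_
  simp [lst_map_neg]

theorem differentiableOn_lst_left {m : Measure ℝ} [IsFiniteMeasure m] (hm : m (Set.Ioi 0) = 0) :
    DifferentiableOn ℂ (lst m) {s | s.re < 0} := by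
  have h := (differentiableOn_lst (map_neg_Iio hm)).comp (f := fun s : ℂ => -s)
    (s := {s | s.re < 0}) (by fun_prop) (fun s (hs : s.re < 0) => by simpa using hs)
  refine h.congr fun s _ => ?_
  simp [lst_map_neg]

theorem ae_re_mul_nonneg_left {m : Measure ℝ} (hm : m (Set.Ioi 0) = 0) {s : ℂ} (hs : s.re ≤ 0) :
    ∀ᵐ x ∂m, 0 ≤ s.re * x := by
  have : ∀ᵐ x ∂m, x ≤ 0 := by rw [ae_iff]; simpa [Set.Ioi] using hm
  exact this.mono fun _ hx => mul_nonneg_of_nonpos_of_nonpos hs hx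

theorem lst_add {m n : Measure ℝ} [IsFiniteMeasure m] [IsFiniteMeasure n] {s : ℂ}
    (hm : ∀ᵐ x ∂m, 0 ≤ s.re * x) (hn : ∀ᵐ x ∂n, 0 ≤ s.re * x) :
    lst (m + n) s = lst m s + lst n s :=
  integral_add_measure (integrable_exp_neg_mul hm) (integrable_exp_neg_mul hn)

theorem lst_smul (c : ℝ≥0∞) (m : Measure ℝ) (s : ℂ) : lst (c • m) s = c.toReal * lst m s := by
  simp [lst, integral_smul_measure]

theorem lst_zero_arg (m : Measure ℝ) : lst m 0 = m.real Set.univ := by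
  simp [lst]

theorem lst_zero_measure (s : ℂ) : lst 0 s = 0 := by simp [lst]

theorem lst_dirac (x : ℝ) (s : ℂ) : lst (Measure.dirac x) s = Complex.exp (-s * x) := by
  simp [lst]

theorem lst_eq_charFun (m : Measure ℝ) {s : ℂ} (hs : s.re = 0) : lst m s = charFun m (-s.im) := by
  have : s = s.im * Complex.I := by apply Complex.ext <;> simp [hs]
  rw [lst, charFun_apply_real]
  congr 1
  funext x
  conv_lhs => rw [this]
  congr 1
  push_cast
  ring

theorem lst_conv (m n : Measure ℝ) [IsFiniteMeasure m] [IsFiniteMeasure n] {s : ℂ}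
    (hs : s.re = 0) : lst (m ∗ n) s = lst m s * lst n s := by
  rw [lst_eq_charFun _ hs, lst_eq_charFun _ hs, lst_eq_charFun _ hs, charFun_conv]

theorem lst_conj (m : Measure ℝ) (s : ℂ) :
    lst m ((starRingEnd ℂ) s) = (starRingEnd ℂ) (lst m s) := by
  rw [lst, lst, ← integral_conj]
  congr 1
  funext x
  rw [← Complex.exp_conj]
  simp

/-- The coefficients with which four positive measures are combined to a complex measure. -/
def quadCoeff : Fin 4 → ℂ := ![1, -1, Complex.I, -Complex.I]

/-- The transform of the complex measure `q 0 - q 1 + i (q 2 - q 3)`. Complex measures are represented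
by quadruples of finite positive measures throughout, as only the latter are pushed forward and
multiplied below; the representation is not unique. -/
def quadLst (q : Fin 4 → Measure ℝ) (s : ℂ) : ℂ := ∑ k, quadCoeff k * lst (q k) s

/-- A finite signed measure whose Fourier transform is a real constant is a multiple of the Dirac
measure at `0`. -/
theorem measure_eq_of_lst_sub_eq_const {a b : Measure ℝ} [IsFiniteMeasure a] [IsFiniteMeasure b]
    {r : ℝ} (h : ∀ s : ℂ, s.re = 0 → lst a s - lst b s = r) :
    a.restrict (Set.Ioi 0) = b.restrict (Set.Ioi 0) := by
  -- One of the two multiples of the Dirac measure is zero, according to the sign of `r`.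
  have key : a + ENNReal.ofReal (-r) • Measure.dirac 0 = b + ENNReal.ofReal r • Measure.dirac 0 := by
    have hfin : ∀ x : ℝ, IsFiniteMeasure (ENNReal.ofReal x • Measure.dirac (0 : ℝ)) :=
      fun x => ⟨by simp⟩
    have := hfin r
    have := hfin (-r)
    refine Measure.ext_of_charFun (funext fun t => ?_)
    have ht : (-(t : ℂ) * Complex.I).re = 0 := by simp
    have him : (-(t : ℂ) * Complex.I).im = -t := by simp
    have h1 := lst_eq_charFun (a + ENNReal.ofReal (-r) • Measure.dirac 0) ht
    have h2 := lst_eq_charFun (b + ENNReal.ofReal r • Measure.dirac 0) ht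
    rw [him, neg_neg] at h1 h2
    rw [← h1, ← h2, lst_add (ae_re_mul_nonneg_of_re_eq_zero _ ht) (ae_re_mul_nonneg_of_re_eq_zero _ ht),
      lst_add (ae_re_mul_nonneg_of_re_eq_zero _ ht) (ae_re_mul_nonneg_of_re_eq_zero _ ht), lst_smul,
      lst_smul, lst_dirac]
    have h3 := h _ ht
    have h4 : ((ENNReal.ofReal r).toReal : ℂ) - (ENNReal.ofReal (-r)).toReal = r := by
      rcases le_total 0 r with h0 | h0
      · rw [ENNReal.toReal_ofReal h0, ENNReal.ofReal_of_nonpos (by linarith)]; simp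
      · rw [ENNReal.toReal_ofReal (by linarith : 0 ≤ -r), ENNReal.ofReal_of_nonpos h0]; simp
    simp only [Complex.ofReal_zero, mul_zero, Complex.exp_zero, mul_one]
    linear_combination h3 - h4
  have h0 : (Measure.dirac (0 : ℝ)).restrict (Set.Ioi 0) = 0 := by
    rw [Measure.restrict_eq_zero]; simp
  have := congrArg (fun m => m.restrict (Set.Ioi 0)) key
  simpa [Measure.restrict_add, Measure.restrict_smul, h0] using this

theorem quadLst_eq (q : Fin 4 → Measure ℝ) (s : ℂ) :
    quadLst q s = (lst (q 0) s - lst (q 1) s) + Complex.I * (lst (q 2) s - lst (q 3) s) := by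
  simp [quadLst, quadCoeff, Fin.sum_univ_four]; ring

theorem measure_eq_of_quadLst_eq_const {q : Fin 4 → Measure ℝ} [∀ k, IsFiniteMeasure (q k)]
    {κ : ℂ} (h : ∀ s : ℂ, s.re = 0 → quadLst q s = κ) :
    (q 0).restrict (Set.Ioi 0) = (q 1).restrict (Set.Ioi 0) ∧
      (q 2).restrict (Set.Ioi 0) = (q 3).restrict (Set.Ioi 0) := by
  have hpair : ∀ s : ℂ, s.re = 0 →
      lst (q 0) s - lst (q 1) s = (κ.re : ℂ) ∧ lst (q 2) s - lst (q 3) s = (κ.im : ℂ) := by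
    intro s hs
    have h1 := h s hs
    have h2 := congrArg (starRingEnd ℂ) (h ((starRingEnd ℂ) s) (by simpa using hs))
    rw [quadLst_eq] at h1 h2
    simp only [map_add, map_mul, map_sub, lst_conj, Complex.conj_conj, Complex.conj_I] at h2
    have hre : (κ.re : ℂ) = (κ + (starRingEnd ℂ) κ) / 2 := by
      rw [Complex.add_conj]; push_cast; ring
    have him : (κ.im : ℂ) * Complex.I = (κ - (starRingEnd ℂ) κ) / 2 := by
      rw [Complex.sub_conj]; push_cast; ring
    constructor
    · rw [hre]; linear_combination (h1 + h2) / 2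
    · apply mul_right_cancel₀ Complex.I_ne_zero
      rw [him]; linear_combination (h1 - h2) / 2
  exact ⟨measure_eq_of_lst_sub_eq_const fun s hs => (hpair s hs).1,
    measure_eq_of_lst_sub_eq_const fun s hs => (hpair s hs).2⟩

theorem continuousOn_quadLst {q : Fin 4 → Measure ℝ} [∀ k, IsFiniteMeasure (q k)]
    (hq : ∀ k, q k (Set.Iio 0) = 0) : ContinuousOn (quadLst q) {s | 0 ≤ s.re} :=
  continuousOn_finsetSum _ fun k _ => continuousOn_const.mul (continuousOn_lst (hq k))

theorem differentiableOn_quadLst {q : Fin 4 → Measure ℝ} [∀ k, IsFiniteMeasure (q k)]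
    (hq : ∀ k, q k (Set.Iio 0) = 0) : DifferentiableOn ℂ (quadLst q) {s | 0 < s.re} :=
  DifferentiableOn.fun_sum fun k _ => (differentiableOn_const _).mul (differentiableOn_lst (hq k))

theorem continuousOn_quadLst_left {q : Fin 4 → Measure ℝ} [∀ k, IsFiniteMeasure (q k)]
    (hq : ∀ k, q k (Set.Ioi 0) = 0) : ContinuousOn (quadLst q) {s | s.re ≤ 0} :=
  continuousOn_finsetSum _ fun k _ => continuousOn_const.mul (continuousOn_lst_left (hq k))

theorem differentiableOn_quadLst_left {q : Fin 4 → Measure ℝ} [∀ k, IsFiniteMeasure (q k)]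
    (hq : ∀ k, q k (Set.Ioi 0) = 0) : DifferentiableOn ℂ (quadLst q) {s | s.re < 0} :=
  DifferentiableOn.fun_sum fun k _ =>
    (differentiableOn_const _).mul (differentiableOn_lst_left (hq k))

theorem norm_quadCoeff (k : Fin 4) : ‖quadCoeff k‖ = 1 := by
  fin_cases k <;> simp [quadCoeff]

theorem norm_quadLst_le {q : Fin 4 → Measure ℝ} [∀ k, IsFiniteMeasure (q k)] {s : ℂ}
    (hq : ∀ k, ∀ᵐ x ∂q k, 0 ≤ s.re * x) : ‖quadLst q s‖ ≤ ∑ k, (q k).real Set.univ := by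
  refine (norm_sum_le _ _).trans (Finset.sum_le_sum fun k _ => ?_)
  rw [norm_mul, norm_quadCoeff, one_mul]
  exact norm_lst_le (hq k)

theorem lst_eq_restrict_add (m : Measure ℝ) [IsFiniteMeasure m] {s : ℂ} (hs : s.re = 0) {A : Set ℝ}
    (hA : MeasurableSet A) : lst m s = lst (m.restrict A) s + lst (m.restrict Aᶜ) s := by
  conv_lhs => rw [← Measure.restrict_add_restrict_compl (μ := m) hA]
  exact lst_add (ae_re_mul_nonneg_of_re_eq_zero _ hs) (ae_re_mul_nonneg_of_re_eq_zero _ hs)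

theorem quadLst_eq_restrict_add (q : Fin 4 → Measure ℝ) [∀ k, IsFiniteMeasure (q k)] {s : ℂ}
    (hs : s.re = 0) {A : Set ℝ} (hA : MeasurableSet A) :
    quadLst q s = quadLst (fun k => (q k).restrict A) s
      + quadLst (fun k => (q k).restrict Aᶜ) s := by
  simp only [quadLst, ← Finset.sum_add_distrib, ← mul_add]
  exact Finset.sum_congr rfl fun k _ => by rw [lst_eq_restrict_add _ hs hA]

/-- If the transform of a complex measure extends from the imaginary axis to a bounded holomorphic
function in the left half-plane, then the measure does not charge `(0, ∞)`: the transform of its part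
on `(0, ∞)` extends to both half-planes, so it is constant. -/
theorem restrict_Ioi_eq_of_quadLst_eq {q : Fin 4 → Measure ℝ} [∀ k, IsFiniteMeasure (q k)]
    {g : ℂ → ℂ} {M : ℝ} (hg : ContinuousOn g {s | s.re ≤ 0})
    (hg' : DifferentiableOn ℂ g {s | s.re < 0}) (hM : ∀ s : ℂ, s.re ≤ 0 → ‖g s‖ ≤ M)
    (h : ∀ s : ℂ, s.re = 0 → quadLst q s = g s) :
    (q 0).restrict (Set.Ioi 0) = (q 1).restrict (Set.Ioi 0) ∧
      (q 2).restrict (Set.Ioi 0) = (q 3).restrict (Set.Ioi 0) := by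
  set q₁ : Fin 4 → Measure ℝ := fun k => (q k).restrict (Set.Ioi 0) with hq₁
  set q₂ : Fin 4 → Measure ℝ := fun k => (q k).restrict (Set.Ioi 0)ᶜ with hq₂
  have h₁ : ∀ k, q₁ k (Set.Iio 0) = 0 := fun k => by
    rw [hq₁, Measure.restrict_apply measurableSet_Iio]
    have : Set.Iio (0 : ℝ) ∩ Set.Ioi 0 = ∅ := by ext x; simp; intro h; linarith
    rw [this]; simp
  have h₂ : ∀ k, q₂ k (Set.Ioi 0) = 0 := fun k => by
    rw [hq₂, Measure.restrict_apply measurableSet_Ioi, Set.inter_compl_self]; simp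
  have hb₁ := fun (s : ℂ) (hs : 0 ≤ s.re) => norm_quadLst_le fun k => ae_re_mul_nonneg (h₁ k) hs
  have hb₂ := fun (s : ℂ) (hs : s.re ≤ 0) => norm_quadLst_le fun k => ae_re_mul_nonneg_left (h₂ k) hs
  set C₁ := ∑ k, (q₁ k).real Set.univ
  set C₂ := ∑ k, (q₂ k).real Set.univ
  have hC₁ : 0 ≤ C₁ := by positivity
  have hC₂ : 0 ≤ C₂ := by positivity
  have hM0 : 0 ≤ M := (norm_nonneg _).trans (hM 0 (by simp))
  obtain ⟨p, hp, hp1, -⟩ := Complex.exists_polynomial_of_halfPlanes (n := 0) (M := C₁ + (M + C₂))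
    (continuousOn_quadLst h₁) (differentiableOn_quadLst h₁)
    (hg.sub (continuousOn_quadLst_left h₂)) (hg'.sub (differentiableOn_quadLst_left h₂))
    (fun s hs => by
      have := quadLst_eq_restrict_add q hs (measurableSet_Ioi (a := (0 : ℝ)))
      simp only [Pi.sub_apply, ← h s hs, this, hq₁, hq₂]; ring)
    (fun s hs => by have := hb₁ s hs; simp only [pow_zero, mul_one]; linarith)
    (fun s hs => by
      have := hb₂ s hs
      have := hM s hs
      have := norm_sub_le (g s) (quadLst q₂ s)
      simp only [pow_zero, mul_one, Pi.sub_apply]; linarith)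
  have hconst : ∀ s : ℂ, s.re = 0 → quadLst q₁ s = p.coeff 0 := fun s hs => by
    rw [hp1 s hs.ge, eq_C_of_natDegree_le_zero hp]; simp
  have := measure_eq_of_quadLst_eq_const hconst
  simpa [hq₁, Measure.restrict_restrict] using this

theorem quadLst_map_neg (q : Fin 4 → Measure ℝ) (s : ℂ) :
    quadLst (fun k => (q k).map (fun x => -x)) s = quadLst q (-s) := by
  simp [quadLst, lst_map_neg]

/-- The mirror image of `restrict_Ioi_eq_of_quadLst_eq`. -/
theorem restrict_Iio_eq_of_quadLst_eq {q : Fin 4 → Measure ℝ} [∀ k, IsFiniteMeasure (q k)]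
    {g : ℂ → ℂ} {M : ℝ} (hg : ContinuousOn g {s | 0 ≤ s.re})
    (hg' : DifferentiableOn ℂ g {s | 0 < s.re}) (hM : ∀ s : ℂ, 0 ≤ s.re → ‖g s‖ ≤ M)
    (h : ∀ s : ℂ, s.re = 0 → quadLst q s = g s) :
    (q 0).restrict (Set.Iio 0) = (q 1).restrict (Set.Iio 0) ∧
      (q 2).restrict (Set.Iio 0) = (q 3).restrict (Set.Iio 0) := by
  have hmain := restrict_Ioi_eq_of_quadLst_eq (q := fun k => (q k).map (fun x => -x))
    (g := fun s => g (-s)) (M := M)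
    (hg.comp (f := fun s : ℂ => -s) (by fun_prop) (fun s (hs : s.re ≤ 0) => by simpa using hs))
    (hg'.comp (f := fun s : ℂ => -s) (by fun_prop) (fun s (hs : s.re < 0) => by simpa using hs))
    (fun s hs => hM (-s) (by simpa using hs))
    (fun s hs => by rw [quadLst_map_neg]; exact h _ (by simpa using hs))
  have hback : ∀ a b : Measure ℝ, (a.map (fun x => -x)).restrict (Set.Ioi 0)
      = (b.map (fun x => -x)).restrict (Set.Ioi 0) →
      a.restrict (Set.Iio 0) = b.restrict (Set.Iio 0) := by
    intro a b hab
    have h2 := congrArg (fun m : Measure ℝ => m.map (fun x => -x)) hab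
    have hrw : ∀ m : Measure ℝ, ((m.map (fun x => -x)).restrict (Set.Ioi 0)).map (fun x => -x)
        = m.restrict (Set.Iio 0) := by
      intro m
      rw [Measure.restrict_map (by fun_prop) measurableSet_Ioi,
        Measure.map_map (by fun_prop) (by fun_prop)]
      have : ((fun x : ℝ => -x) ∘ fun x => -x) = id := by funext x; simp
      rw [this, Measure.map_id]
      congr 1
      ext x; simp
    simpa [hrw] using h2
  exact ⟨hback _ _ hmain.1, hback _ _ hmain.2⟩

/-- Bounded holomorphic functions in the right half-plane are determined by their boundary values. -/
theorem eqOn_rightHalfPlane {f g : ℂ → ℂ} {M : ℝ} (hf : ContinuousOn f {s | 0 ≤ s.re})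
    (hf' : DifferentiableOn ℂ f {s | 0 < s.re}) (hg : ContinuousOn g {s | 0 ≤ s.re})
    (hg' : DifferentiableOn ℂ g {s | 0 < s.re}) (hfM : ∀ s : ℂ, 0 ≤ s.re → ‖f s‖ ≤ M)
    (hgM : ∀ s : ℂ, 0 ≤ s.re → ‖g s‖ ≤ M) (h : ∀ s : ℂ, s.re = 0 → f s = g s) :
    ∀ s : ℂ, 0 ≤ s.re → f s = g s := by
  have hM0 : 0 ≤ M := (norm_nonneg _).trans (hfM 0 (by simp))
  obtain ⟨p, hp, hp1, hp2⟩ := Complex.exists_polynomial_of_halfPlanes (n := 0) (M := M + M)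
    (hf.sub hg) (hf'.sub hg') (g := fun _ => 0) continuousOn_const (differentiableOn_const _)
    (fun s hs => by simp [h s hs])
    (fun s hs => by
      have := norm_sub_le (f s) (g s)
      have := hfM s hs
      have := hgM s hs
      simp only [pow_zero, mul_one, Pi.sub_apply]; linarith)
    (fun s hs => by simp; linarith)
  intro s hs
  have h0 : p = C (p.coeff 0) := eq_C_of_natDegree_le_zero hp
  have h1 := hp1 s hs
  have h2 := hp2 0 (by simp)
  rw [h0] at h1 h2
  simp only [eval_C] at h1 h2
  rw [← h2] at h1
  exact sub_eq_zero.1 h1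

/-- The transforms, on the imaginary axis, of the finite complex measures, as a subspace of the
functions on the line. -/
def signedTransforms : Submodule ℂ (ℝ → ℂ) :=
  Submodule.span ℂ {f | ∃ m : Measure ℝ, IsFiniteMeasure m ∧
    f = fun t : ℝ => lst m (t * Complex.I)}

theorem ofReal_mul_I_re (t : ℝ) : ((t : ℂ) * Complex.I).re = 0 := by simp

theorem one_mem_signedTransforms : (1 : ℝ → ℂ) ∈ signedTransforms :=
  Submodule.subset_span ⟨Measure.dirac 0, inferInstance, by funext t; simp [lst_dirac]⟩

theorem mul_mem_signedTransforms {f g : ℝ → ℂ} (hf : f ∈ signedTransforms)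
    (hg : g ∈ signedTransforms) : f * g ∈ signedTransforms := by
  have h := Submodule.mul_mem_mul hf hg
  rw [signedTransforms, Submodule.span_mul_span] at h
  refine Submodule.span_mono ?_ h
  rintro _ ⟨_, ⟨m, hm, rfl⟩, _, ⟨n, hn, rfl⟩, rfl⟩
  exact ⟨m ∗ n, inferInstance, funext fun t => (lst_conv m n (ofReal_mul_I_re t)).symm⟩

/-- The transforms of the finite complex measures form an algebra, by convolution. -/
def signedTransformAlgebra : Subalgebra ℂ (ℝ → ℂ) :=
  signedTransforms.toSubalgebra one_mem_signedTransforms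
    fun _ _ hf hg => mul_mem_signedTransforms hf hg

theorem exists_quadLst_of_mem {f : ℝ → ℂ} (hf : f ∈ signedTransforms) :
    ∃ q : Fin 4 → Measure ℝ, (∀ k, IsFiniteMeasure (q k)) ∧
      ∀ t : ℝ, f t = quadLst q (t * Complex.I) := by
  have hlin : ∀ (m n : Measure ℝ) [IsFiniteMeasure m] [IsFiniteMeasure n] (t : ℝ),
      lst (m + n) (t * Complex.I) = lst m (t * Complex.I) + lst n (t * Complex.I) :=
    fun m n _ _ t => lst_add (ae_re_mul_nonneg_of_re_eq_zero _ (ofReal_mul_I_re t))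
      (ae_re_mul_nonneg_of_re_eq_zero _ (ofReal_mul_I_re t))
  refine Submodule.span_induction ?_ ?_ ?_ ?_ hf
  · rintro _ ⟨m, hm, rfl⟩
    refine ⟨![m, 0, 0, 0], fun k => ?_, fun t => by simp [quadLst_eq, lst_zero_measure]⟩
    fin_cases k <;> simp <;> infer_instance
  · exact ⟨fun _ => 0, fun _ => inferInstance, fun t => by simp [quadLst_eq]⟩
  · rintro f g - - ⟨q, hq, hfq⟩ ⟨r, hr, hgr⟩
    refine ⟨fun k => q k + r k, fun k => inferInstance, fun t => ?_⟩
    simp only [Pi.add_apply, hfq, hgr, quadLst_eq, hlin]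
    ring
  · rintro c f - ⟨q, hq, hfq⟩
    set x : ℝ≥0∞ := ENNReal.ofReal c.re with hx
    set x' : ℝ≥0∞ := ENNReal.ofReal (-c.re) with hx'
    set y : ℝ≥0∞ := ENNReal.ofReal c.im with hy
    set y' : ℝ≥0∞ := ENNReal.ofReal (-c.im) with hy'
    have hsm : ∀ (r : ℝ) (k : Fin 4), IsFiniteMeasure (ENNReal.ofReal r • q k) := fun r k =>
      (q k).smul_finite ENNReal.ofReal_ne_top
    have := hsm c.re
    have := hsm (-c.re)
    have := hsm c.im
    have := hsm (-c.im)
    refine ⟨![x • q 0 + x' • q 1 + y • q 3 + y' • q 2, x • q 1 + x' • q 0 + y • q 2 + y' • q 3,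
      x • q 2 + x' • q 3 + y • q 0 + y' • q 1, x • q 3 + x' • q 2 + y • q 1 + y' • q 0],
      fun k => ?_, fun t => ?_⟩
    · fin_cases k <;> simp <;> infer_instance
    · have hdiff : ∀ r : ℝ, ((ENNReal.ofReal r).toReal : ℂ) - (ENNReal.ofReal (-r)).toReal = r := by
        intro r
        rcases le_total 0 r with h0 | h0
        · rw [ENNReal.toReal_ofReal h0, ENNReal.ofReal_of_nonpos (by linarith)]; simp
        · rw [ENNReal.toReal_ofReal (by linarith : 0 ≤ -r), ENNReal.ofReal_of_nonpos h0]; simp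
      have hre := hdiff c.re
      have him := hdiff c.im
      simp only [Pi.smul_apply, smul_eq_mul, hfq, quadLst_eq, Matrix.cons_val_zero,
        Matrix.cons_val_one, Matrix.cons_val, hx, hx', hy, hy']
      rw [hlin, hlin, hlin, hlin, hlin, hlin, hlin, hlin, hlin, hlin, hlin, hlin]
      simp only [lst_smul]
      conv_lhs => rw [← Complex.re_add_im c]
      rw [← hre, ← him]
      linear_combination (-(((ENNReal.ofReal c.im).toReal : ℂ) - (ENNReal.ofReal (-c.im)).toReal)
        * (lst (q 2) (t * Complex.I) - lst (q 3) (t * Complex.I))) * (-Complex.I_sq)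

theorem integral_density_mem_signedTransforms {h : ℝ → ℂ} (hh : Integrable h) :
    (fun t : ℝ => ∫ x : ℝ, Complex.exp (-(t * Complex.I) * x) * h x) ∈ signedTransforms := by
  have hreal : ∀ g : ℝ → ℝ, Integrable g →
      (fun t : ℝ => ∫ x : ℝ, Complex.exp (-(t * Complex.I) * x) * (max (g x) 0 : ℝ))
        ∈ signedTransforms := by
    intro g hg
    have hg' : AEMeasurable (fun x => ENNReal.ofReal (g x)) := hg.1.aemeasurable.ennreal_ofReal
    refine Submodule.subset_span ⟨volume.withDensity fun x => ENNReal.ofReal (g x),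
      isFiniteMeasure_withDensity_ofReal hg.2, funext fun t => ?_⟩
    rw [lst, integral_withDensity_eq_integral_toReal_smul₀ hg'
      (Eventually.of_forall fun _ => ENNReal.ofReal_lt_top)]
    refine integral_congr_ae (Eventually.of_forall fun x => ?_)
    simp only [Complex.real_smul]
    rw [mul_comm]
    congr 2
  have hint : ∀ g : ℝ → ℝ, Integrable g → ∀ t : ℝ,
      Integrable fun x : ℝ => Complex.exp (-(t * Complex.I) * x) * (max (g x) 0 : ℝ) := by
    intro g hg t
    refine (hg.pos_part.ofReal (𝕜 := ℂ)).bdd_mul (c := 1)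
      (Continuous.aestronglyMeasurable (by fun_prop)) (Eventually.of_forall fun x => ?_)
    exact norm_exp_neg_mul_ofReal_le_one (by simp)
  have e := signedTransforms.sub_mem (hreal _ hh.re) (hreal _ hh.re.neg)
  have e' := signedTransforms.smul_mem Complex.I
    (signedTransforms.sub_mem (hreal _ hh.im) (hreal _ hh.im.neg))
  convert signedTransforms.add_mem e e' using 1
  funext t
  simp only [Pi.add_apply, Pi.sub_apply, Pi.smul_apply, smul_eq_mul]
  rw [← integral_sub (hint _ hh.re t) (hint _ hh.re.neg t),
    ← integral_sub (hint _ hh.im t) (hint _ hh.im.neg t), ← integral_const_mul,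
    ← integral_add (f := fun x : ℝ => Complex.exp (-(t * Complex.I) * x) * _
        - Complex.exp (-(t * Complex.I) * x) * _)
      (g := fun x : ℝ => Complex.I * (Complex.exp (-(t * Complex.I) * x) * _
        - Complex.exp (-(t * Complex.I) * x) * _))
      ((hint _ hh.re t).sub (hint _ hh.re.neg t))
      (((hint _ hh.im t).sub (hint _ hh.im.neg t)).const_mul _)]
  refine integral_congr_ae (Eventually.of_forall fun x => ?_)
  have hpart : ∀ r : ℝ, ((max r 0 : ℝ) : ℂ) - (max (-r) 0 : ℝ) = r := by
    intro r
    rw [← Complex.ofReal_sub, max_zero_sub_max_neg_zero_eq_self]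
  have h1 := hpart (h x).re
  have h2 := hpart (h x).im
  simp only [Pi.neg_apply, RCLike.re_to_complex, RCLike.im_to_complex]
  conv_lhs => rw [← Complex.re_add_im (h x), ← h1, ← h2]
  ring

/-- For `Re z ≠ 0` the function `1 / (s - z)` is the transform of an exponential density, carried by
the half-line on which it is integrable. -/
theorem inv_sub_mem_signedTransforms {z : ℂ} (hz : z.re ≠ 0) :
    (fun t : ℝ => ((t : ℂ) * Complex.I - z)⁻¹) ∈ signedTransforms := by
  have hrw : ∀ (A : Set ℝ) (t x : ℝ), MeasurableSet A →
      Complex.exp (-(t * Complex.I) * x) * A.indicator (fun x : ℝ => Complex.exp (z * x)) x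
        = A.indicator (fun x : ℝ => Complex.exp ((z - t * Complex.I) * x)) x := by
    intro A t x hA
    by_cases hx : x ∈ A
    · simp only [Set.indicator_of_mem hx, ← Complex.exp_add]; congr 1; ring
    · simp [Set.indicator_of_notMem hx]
  rcases lt_or_gt_of_ne hz with h | h
  · have h1 := integral_density_mem_signedTransforms
      ((integrable_indicator_iff measurableSet_Ioi).2 (integrableOn_exp_mul_complex_Ioi h 0))
    convert h1 using 1
    funext t
    simp_rw [hrw _ t _ measurableSet_Ioi]
    rw [integral_indicator measurableSet_Ioi, integral_exp_mul_complex_Ioi (by simpa using h)]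
    simp only [Complex.ofReal_zero, mul_zero, Complex.exp_zero]
    rw [← neg_sub z, inv_neg, neg_div, one_div]
  · have h1 := signedTransforms.neg_mem (integral_density_mem_signedTransforms
      ((integrable_indicator_iff measurableSet_Iic).2 (integrableOn_exp_mul_complex_Iic h 0)))
    convert h1 using 1
    funext t
    simp only [Pi.neg_apply]
    simp_rw [hrw _ t _ measurableSet_Iic]
    rw [integral_indicator measurableSet_Iic, integral_exp_mul_complex_Iic (by simpa using h)]
    simp only [Complex.ofReal_zero, mul_zero, Complex.exp_zero]
    rw [← neg_sub z, inv_neg, one_div]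

/-- A rational function that is bounded at infinity and has no pole on the imaginary axis is, on this
axis, the transform of a finite complex measure. -/
theorem exists_quadLst_of_rational {κ : Type*} (K : Finset κ) (z : κ → ℂ)
    (hz : ∀ k ∈ K, (z k).re ≠ 0) (f : ℂ[X]) (hf : f.natDegree ≤ K.card) :
    ∃ q : Fin 4 → Measure ℝ, (∀ k, IsFiniteMeasure (q k)) ∧
      ∀ s : ℂ, s.re = 0 → f.eval s / ∏ k ∈ K, (s - z k) = quadLst q s := by
  have := Subalgebra.eval_div_prod_mem signedTransformAlgebra (fun t : ℝ => (t : ℂ) * Complex.I) K z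
    (fun k hk t h => hz k hk (by rw [← h]; simp))
    (fun k hk => inv_sub_mem_signedTransforms (hz k hk)) f hf
  obtain ⟨q, hq, h⟩ := exists_quadLst_of_mem this
  refine ⟨q, hq, fun s hs => ?_⟩
  have hs' : (s.im : ℂ) * Complex.I = s := by apply Complex.ext <;> simp [hs]
  simpa [hs'] using h s.im

/-! ### The kernel of the functional equation -/

theorem Matrix.det_one_sub_ne_zero {ι : Type*} [Fintype ι] [DecidableEq ι] {B : Matrix ι ι ℂ}
    (h : ∀ i, ∑ j, ‖B j i‖ < 1) : (1 - B).det ≠ 0 := by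
  refine det_ne_zero_of_sum_col_lt_diag fun i => ?_
  have h1 : ∑ j ∈ Finset.univ.erase i, ‖(1 - B) j i‖ = ∑ j ∈ Finset.univ.erase i, ‖B j i‖ := by
    refine Finset.sum_congr rfl fun j hj => ?_
    rw [Matrix.sub_apply, Matrix.one_apply_ne (Finset.ne_of_mem_erase hj)]; simp
  have h2 := Finset.add_sum_erase Finset.univ (fun j => ‖B j i‖) (Finset.mem_univ i)
  have h3 : 1 - ‖B i i‖ ≤ ‖(1 - B) i i‖ := by
    rw [Matrix.sub_apply, Matrix.one_apply_eq]
    simpa using norm_sub_norm_le (1 : ℂ) (B i i)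
  have := h i
  have h4 : ‖B i i‖ + ∑ j ∈ Finset.univ.erase i, ‖B j i‖ = ∑ j, ‖B j i‖ := h2
  rw [h1]
  linarith

theorem Matrix.sum_norm_mulVec_le {ι : Type*} [Fintype ι] {B : Matrix ι ι ℂ} {κ : ℝ}
    (h : ∀ i, ∑ j, ‖B j i‖ ≤ κ) (x : ι → ℂ) : ∑ j, ‖(B *ᵥ x) j‖ ≤ κ * ∑ j, ‖x j‖ := by
  calc ∑ j, ‖(B *ᵥ x) j‖ ≤ ∑ j, ∑ i, ‖B j i‖ * ‖x i‖ := by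
        refine Finset.sum_le_sum fun j _ => (norm_sum_le _ _).trans (Finset.sum_le_sum fun i _ => ?_)
        rw [norm_mul]
    _ = ∑ i, (∑ j, ‖B j i‖) * ‖x i‖ := by
        rw [Finset.sum_comm]; simp_rw [Finset.sum_mul]
    _ ≤ ∑ i, κ * ‖x i‖ := Finset.sum_le_sum fun i _ => by gcongr; exact h i
    _ = _ := by rw [Finset.mul_sum]

namespace ModelI

variable {N : ℕ} (M : ModelI N)

theorem P_nonneg (i j : Fin N) : 0 ≤ M.P i j := M.P_irreducible.nonneg i j

theorem p₃_pos : 0 < M.p₃ := by have := M.p_lt; unfold p₃; linarith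

theorem DB_eval (i : Fin N) (s : ℂ) : (M.DB i).eval s = ∏ k, (s - M.t i k) := by
  simp [DB, eval_prod]

theorem DA_eval (j : Fin N) (s : ℂ) : (M.DA j).eval s = ∏ r, (s - M.u j r) := by
  simp [DA, eval_prod]

theorem DB_monic (i : Fin N) : (M.DB i).Monic := by
  unfold DB
  apply monic_prod_of_monic
  intro k _
  exact monic_X_sub_C _

theorem DA_monic (i : Fin N) : (M.DA i).Monic := by
  unfold DA
  apply monic_prod_of_monic
  intro k _
  exact monic_X_sub_C _

theorem DB_natDegree (i : Fin N) : (M.DB i).natDegree = M.m i := by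
  rw [DB, natDegree_prod_of_monic _ _ fun k _ => monic_X_sub_C (M.t i k)]
  simp

theorem DA_natDegree (i : Fin N) : (M.DA i).natDegree = M.l i := by
  rw [DA, natDegree_prod_of_monic _ _ fun k _ => monic_X_sub_C (M.u i k)]
  simp

theorem DB_eval_ne_zero (i : Fin N) {s : ℂ} (hs : 0 ≤ s.re) : (M.DB i).eval s ≠ 0 := by
  rw [DB_eval, Finset.prod_ne_zero_iff]
  intro k _ h
  have := M.t_re i k
  rw [← sub_eq_zero.1 h] at this
  linarith

theorem DA_eval_neg_ne_zero (j : Fin N) {s : ℂ} (hs : s.re ≤ 0) : (M.DA j).eval (-s) ≠ 0 := by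
  rw [DA_eval, Finset.prod_ne_zero_iff]
  intro k _ h
  have := M.u_re j k
  rw [← sub_eq_zero.1 h] at this
  simp at this
  linarith

theorem lst_lawS (i : Fin N) {s : ℂ} (hs : 0 ≤ s.re) :
    lst (M.lawS i) s = (M.NB i).eval s / (M.DB i).eval s := M.lst_S i s hs

theorem lst_lawA (j : Fin N) {s : ℂ} (hs : 0 ≤ s.re) :
    lst (M.lawA j) s = (M.NA j).eval s / (M.DA j).eval s := M.lst_A j s hs

theorem norm_lst_lawS_le (i : Fin N) {s : ℂ} (hs : 0 ≤ s.re) : ‖lst (M.lawS i) s‖ ≤ 1 := by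
  have := M.lawS_prob i
  simpa using norm_lst_le (ae_re_mul_nonneg (M.lawS_nonneg i) hs)

theorem norm_lst_lawA_le (i : Fin N) {s : ℂ} (hs : 0 ≤ s.re) : ‖lst (M.lawA i) s‖ ≤ 1 := by
  have := M.lawA_prob i
  simpa using norm_lst_le (ae_re_mul_nonneg (M.lawA_nonneg i) hs)

theorem NB_natDegree_le (i : Fin N) : (M.NB i).natDegree ≤ M.m i := by
  rw [← M.DB_natDegree i]
  refine natDegree_le_of_norm_le fun r hr => ?_
  have h := M.norm_lst_lawS_le i (s := r) (by simpa using hr)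
  have hne := M.DB_eval_ne_zero i (s := r) (by simpa using hr)
  rw [M.lst_lawS i (by simpa using hr), norm_div, div_le_one (norm_pos_iff.2 hne)] at h
  exact h

theorem NA_natDegree_le (i : Fin N) : (M.NA i).natDegree ≤ M.l i := by
  rw [← M.DA_natDegree i]
  refine natDegree_le_of_norm_le fun r hr => ?_
  have h := M.norm_lst_lawA_le i (s := r) (by simpa using hr)
  have hne := M.DA_eval_neg_ne_zero i (s := -r) (by simpa using hr)
  rw [neg_neg] at hne
  rw [M.lst_lawA i (by simpa using hr), norm_div, div_le_one (norm_pos_iff.2 hne)] at h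
  exact h

theorem H_apply (s : ℂ) (i j : Fin N) : M.H s i j =
    ((M.NB i).eval s * (M.NA j).eval (-s)) / ((M.DB i).eval s * (M.DA j).eval (-s)) := rfl

theorem F_apply (s : ℂ) (j i : Fin N) : M.F s j i = (M.P i j : ℂ) * M.H s i j := by
  simp [F, Matrix.hadamard]

theorem H_eq_lst {s : ℂ} (hs : s.re = 0) (i j : Fin N) :
    M.H s i j = lst (M.lawS i) s * lst (M.lawA j) (-s) := by
  rw [M.lst_lawS i hs.ge, M.lst_lawA j (by simp [hs]), H_apply, mul_div_mul_comm]

theorem norm_H_le_one {s : ℂ} (hs : s.re = 0) (i j : Fin N) : ‖M.H s i j‖ ≤ 1 := by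
  rw [M.H_eq_lst hs, norm_mul]
  exact mul_le_one₀ (M.norm_lst_lawS_le i hs.ge) (norm_nonneg _)
    (M.norm_lst_lawA_le j (by simp [hs]))

theorem H_zero (i j : Fin N) : M.H 0 i j = 1 := by
  have := M.lawS_prob i
  have := M.lawA_prob j
  rw [M.H_eq_lst (by simp), neg_zero, lst_zero_arg, lst_zero_arg]
  simp

/-- The limit of the matrix `H` at infinity. -/
def Hinf : Matrix (Fin N) (Fin N) ℂ := Matrix.of fun i j =>
  (M.NB i).coeff (M.m i) * (M.NA j).coeff (M.l j)

theorem tendsto_H (i j : Fin N) :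
    Tendsto (fun s => M.H s i j) (Bornology.cobounded ℂ) (𝓝 (M.Hinf i j)) := by
  have hneg : Tendsto (fun s : ℂ => -s) (Bornology.cobounded ℂ) (Bornology.cobounded ℂ) := by
    rw [← tendsto_norm_atTop_iff_cobounded]
    simpa using tendsto_norm_cobounded_atTop (E := ℂ)
  have h1 := (M.NB i).tendsto_eval_div_pow (M.NB_natDegree_le i)
  have h2 := ((M.NA j).tendsto_eval_div_pow (M.NA_natDegree_le j)).comp hneg
  have h3 := (M.DB i).tendsto_eval_div_pow (M.DB_natDegree i).le
  have h4 := ((M.DA j).tendsto_eval_div_pow (M.DA_natDegree j).le).comp hneg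
  have c3 : (M.DB i).coeff (M.m i) = 1 := by
    have := (M.DB_monic i).coeff_natDegree; rwa [DB_natDegree] at this
  have c4 : (M.DA j).coeff (M.l j) = 1 := by
    have := (M.DA_monic j).coeff_natDegree; rwa [DA_natDegree] at this
  rw [c3] at h3
  rw [c4] at h4
  have h5 := (h1.mul h2).div (h3.mul h4) (by simp)
  have hlim : (M.NB i).coeff (M.m i) * (M.NA j).coeff (M.l j) / (1 * 1) = M.Hinf i j := by
    simp [Hinf]
  rw [hlim] at h5
  refine h5.congr' ?_
  filter_upwards [Bornology.eventually_ne_cobounded (0 : ℂ)] with s hs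
  have hs' : -s ≠ 0 := neg_ne_zero.2 hs
  simp only [Pi.div_apply, Function.comp, H_apply]
  have e1 : s ^ M.m i ≠ 0 := pow_ne_zero _ hs
  have e2 : (-s) ^ M.l j ≠ 0 := pow_ne_zero _ hs'
  rw [div_mul_div_comm, div_mul_div_comm, div_div_div_cancel_right₀ (mul_ne_zero e1 e2)]

/-- The limit of `H` may be computed along the imaginary axis, where `H` consists of characteristic
functions. -/
theorem norm_Hinf_le_one (i j : Fin N) : ‖M.Hinf i j‖ ≤ 1 := by
  have hI : Tendsto (fun r : ℝ => (r : ℂ) * Complex.I) atTop (Bornology.cobounded ℂ) := by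
    rw [← tendsto_norm_atTop_iff_cobounded]
    simpa using tendsto_abs_atTop_atTop
  exact le_of_tendsto ((M.tendsto_H i j).comp hI).norm
    (Eventually.of_forall fun r => M.norm_H_le_one (by simp) i j)

/-- A bound, larger than `1`, for the entries of `H` under which the recursion `Φ(s) = R(s)Φ(as) + Ṽ(s)`
is still a contraction: `kap * (p₁ + p₂) < 1`. -/
def kap : ℝ := 2 / (1 + M.p₁ + M.p₂)

theorem one_lt_kap : 1 < M.kap := by
  have := M.p₁_pos; have := M.p₂_pos; have := M.p_lt
  rw [kap, lt_div_iff₀ (by linarith)]; linarith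

theorem kap_mul_lt : M.kap * (M.p₁ + M.p₂) < 1 := by
  have := M.p₁_pos; have := M.p₂_pos; have := M.p_lt
  rw [kap, div_mul_eq_mul_div, div_lt_one (by linarith)]; linarith

theorem kap_mul_p₁_lt : M.kap * M.p₁ < 1 := by
  have := M.kap_mul_lt; have := M.one_lt_kap; have := M.p₂_pos
  nlinarith [mul_pos (by linarith : 0 < M.kap) M.p₂_pos]

/-- The factor by which `R(s)` contracts the `ℓ¹` norm where the entries of `H(s)` are bounded by
`kap`. -/
def ratio : ℝ := M.kap * M.p₂ / (1 - M.kap * M.p₁)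

theorem ratio_nonneg : 0 ≤ M.ratio := by
  have := M.kap_mul_p₁_lt; have := M.one_lt_kap; have := M.p₂_pos
  exact div_nonneg (mul_nonneg (by linarith) (by linarith)) (by linarith)

theorem ratio_lt_one : M.ratio < 1 := by
  have := M.kap_mul_p₁_lt; have := M.kap_mul_lt
  rw [ratio, div_lt_one (by linarith)]; linarith

theorem sum_norm_F_le {s : ℂ} {κ : ℝ} (h : ∀ i j, ‖M.H s i j‖ ≤ κ) (i : Fin N) :
    ∑ j, ‖M.F s j i‖ ≤ κ := by
  calc ∑ j, ‖M.F s j i‖ ≤ ∑ j, M.P i j * κ := Finset.sum_le_sum fun j _ => by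
        rw [F_apply, norm_mul, Complex.norm_real, Real.norm_of_nonneg (M.P_nonneg i j)]
        exact mul_le_mul_of_nonneg_left (h i j) (M.P_nonneg i j)
    _ = κ := by rw [← Finset.sum_mul, M.P_row, one_mul]

theorem det_ne_zero_of_norm_H_le {s : ℂ} (h : ∀ i j, ‖M.H s i j‖ ≤ M.kap) {r : ℝ} (hr0 : 0 ≤ r)
    (hr : r ≤ M.p₁) : (1 - (r : ℂ) • M.F s).det ≠ 0 := by
  refine Matrix.det_one_sub_ne_zero fun i => ?_
  simp only [Matrix.smul_apply, norm_smul, Complex.norm_real, Real.norm_of_nonneg hr0]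
  rw [← Finset.mul_sum]
  have h1 := M.sum_norm_F_le h i
  have h2 := M.kap_mul_p₁_lt
  have h3 := M.one_lt_kap
  calc r * ∑ j, ‖M.F s j i‖ ≤ M.p₁ * M.kap :=
        mul_le_mul hr h1 (Finset.sum_nonneg fun _ _ => norm_nonneg _) M.p₁_pos.le
    _ < 1 := by linarith

/-- The basic contraction estimate. Since the rows of `P` sum to `1`, the operator norm of `F(s)` on
`ℓ¹` is at most `kap`, and the term with `y` can be absorbed on the left. -/
theorem sum_norm_le_of_eq {s : ℂ} (h : ∀ i j, ‖M.H s i j‖ ≤ M.kap) {x y w : Fin N → ℂ}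
    (hy : y = (M.p₁ : ℂ) • (M.F s *ᵥ y) + (M.p₂ : ℂ) • (M.F s *ᵥ x) + w) :
    ∑ j, ‖y j‖ ≤ M.ratio * ∑ j, ‖x j‖ + (1 - M.kap * M.p₁)⁻¹ * ∑ j, ‖w j‖ := by
  have hF := Matrix.sum_norm_mulVec_le (M.sum_norm_F_le h)
  have h0 := M.kap_mul_p₁_lt
  have h1 : ∑ j, ‖y j‖ ≤ M.p₁ * (M.kap * ∑ j, ‖y j‖) + M.p₂ * (M.kap * ∑ j, ‖x j‖)
      + ∑ j, ‖w j‖ := by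
    calc ∑ j, ‖y j‖ ≤ ∑ j, (M.p₁ * ‖(M.F s *ᵥ y) j‖ + M.p₂ * ‖(M.F s *ᵥ x) j‖ + ‖w j‖) := by
          refine Finset.sum_le_sum fun j _ => ?_
          have := congrFun hy j
          rw [this]
          refine (norm_add_le _ _).trans (add_le_add_left ((norm_add_le _ _).trans ?_) _)
          simp only [Pi.smul_apply, norm_smul, Complex.norm_real,
            Real.norm_of_nonneg M.p₁_pos.le, Real.norm_of_nonneg M.p₂_pos.le]
          exact le_rfl
      _ ≤ _ := by
          rw [Finset.sum_add_distrib, Finset.sum_add_distrib, ← Finset.mul_sum, ← Finset.mul_sum]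
          gcongr
          · exact M.p₁_pos.le
          · exact hF y
          · exact M.p₂_pos.le
          · exact hF x
  have hpos : 0 < 1 - M.kap * M.p₁ := by linarith
  rw [ratio, div_mul_eq_mul_div, inv_mul_eq_div, ← add_div, le_div_iff₀ hpos]
  linarith

theorem regular_of_re_eq_zero {s : ℂ} (hs : s.re = 0) : s ∈ M.regular :=
  ⟨hs.ge, fun j => M.DA_eval_neg_ne_zero j hs.le⟩

theorem Om_of_norm_H_le {s : ℂ} (hs : s ∈ M.regular) (h : ∀ i j, ‖M.H s i j‖ ≤ M.kap) :
    s ∈ M.Om := ⟨hs, M.det_ne_zero_of_norm_H_le h M.p₁_pos.le le_rfl⟩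

theorem Om_of_re_eq_zero {s : ℂ} (hs : s.re = 0) : s ∈ M.Om :=
  M.Om_of_norm_H_le (M.regular_of_re_eq_zero hs) fun i j =>
    (M.norm_H_le_one hs i j).trans M.one_lt_kap.le

theorem continuousAt_H {s : ℂ} (hs : s ∈ M.regular) (i j : Fin N) :
    ContinuousAt (fun s => M.H s i j) s := by
  simp only [H_apply]
  refine ContinuousAt.div ?_ ?_ (mul_ne_zero (M.DB_eval_ne_zero i hs.1) (hs.2 j))
  · exact (Continuous.mul (M.NB i).continuous ((M.NA j).continuous.comp continuous_neg)).continuousAt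
  · exact (Continuous.mul (M.DB i).continuous ((M.DA j).continuous.comp continuous_neg)).continuousAt

theorem den_eq (j : Fin N) (s : ℂ) :
    M.den j s = (∏ r, (-s - M.u j r)) * ∏ k, ∏ q, (s - M.t k q) := by
  simp [den, DA_eval, DB_eval]

theorem den_ne_zero {s : ℂ} (hs : s ∈ M.regular) (j : Fin N) : M.den j s ≠ 0 :=
  mul_ne_zero (hs.2 j) (Finset.prod_ne_zero_iff.2 fun k _ => M.DB_eval_ne_zero k hs.1)

theorem continuous_den (j : Fin N) : Continuous (M.den j) := by
  unfold den
  exact ((M.DA j).continuous.comp continuous_neg).mul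
    (continuous_finsetProd _ fun k _ => (M.DB k).continuous)

theorem continuous_num (c : M.Coeffs) (j : Fin N) : Continuous (M.num c j) := by
  unfold num; fun_prop

theorem continuousAt_v (c : M.Coeffs) {s : ℂ} (hs : s ∈ M.regular) (j : Fin N) :
    ContinuousAt (fun s => M.v c s j) s :=
  (M.continuous_num c j).continuousAt.div (M.continuous_den j).continuousAt (M.den_ne_zero hs j)

/-- At `0` the entries of `H` are equal to `1 < kap`, so they are bounded by `kap` near `0`. -/
theorem exists_radius (c : M.Coeffs) : ∃ ρ > 0, ∃ B, ∀ s : ℂ, ‖s‖ < ρ →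
    (∀ j, (M.DA j).eval (-s) ≠ 0) ∧ (∀ i j, ‖M.H s i j‖ ≤ M.kap) ∧ ∑ j, ‖M.v c s j‖ ≤ B := by
  have h0 : (0 : ℂ) ∈ M.regular := M.regular_of_re_eq_zero (by simp)
  have e1 : ∀ᶠ s : ℂ in 𝓝 0, ∀ j, (M.DA j).eval (-s) ≠ 0 :=
    eventually_all.2 fun j =>
      ((M.DA j).continuous.comp continuous_neg).continuousAt.eventually_ne (h0.2 j)
  have e2 : ∀ᶠ s : ℂ in 𝓝 0, ∀ i j, ‖M.H s i j‖ ≤ M.kap :=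
    eventually_all.2 fun i => eventually_all.2 fun j =>
      ((M.continuousAt_H h0 i j).norm.eventually_lt continuousAt_const (by
        simpa [H_zero] using M.one_lt_kap)).mono fun s hs => hs.le
  have hc : ContinuousAt (fun s => ∑ j, ‖M.v c s j‖) 0 :=
    tendsto_finsetSum _ fun j _ => (M.continuousAt_v c h0 j).norm
  have e3 : ∀ᶠ s : ℂ in 𝓝 0, ∑ j, ‖M.v c s j‖ ≤ ∑ j, ‖M.v c 0 j‖ + 1 :=
    (hc.eventually_lt continuousAt_const (by simp)).mono fun s hs => hs.le
  obtain ⟨ρ, hρ, h⟩ := Metric.eventually_nhds_iff.1 (e1.and (e2.and e3))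
  exact ⟨ρ, hρ, _, fun s hs => h (by simpa using hs)⟩

/-- The matrix `kernel` with `p₁` replaced by a parameter `r`; at `r = 0` it is diagonal. -/
def kernelAt (r : ℝ) : Matrix (Fin N) (Fin N) ℂ[X] :=
  Matrix.of fun j i =>
    (if i = j then (M.DA j).comp (-X) * M.DB i else 0)
      - C ((r : ℂ) * (M.P i j : ℂ)) * (M.NB i * (M.NA j).comp (-X))

theorem kernelAt_p₁ : M.kernelAt M.p₁ = M.kernel := rfl

theorem kernelAt_map_eval (r : ℝ) (s : ℂ) (j i : Fin N) : ((M.kernelAt r).map (eval s)) j i =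
    (if i = j then (M.DA j).eval (-s) * (M.DB i).eval s else 0)
      - (r : ℂ) * M.P i j * ((M.NB i).eval s * (M.NA j).eval (-s)) := by
  simp only [kernelAt, Matrix.map_apply, Matrix.of_apply, eval_sub, eval_mul, eval_C, eval_comp,
    eval_neg, eval_X]
  split_ifs <;> simp [eval_comp]

theorem eval_det_kernelAt (r : ℝ) (s : ℂ) :
    (M.kernelAt r).det.eval s = ((M.kernelAt r).map (eval s)).det := by
  rw [← coe_evalRingHom, RingHom.map_det]; rfl

theorem eval_det_kernelAt_eq (r : ℝ) {s : ℂ} (hs : ∀ i, (M.DB i).eval s ≠ 0)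
    (hs' : ∀ j, (M.DA j).eval (-s) ≠ 0) : (M.kernelAt r).det.eval s =
      (∏ j, (M.DA j).eval (-s)) * (1 - (r : ℂ) • M.F s).det * ∏ i, (M.DB i).eval s := by
  have h : (M.kernelAt r).map (eval s) =
      Matrix.diagonal (fun j => (M.DA j).eval (-s)) * (1 - (r : ℂ) • M.F s) *
        Matrix.diagonal (fun i => (M.DB i).eval s) := by
    ext j i
    have h1 := hs i
    have h2 := hs' j
    rw [kernelAt_map_eval, Matrix.mul_diagonal, Matrix.diagonal_mul, Matrix.sub_apply,
      Matrix.smul_apply, F_apply, H_apply, smul_eq_mul, Matrix.one_apply]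
    by_cases hij : i = j
    · subst hij; simp only [if_true]; field_simp
    · rw [if_neg hij, if_neg (Ne.symm hij)]; field_simp; ring
  rw [eval_det_kernelAt, h, Matrix.det_mul, Matrix.det_mul, Matrix.det_diagonal,
    Matrix.det_diagonal]

theorem kernelDet_eval (s : ℂ) : M.kernelDet.eval s = (M.kernel.map (eval s)).det :=
  M.eval_det_kernelAt M.p₁ s

/-- The product of `D_{B,ν}(s)` over `ν ≠ i`. -/
def DBerase (i : Fin N) (s : ℂ) : ℂ := ∏ k ∈ Finset.univ.erase i, (M.DB k).eval s

theorem DB_mul_DBerase (i : Fin N) (s : ℂ) :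
    (M.DB i).eval s * M.DBerase i s = ∏ k, (M.DB k).eval s :=
  Finset.mul_prod_erase _ (fun k => (M.DB k).eval s) (Finset.mem_univ i)

theorem DBerase_ne_zero (i : Fin N) {s : ℂ} (hs : 0 ≤ s.re) : M.DBerase i s ≠ 0 :=
  Finset.prod_ne_zero_iff.2 fun k _ => M.DB_eval_ne_zero k hs

theorem G_apply (s : ℂ) (j i : Fin N) : M.G s j i =
    (M.P i j : ℂ) * ((M.NB i).eval s * (M.NA j).eval (-s)) * M.DBerase i s := rfl

/-- The substitution `y i ↦ DBerase i s * y i` turns the equation with the common denominators `den`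
into one with the matrix `kernel`. -/
theorem kernel_mul_DBerase (s : ℂ) (j i : Fin N) :
    (M.kernel.map (eval s)) j i * M.DBerase i s
      = (if i = j then M.den j s else 0) - (M.p₁ : ℂ) * M.G s j i := by
  rw [← kernelAt_p₁, kernelAt_map_eval, G_apply, den, ← M.DB_mul_DBerase i]
  split_ifs <;> ring

theorem G_eq_den_mul_F {s : ℂ} (hs : ∀ i, (M.DB i).eval s ≠ 0) (hs' : ∀ j, (M.DA j).eval (-s) ≠ 0)
    (j i : Fin N) : M.G s j i = M.den j s * M.F s j i := by
  have h1 := hs i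
  have h2 := hs' j
  rw [G_apply, F_apply, H_apply, den, ← M.DB_mul_DBerase i]
  field_simp

theorem kernelDet_eval_ne_zero {s : ℂ} (hs : s ∈ M.Om) : M.kernelDet.eval s ≠ 0 := by
  rw [kernelDet, ← kernelAt_p₁,
    M.eval_det_kernelAt_eq M.p₁ (fun i => M.DB_eval_ne_zero i hs.1.1) hs.1.2]
  exact mul_ne_zero (mul_ne_zero (Finset.prod_ne_zero_iff.2 fun j _ => hs.1.2 j) hs.2)
    (Finset.prod_ne_zero_iff.2 fun i _ => M.DB_eval_ne_zero i hs.1.1)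

end ModelI

/-! ### The series solution -/

namespace ModelI

variable {N : ℕ} (M : ModelI N)

/-- The solved form of the functional equation is equivalent to the implicit one. -/
theorem eq_R_mulVec_add_iff {s : ℂ} (hs : (1 - (M.p₁ : ℂ) • M.F s).det ≠ 0) {x y w : Fin N → ℂ} :
    y = M.R s *ᵥ x + (1 - (M.p₁ : ℂ) • M.F s)⁻¹ *ᵥ w ↔
      y = (M.p₁ : ℂ) • (M.F s *ᵥ y) + (M.p₂ : ℂ) • (M.F s *ᵥ x) + w := by
  set A := 1 - (M.p₁ : ℂ) • M.F s with hA
  have hu : IsUnit A.det := isUnit_iff_ne_zero.2 hs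
  have h1 : M.R s *ᵥ x + A⁻¹ *ᵥ w = A⁻¹ *ᵥ ((M.p₂ : ℂ) • (M.F s *ᵥ x) + w) := by
    rw [R, ← hA, Matrix.mulVec_add, Matrix.smul_mulVec, ← Matrix.mulVec_mulVec, Matrix.mulVec_smul]
  have h2 : A *ᵥ y = y - (M.p₁ : ℂ) • (M.F s *ᵥ y) := by
    rw [hA, Matrix.sub_mulVec, Matrix.one_mulVec, Matrix.smul_mulVec]
  rw [h1, add_assoc, ← sub_eq_iff_eq_add', ← h2]
  constructor
  · intro h; rw [h, Matrix.mulVec_mulVec, Matrix.mul_nonsing_inv _ hu, Matrix.one_mulVec]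
  · intro h; rw [← h, Matrix.mulVec_mulVec, Matrix.nonsing_inv_mul _ hu, Matrix.one_mulVec]

theorem sum_norm_R_mulVec_add_le {s : ℂ} (h : ∀ i j, ‖M.H s i j‖ ≤ M.kap) (x w : Fin N → ℂ) :
    ∑ j, ‖(M.R s *ᵥ x + (1 - (M.p₁ : ℂ) • M.F s)⁻¹ *ᵥ w : Fin N → ℂ) j‖
      ≤ M.ratio * ∑ j, ‖x j‖ + (1 - M.kap * M.p₁)⁻¹ * ∑ j, ‖w j‖ :=
  M.sum_norm_le_of_eq h ((M.eq_R_mulVec_add_iff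
    (M.det_ne_zero_of_norm_H_le h M.p₁_pos.le le_rfl)).1 rfl)

theorem sum_norm_R_mulVec_le {s : ℂ} (h : ∀ i j, ‖M.H s i j‖ ≤ M.kap) (x : Fin N → ℂ) :
    ∑ j, ‖(M.R s *ᵥ x) j‖ ≤ M.ratio * ∑ j, ‖x j‖ := by
  simpa using M.sum_norm_R_mulVec_add_le h x 0

/-- The points whose whole orbit under multiplication by `a` lies in `Om`, that is, at which all the
terms of the series are defined. -/
def Good (s : ℂ) : Prop := ∀ k : ℕ, (M.a : ℂ) ^ k * s ∈ M.Om

variable {M}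

theorem Good.mem_Om {s : ℂ} (hs : M.Good s) : s ∈ M.Om := by simpa using hs 0

theorem Good.mul {s : ℂ} (hs : M.Good s) : M.Good (M.a * s) := fun k => by
  have := hs (k + 1); rwa [pow_succ, mul_assoc] at this

variable (M)

theorem re_mul_a (s : ℂ) : ((M.a : ℂ) * s).re = M.a * s.re := Complex.re_ofReal_mul _ _

theorem norm_mul_a (s : ℂ) : ‖(M.a : ℂ) * s‖ = M.a * ‖s‖ := by
  rw [norm_mul, Complex.norm_real, Real.norm_of_nonneg M.a_pos.le]

theorem norm_mul_a_le (s : ℂ) : ‖(M.a : ℂ) * s‖ ≤ ‖s‖ := by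
  rw [norm_mul_a]; exact mul_le_of_le_one_left (norm_nonneg _) M.a_lt.le

theorem prodR_succ' (s : ℂ) (k : ℕ) : M.prodR s (k + 1) = M.R s * M.prodR (M.a * s) k := by
  induction k with
  | zero => simp [prodR]
  | succ k ih =>
    rw [prodR, ih, prodR, Matrix.mul_assoc]
    congr 3
    ring

theorem term_succ (c : M.Coeffs) (s : ℂ) (k : ℕ) :
    M.term c s (k + 1) = M.R s *ᵥ M.term c (M.a * s) k := by
  rw [term, term, prodR_succ', Matrix.mulVec_mulVec]
  congr 2
  ring

theorem term_zero (c : M.Coeffs) (s : ℂ) : M.term c s 0 = M.Vt c s := by simp [term, prodR]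

variable {M}

theorem exists_pow_mul_lt (M : ModelI N) {ρ : ℝ} (hρ : 0 < ρ) (s : ℂ) :
    ∃ n : ℕ, ‖(M.a : ℂ) ^ n * s‖ < ρ := by
  have h := (tendsto_pow_atTop_nhds_zero_of_lt_one M.a_pos.le M.a_lt).mul_const ‖s‖
  rw [zero_mul] at h
  obtain ⟨n, hn⟩ := (h.eventually_lt_const hρ).exists
  refine ⟨n, ?_⟩
  rwa [norm_mul, norm_pow, Complex.norm_real, Real.norm_of_nonneg M.a_pos.le]

/-- Induction along the orbits of multiplication by `a`, which end near `0`. -/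
theorem orbit_induction (M : ModelI N) {ρ : ℝ} (hρ : 0 < ρ) {p : ℂ → Prop}
    (h0 : ∀ s, ‖s‖ < ρ → p s) (h1 : ∀ s, p (M.a * s) → p s) (s : ℂ) : p s := by
  obtain ⟨n, hn⟩ := M.exists_pow_mul_lt hρ s
  induction n generalizing s with
  | zero => exact h0 s (by simpa using hn)
  | succ n ih => exact h1 s (ih _ (by rwa [pow_succ, mul_assoc] at hn))

/-- In the disc of radius `ρ` the functional equation has no singularity, its inhomogeneity is bounded
by `B`, and it contracts by the factor `ratio`. -/
structure IsRadius (c : M.Coeffs) (ρ B : ℝ) : Prop where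
  pos : 0 < ρ
  DA_ne_zero : ∀ s : ℂ, ‖s‖ < ρ → ∀ j, (M.DA j).eval (-s) ≠ 0
  H_le : ∀ s : ℂ, ‖s‖ < ρ → ∀ i j, ‖M.H s i j‖ ≤ M.kap
  v_le : ∀ s : ℂ, ‖s‖ < ρ → ∑ j, ‖M.v c s j‖ ≤ B

theorem exists_isRadius (c : M.Coeffs) : ∃ ρ B, M.IsRadius c ρ B := by
  obtain ⟨ρ, hρ, B, h⟩ := M.exists_radius c
  exact ⟨ρ, B, hρ, fun s hs => (h s hs).1, fun s hs => (h s hs).2.1, fun s hs => (h s hs).2.2⟩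

namespace IsRadius

variable {c : M.Coeffs} {ρ B : ℝ}

theorem mul_lt {s : ℂ} (hs : ‖s‖ < ρ) : ‖(M.a : ℂ) * s‖ < ρ := (M.norm_mul_a_le s).trans_lt hs

theorem mem_Om (hρ : M.IsRadius c ρ B) {s : ℂ} (hs : ‖s‖ < ρ) (h0 : 0 ≤ s.re) : s ∈ M.Om :=
  M.Om_of_norm_H_le ⟨h0, hρ.DA_ne_zero s hs⟩ (hρ.H_le s hs)

theorem good (hρ : M.IsRadius c ρ B) {s : ℂ} (hs : ‖s‖ < ρ) (h0 : 0 ≤ s.re) : M.Good s := by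
  intro k
  induction k generalizing s with
  | zero => simpa using hρ.mem_Om hs h0
  | succ k ih =>
    rw [pow_succ, mul_assoc]
    exact ih (mul_lt hs) (by rw [re_mul_a]; exact mul_nonneg M.a_pos.le h0)

theorem sum_norm_Vt_le (hρ : M.IsRadius c ρ B) {s : ℂ} (hs : ‖s‖ < ρ) :
    ∑ j, ‖M.Vt c s j‖ ≤ (1 - M.kap * M.p₁)⁻¹ * B := by
  have h1 := M.sum_norm_R_mulVec_add_le (hρ.H_le s hs) 0 (M.v c s)
  have h2 : 0 < 1 - M.kap * M.p₁ := by linarith [M.kap_mul_p₁_lt]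
  have h3 := mul_le_mul_of_nonneg_left (hρ.v_le s hs) (inv_nonneg.2 h2.le)
  simp only [Matrix.mulVec_zero, zero_add, Pi.zero_apply, norm_zero, Finset.sum_const_zero,
    mul_zero] at h1
  exact h1.trans h3

theorem sum_norm_term_le (hρ : M.IsRadius c ρ B) {s : ℂ} (hs : ‖s‖ < ρ) (k : ℕ) :
    ∑ j, ‖M.term c s k j‖ ≤ M.ratio ^ k * ((1 - M.kap * M.p₁)⁻¹ * B) := by
  induction k generalizing s with
  | zero => simpa [term_zero] using hρ.sum_norm_Vt_le hs
  | succ k ih =>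
    rw [term_succ, pow_succ']
    refine (M.sum_norm_R_mulVec_le (hρ.H_le s hs) _).trans ?_
    rw [mul_assoc]
    exact mul_le_mul_of_nonneg_left (ih (mul_lt hs)) M.ratio_nonneg

theorem norm_term_le (hρ : M.IsRadius c ρ B) {s : ℂ} (hs : ‖s‖ < ρ) (k : ℕ) :
    ‖M.term c s k‖ ≤ M.ratio ^ k * ((1 - M.kap * M.p₁)⁻¹ * B) := by
  refine le_trans ?_ (hρ.sum_norm_term_le hs k)
  refine (pi_norm_le_iff_of_nonneg (by positivity)).2 fun j => ?_
  exact Finset.single_le_sum (f := fun j => ‖M.term c s k j‖) (fun _ _ => norm_nonneg _)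
    (Finset.mem_univ j)

theorem summable_bound :
    Summable fun k : ℕ => M.ratio ^ k * ((1 - M.kap * M.p₁)⁻¹ * B) :=
  (summable_geometric_of_lt_one M.ratio_nonneg M.ratio_lt_one).mul_right _

theorem summable (hρ : M.IsRadius c ρ B) {s : ℂ} (hs : ‖s‖ < ρ) : Summable (M.term c s) :=
  Summable.of_norm_bounded summable_bound (hρ.norm_term_le hs)

theorem norm_series_le (hρ : M.IsRadius c ρ B) {s : ℂ} (hs : ‖s‖ < ρ) :
    ‖M.series c s‖ ≤ ∑' k : ℕ, M.ratio ^ k * ((1 - M.kap * M.p₁)⁻¹ * B) :=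
  tsum_of_norm_bounded summable_bound.hasSum (hρ.norm_term_le hs)

end IsRadius

/-- The series converges at every point: its tail is the series at a point close to `0`, with a fixed
matrix applied. Where a matrix is singular, the junk value of its inverse does no harm. -/
theorem summable_term (c : M.Coeffs) (s : ℂ) : Summable (M.term c s) := by
  obtain ⟨ρ, B, hρ⟩ := exists_isRadius c
  refine M.orbit_induction hρ.pos (fun s hs => hρ.summable hs) (fun s hs => ?_) s
  rw [← summable_nat_add_iff 1]
  simp_rw [term_succ]
  exact hs.map (M.R s).mulVecLin (Continuous.matrix_mulVec continuous_const continuous_id)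

theorem series_eq (c : M.Coeffs) (s : ℂ) :
    M.series c s = M.R s *ᵥ M.series c (M.a * s) + M.Vt c s := by
  rw [series, (summable_term c s).tsum_eq_zero_add, term_zero, add_comm]
  congr 1
  simp_rw [term_succ]
  have hc : Continuous (M.R s).mulVecLin := by
    exact Continuous.matrix_mulVec continuous_const continuous_id
  exact ((summable_term c (M.a * s)).map_tsum (M.R s).mulVecLin hc).symm

/-- A bounded solution of the functional equation is the sum of the series: the difference is
contracted indefinitely near `0`, and the equation propagates the equality outwards. -/
theorem eq_series_of_bounded {c : M.Coeffs} {Φ : ℂ → Fin N → ℂ} {C : ℝ}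
    (hC : ∀ s : ℂ, 0 ≤ s.re → ∀ j, ‖Φ s j‖ ≤ C)
    (h : ∀ s ∈ M.Om, Φ s = M.R s *ᵥ Φ (M.a * s) + M.Vt c s) {s : ℂ} (hs : M.Good s) :
    Φ s = M.series c s := by
  obtain ⟨ρ, B, hρ⟩ := exists_isRadius c
  revert hs
  refine M.orbit_induction hρ.pos (p := fun s => M.Good s → Φ s = M.series c s) ?_ ?_ s
  · intro s hs hg
    set S := ∑' k : ℕ, M.ratio ^ k * ((1 - M.kap * M.p₁)⁻¹ * B)
    -- The difference solves the homogeneous equation, which contracts by `ratio` at each use.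
    have key : ∀ k : ℕ, ∀ s : ℂ, ‖s‖ < ρ → M.Good s →
        ∑ j, ‖(Φ s - M.series c s) j‖ ≤ M.ratio ^ k * ∑ _j : Fin N, (C + S) := by
      intro k
      induction k with
      | zero =>
        intro s hs hg
        rw [pow_zero, one_mul]
        refine Finset.sum_le_sum fun j _ => (norm_sub_le _ _).trans ?_
        exact add_le_add (hC s hg.mem_Om.1.1 j) ((norm_le_pi_norm _ j).trans (hρ.norm_series_le hs))
      | succ k ih =>
        intro s hs hg
        have : Φ s - M.series c s = M.R s *ᵥ (Φ (M.a * s) - M.series c (M.a * s)) := by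
          rw [h s hg.mem_Om, series_eq c s, Matrix.mulVec_sub]; abel
        rw [this, pow_succ', mul_assoc]
        exact (M.sum_norm_R_mulVec_le (hρ.H_le s hs) _).trans
          (mul_le_mul_of_nonneg_left (ih _ (IsRadius.mul_lt hs) hg.mul) M.ratio_nonneg)
    have hlim := (tendsto_pow_atTop_nhds_zero_of_lt_one M.ratio_nonneg M.ratio_lt_one).mul_const
      (∑ _j : Fin N, (C + S))
    rw [zero_mul] at hlim
    have h0 := ge_of_tendsto hlim (Eventually.of_forall fun k => key k s hs hg)
    have h1 := (Finset.sum_eq_zero_iff_of_nonneg fun _ _ => norm_nonneg _).1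
      (le_antisymm h0 (Finset.sum_nonneg fun _ _ => norm_nonneg _))
    rw [← sub_eq_zero]
    funext j
    exact norm_eq_zero.1 (h1 j (Finset.mem_univ j))
  · intro s ih hg
    rw [h s hg.mem_Om, series_eq c s, ih hg.mul]

end ModelI

/-! ### The roots of the determinant -/

/-- The number of roots in the open right half-plane, with multiplicity. -/
def Polynomial.rightCount (p : ℂ[X]) : ℕ := (p.roots.filter fun z => 0 < z.re).card

namespace Polynomial

theorem rightCount_mul {p q : ℂ[X]} (h : p * q ≠ 0) :
    (p * q).rightCount = p.rightCount + q.rightCount := by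
  simp [rightCount, roots_mul h, Multiset.filter_add]

theorem rightCount_prod {ι : Type*} (s : Finset ι) (f : ι → ℂ[X]) (h : ∀ i ∈ s, f i ≠ 0) :
    (∏ i ∈ s, f i).rightCount = ∑ i ∈ s, (f i).rightCount := by
  classical
  induction s using Finset.induction_on with
  | empty => simp [rightCount]
  | insert i s hi ih =>
    have h0 := Finset.prod_ne_zero_iff.2 h
    rw [Finset.prod_insert hi] at h0 ⊢
    rw [rightCount_mul h0, ih fun j hj => h j (Finset.mem_insert_of_mem hj), Finset.sum_insert hi]

theorem rightCount_X_sub_C (z : ℂ) : (X - C z).rightCount = if 0 < z.re then 1 else 0 := by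
  rw [rightCount, roots_X_sub_C, Multiset.filter_singleton]
  split_ifs <;> simp

theorem rightCount_neg (p : ℂ[X]) : (-p).rightCount = p.rightCount := by
  rw [rightCount, roots_neg, rightCount]

/-- The roots of a polynomial of degree `D`, enumerated as a family on `Fin D`. -/
theorem exists_prod_X_sub_C {p : ℂ[X]} {D : ℕ} (hD : p.natDegree = D) :
    ∃ z : Fin D → ℂ, p = C p.leadingCoeff * ∏ i, (X - C (z i)) := by
  have hsplit := IsAlgClosed.splits p
  have hcard : p.roots.toList.length = D := by
    rw [Multiset.length_toList, ← hsplit.natDegree_eq_card_roots, hD]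
  refine ⟨fun i => p.roots.toList.get (i.cast hcard.symm), ?_⟩
  subst hcard
  conv_lhs => rw [hsplit.eq_prod_roots]
  congr 1
  conv_lhs => rw [← Multiset.coe_toList p.roots]
  rw [Multiset.map_coe, Multiset.prod_coe]
  simp only [Fin.cast_eq_self]
  rw [← List.prod_ofFn]
  congr 1
  refine List.ext_get (by simp) fun n h1 h2 => by simp

theorem rightCount_C_mul_prod {a : ℂ} (ha : a ≠ 0) {D : ℕ} (z : Fin D → ℂ) :
    (C a * ∏ i, (X - C (z i))).rightCount = ∑ i, if 0 < (z i).re then 1 else 0 := by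
  have h0 : (∏ i, (X - C (z i))) ≠ 0 := Finset.prod_ne_zero_iff.2 fun i _ => X_sub_C_ne_zero _
  rw [rightCount_mul (mul_ne_zero (C_ne_zero.2 ha) h0), rightCount_prod _ _ fun i _ => X_sub_C_ne_zero _]
  simp [rightCount_X_sub_C]
  simp [rightCount]

/-- In a continuous family of polynomials of constant degree with bounded roots, none of them on the
imaginary axis, the number of right roots is locally constant. The vectors of roots lie in a compact
set, and the limit of any convergent subsequence of them is a vector of roots of the limit. -/
theorem rightCount_continuous {T : Type*} [TopologicalSpace T] [FirstCountableTopology T]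
    {D : ℕ} {P : T → ℂ[X]}
    (h0 : ∀ r, P r ≠ 0) (hD : ∀ r, (P r).natDegree = D)
    (hlead : Continuous fun r => (P r).leadingCoeff) (heval : ∀ s, Continuous fun r => (P r).eval s)
    {R : ℝ} (hR : ∀ r z, (P r).eval z = 0 → ‖z‖ ≤ R)
    (him : ∀ r z, (P r).eval z = 0 → z.re ≠ 0) : Continuous fun r => (P r).rightCount := by
  refine continuous_iff_continuousAt.2 fun r₀ => ?_
  refine tendsto_of_seq_tendsto fun u hu => ?_
  refine tendsto_of_subseq_tendsto fun ns hns => ?_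
  choose z hz using fun r => exists_prod_X_sub_C (hD r)
  have hroot : ∀ r i, (P r).eval (z r i) = 0 := fun r i => by
    rw [hz r, eval_mul, eval_prod, Finset.prod_eq_zero (Finset.mem_univ i) (by simp), mul_zero]
  have hmem : ∀ n, z (u (ns n)) ∈ Metric.closedBall (0 : Fin D → ℂ) (max R 0) := fun n => by
    rw [mem_closedBall_zero_iff]
    exact (pi_norm_le_iff_of_nonneg (le_max_right _ _)).2 fun i =>
      (hR _ _ (hroot _ i)).trans (le_max_left _ _)
  obtain ⟨w, -, φ, hφ, hw⟩ := (isCompact_closedBall (0 : Fin D → ℂ) (max R 0)).tendsto_subseq hmem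
  refine ⟨φ, ?_⟩
  have hu' : Tendsto (fun n => u (ns (φ n))) atTop (𝓝 r₀) :=
    hu.comp (hns.comp hφ.tendsto_atTop)
  have hw' : ∀ i, Tendsto (fun n => z (u (ns (φ n))) i) atTop (𝓝 (w i)) := fun i =>
    ((continuous_apply i).tendsto w).comp hw
  have hP : P r₀ = C (P r₀).leadingCoeff * ∏ i, (X - C (w i)) := by
    refine Polynomial.funext fun s => ?_
    have h1 : Tendsto (fun n => (P (u (ns (φ n)))).eval s) atTop (𝓝 ((P r₀).eval s)) :=
      ((heval s).tendsto r₀).comp hu'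
    have h2 : Tendsto (fun n => (P (u (ns (φ n)))).leadingCoeff
        * ∏ i, (s - z (u (ns (φ n))) i)) atTop (𝓝 ((P r₀).leadingCoeff * ∏ i, (s - w i))) :=
      ((hlead.tendsto r₀).comp hu').mul
        (tendsto_finsetProd _ fun i _ => tendsto_const_nhds.sub (hw' i))
    have h3 : ∀ r, (P r).eval s = (P r).leadingCoeff * ∏ i, (s - z r i) := fun r => by
      conv_lhs => rw [hz r]
      simp [eval_prod]
    simp_rw [h3 (u _)] at h1
    rw [tendsto_nhds_unique h1 h2]
    simp [eval_prod]
  have hwne : ∀ i, (w i).re ≠ 0 := fun i => by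
    refine him r₀ _ ?_
    rw [hP, eval_mul, eval_prod, Finset.prod_eq_zero (Finset.mem_univ i) (by simp), mul_zero]
  have hc : ∀ r, (P r).rightCount = ∑ i, if 0 < (z r i).re then 1 else 0 := fun r => by
    conv_lhs => rw [hz r]
    exact rightCount_C_mul_prod (leadingCoeff_ne_zero.2 (h0 r)) _
  have hc0 : (P r₀).rightCount = ∑ i, if 0 < (w i).re then 1 else 0 := by
    conv_lhs => rw [hP]
    exact rightCount_C_mul_prod (leadingCoeff_ne_zero.2 (h0 r₀)) _
  have hev : ∀ᶠ n in atTop, ∀ i, (0 < (z (u (ns (φ n))) i).re ↔ 0 < (w i).re) := by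
    refine eventually_all.2 fun i => ?_
    have ht := (Complex.continuous_re.tendsto (w i)).comp (hw' i)
    rcases lt_or_gt_of_ne (hwne i) with h | h
    · filter_upwards [ht.eventually_lt_const h] with n hn
      simp only [Function.comp] at hn
      constructor <;> intro <;> linarith
    · filter_upwards [ht.eventually_const_lt h] with n hn
      exact ⟨fun _ => h, fun _ => hn⟩
  refine tendsto_const_nhds.congr' (hev.mono fun n hn => ?_)
  simp only [Function.comp]
  rw [hc0, hc]
  exact Finset.sum_congr rfl fun i _ => by simp only [hn i]

end Polynomial

namespace ModelI

variable {N : ℕ} (M : ModelI N)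

/-- The degree of the determinant of the kernel. -/
def totalDeg : ℕ := ∑ j, (M.l j + M.m j)

theorem natDegree_comp_neg_X (p : ℂ[X]) : (p.comp (-X)).natDegree = p.natDegree := by
  rw [natDegree_comp]; simp

theorem natDegree_det_kernelAt_le (r : ℝ) : (M.kernelAt r).det.natDegree ≤ M.totalDeg := by
  have hentry : ∀ j i, (M.kernelAt r j i).natDegree ≤ M.l j + M.m i := by
    intro j i
    refine (natDegree_sub_le _ _).trans (max_le ?_ ?_)
    · split_ifs
      · refine natDegree_mul_le.trans ?_
        rw [natDegree_comp_neg_X, DA_natDegree, DB_natDegree]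
      · simp
    · refine (natDegree_C_mul_le _ _).trans (natDegree_mul_le.trans ?_)
      rw [natDegree_comp_neg_X, add_comm]
      exact add_le_add (M.NA_natDegree_le j) (M.NB_natDegree_le i)
  rw [Matrix.det_apply]
  refine natDegree_sum_le_of_forall_le _ _ fun σ _ => ?_
  refine (natDegree_smul_le _ _).trans ((natDegree_prod_le _ _).trans ?_)
  calc ∑ i, (M.kernelAt r (σ i) i).natDegree ≤ ∑ i, (M.l (σ i) + M.m i) :=
        Finset.sum_le_sum fun i _ => hentry _ _
    _ = M.totalDeg := by
        rw [Finset.sum_add_distrib, Equiv.sum_comp σ M.l, totalDeg, Finset.sum_add_distrib]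

/-- The limit of `F` at infinity. -/
def Finf : Matrix (Fin N) (Fin N) ℂ := Matrix.of fun j i => (M.P i j : ℂ) * M.Hinf i j

theorem tendsto_F : Tendsto M.F (Bornology.cobounded ℂ) (𝓝 M.Finf) := by
  refine tendsto_pi_nhds.2 fun j => tendsto_pi_nhds.2 fun i => ?_
  simp only [F_apply]
  exact (M.tendsto_H i j).const_mul _

theorem det_Finf_ne_zero {r : ℝ} (hr0 : 0 ≤ r) (hr : r ≤ M.p₁) :
    (1 - (r : ℂ) • M.Finf).det ≠ 0 := by
  refine Matrix.det_one_sub_ne_zero fun i => ?_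
  have hp : M.p₁ < 1 := by have := M.p₂_pos; have := M.p_lt; linarith
  calc ∑ j, ‖((r : ℂ) • M.Finf) j i‖ ≤ ∑ j, r * M.P i j := by
        refine Finset.sum_le_sum fun j _ => ?_
        rw [Matrix.smul_apply, norm_smul, Complex.norm_real, Real.norm_of_nonneg hr0, Finf,
          Matrix.of_apply, norm_mul, Complex.norm_real, Real.norm_of_nonneg (M.P_nonneg i j)]
        exact mul_le_mul_of_nonneg_left
          (mul_le_of_le_one_right (M.P_nonneg i j) (M.norm_Hinf_le_one i j)) hr0
    _ = r := by rw [← Finset.mul_sum, M.P_row, mul_one]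
    _ < 1 := hr.trans_lt hp

/-- The product `∏ⱼ D_{A,j}(-s) ∏ᵢ D_{B,i}(s)`, which is the determinant of the kernel for `p₁ = 0`. -/
def detDen : ℂ[X] := (∏ j, (M.DA j).comp (-X)) * ∏ i, M.DB i

theorem DA_comp_eq (j : Fin N) : (M.DA j).comp (-X) = ∏ r, -(X - C (-M.u j r)) := by
  rw [DA, prod_comp]
  refine Finset.prod_congr rfl fun r _ => ?_
  simp; ring

theorem DA_comp_ne_zero (j : Fin N) : (M.DA j).comp (-X) ≠ 0 := by
  rw [DA_comp_eq]
  exact Finset.prod_ne_zero_iff.2 fun r _ => neg_ne_zero.2 (X_sub_C_ne_zero _)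

theorem detDen_ne_zero : M.detDen ≠ 0 :=
  mul_ne_zero (Finset.prod_ne_zero_iff.2 fun j _ => M.DA_comp_ne_zero j)
    (Finset.prod_ne_zero_iff.2 fun i _ => (M.DB_monic i).ne_zero)

theorem detDen_natDegree : M.detDen.natDegree = M.totalDeg := by
  have h := M.detDen_ne_zero
  rw [detDen] at h ⊢
  rw [natDegree_mul (left_ne_zero_of_mul h) (right_ne_zero_of_mul h),
    natDegree_prod _ _ fun j _ => M.DA_comp_ne_zero j,
    natDegree_prod _ _ fun i _ => (M.DB_monic i).ne_zero]
  simp [natDegree_comp_neg_X, DA_natDegree, DB_natDegree, totalDeg, Finset.sum_add_distrib]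

theorem eventually_DB_ne_zero :
    ∀ᶠ s : ℂ in Bornology.cobounded ℂ, ∀ i, (M.DB i).eval s ≠ 0 := by
  refine eventually_all.2 fun i => ?_
  have : ∀ᶠ s : ℂ in Bornology.cobounded ℂ, ∀ k, s ≠ M.t i k :=
    eventually_all.2 fun k => Bornology.eventually_ne_cobounded _
  filter_upwards [this] with s hs
  rw [DB_eval]
  exact Finset.prod_ne_zero_iff.2 fun k _ => sub_ne_zero.2 (hs k)

theorem eventually_DA_ne_zero :
    ∀ᶠ s : ℂ in Bornology.cobounded ℂ, ∀ j, (M.DA j).eval (-s) ≠ 0 := by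
  refine eventually_all.2 fun i => ?_
  have : ∀ᶠ s : ℂ in Bornology.cobounded ℂ, ∀ k, s ≠ -M.u i k :=
    eventually_all.2 fun k => Bornology.eventually_ne_cobounded _
  filter_upwards [this] with s hs
  rw [DA_eval]
  refine Finset.prod_ne_zero_iff.2 fun k _ => sub_ne_zero.2 fun h => hs k ?_
  rw [← h, neg_neg]

/-- The leading coefficient of the determinant, from its behaviour at infinity. -/
theorem coeff_det_kernelAt (r : ℝ) : (M.kernelAt r).det.coeff M.totalDeg
    = M.detDen.leadingCoeff * (1 - (r : ℂ) • M.Finf).det := by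
  have h1 := (M.kernelAt r).det.tendsto_eval_div_pow (M.natDegree_det_kernelAt_le r)
  have h2 := M.detDen.tendsto_eval_div_pow M.detDen_natDegree.le
  have hc : Continuous fun A : Matrix (Fin N) (Fin N) ℂ => (1 - (r : ℂ) • A).det :=
    Continuous.matrix_det (by fun_prop)
  have h3 := h2.mul ((hc.tendsto _).comp M.tendsto_F)
  rw [← detDen_natDegree, coeff_natDegree, detDen_natDegree] at h3
  refine tendsto_nhds_unique h1 (h3.congr' ?_)
  filter_upwards [M.eventually_DB_ne_zero, M.eventually_DA_ne_zero] with s hs hs'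
  simp only [Function.comp]
  rw [M.eval_det_kernelAt_eq r hs hs', detDen, eval_mul, eval_prod, eval_prod]
  simp only [eval_comp, eval_neg, eval_X]
  ring

theorem eventually_H_le :
    ∀ᶠ s : ℂ in Bornology.cobounded ℂ, ∀ i j, ‖M.H s i j‖ ≤ M.kap :=
  eventually_all.2 fun i => eventually_all.2 fun j =>
    ((M.tendsto_H i j).norm.eventually_lt_const
      ((M.norm_Hinf_le_one i j).trans_lt M.one_lt_kap)).mono fun _ h => h.le

theorem exists_bound_of_eventually_cobounded {p : ℂ → Prop}
    (h : ∀ᶠ s in Bornology.cobounded ℂ, p s) : ∃ R : ℝ, ∀ s, R < ‖s‖ → p s := by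
  obtain ⟨R, -, hR⟩ := (hasBasis_cobounded_norm (E := ℂ)).eventually_iff.1 h
  exact ⟨R, fun s hs => hR hs.le⟩

theorem rightCount_detDen : M.detDen.rightCount = ∑ j, M.l j := by
  have h := M.detDen_ne_zero
  rw [detDen] at h ⊢
  rw [rightCount_mul h, rightCount_prod _ _ fun j _ => M.DA_comp_ne_zero j,
    rightCount_prod _ _ fun i _ => (M.DB_monic i).ne_zero]
  have h1 : ∀ j, ((M.DA j).comp (-X)).rightCount = M.l j := fun j => by
    rw [DA_comp_eq, rightCount_prod _ _ fun r _ => neg_ne_zero.2 (X_sub_C_ne_zero _)]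
    simp_rw [rightCount_neg, rightCount_X_sub_C]
    simp [M.u_re]
  have h2 : ∀ i, (M.DB i).rightCount = 0 := fun i => by
    rw [DB, rightCount_prod _ _ fun r _ => X_sub_C_ne_zero _]
    simp [rightCount_X_sub_C, fun k => (M.t_re i k).le]
  simp [h1, h2]

/-- The determinant has as many right roots as `D_{A,j}(-s)` has together: the number is constant along
the homotopy that replaces `p₁` by `r ∈ [0, p₁]`, since by diagonal dominance no root crosses the
imaginary axis or escapes to infinity. -/
theorem kernelDet_ne_zero_and_rightCount :
    M.kernelDet ≠ 0 ∧ (M.kernelDet.roots.filter (fun δ => 0 < δ.re)).card = ∑ j, M.l j := by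
  set P : Set.Icc 0 M.p₁ → ℂ[X] := fun r => (M.kernelAt r).det with hP
  have hcoeff : ∀ r : Set.Icc 0 M.p₁, (P r).coeff M.totalDeg ≠ 0 := fun r => by
    rw [hP, M.coeff_det_kernelAt]
    exact mul_ne_zero (leadingCoeff_ne_zero.2 M.detDen_ne_zero) (M.det_Finf_ne_zero r.2.1 r.2.2)
  have h0 : ∀ r, P r ≠ 0 := fun r h => hcoeff r (by rw [h]; simp)
  have hD : ∀ r, (P r).natDegree = M.totalDeg := fun r =>
    natDegree_eq_of_le_of_coeff_ne_zero (M.natDegree_det_kernelAt_le r) (hcoeff r)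
  have hlead : Continuous fun r => (P r).leadingCoeff := by
    have : (fun r => (P r).leadingCoeff)
        = fun r : Set.Icc 0 M.p₁ => M.detDen.leadingCoeff * (1 - ((r : ℝ) : ℂ) • M.Finf).det := by
      funext r
      rw [← M.coeff_det_kernelAt, leadingCoeff, hD r]
    rw [this]
    exact continuous_const.mul (Continuous.matrix_det (by fun_prop))
  have heval : ∀ s, Continuous fun r => (P r).eval s := fun s => by
    have : (fun r => (P r).eval s) = fun r : Set.Icc 0 M.p₁ => ((M.kernelAt (r : ℝ)).map (eval s)).det := by
      funext r
      exact M.eval_det_kernelAt r s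
    rw [this]
    refine Continuous.matrix_det (continuous_pi fun j => continuous_pi fun i => ?_)
    simp only [kernelAt_map_eval]
    fun_prop
  obtain ⟨R, hR⟩ := exists_bound_of_eventually_cobounded
    (M.eventually_DB_ne_zero.and (M.eventually_DA_ne_zero.and M.eventually_H_le))
  -- Diagonal dominance excludes roots on the imaginary axis and far from `0`, for every `r`.
  have hne : ∀ (r : Set.Icc 0 M.p₁) (z : ℂ), (∀ i, (M.DB i).eval z ≠ 0) →
      (∀ j, (M.DA j).eval (-z) ≠ 0) → (∀ i j, ‖M.H z i j‖ ≤ M.kap) → (P r).eval z ≠ 0 := by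
    intro r z h1 h2 h3
    rw [hP, M.eval_det_kernelAt_eq r h1 h2]
    exact mul_ne_zero (mul_ne_zero (Finset.prod_ne_zero_iff.2 fun j _ => h2 j)
      (M.det_ne_zero_of_norm_H_le h3 r.2.1 r.2.2)) (Finset.prod_ne_zero_iff.2 fun i _ => h1 i)
  have hc := rightCount_continuous h0 hD hlead heval (R := R)
    (fun r z hz => by
      by_contra! hlt
      obtain ⟨h1, h2, h3⟩ := hR z hlt
      exact hne r z h1 h2 h3 hz)
    (fun r z hz hre => hne r z (fun i => M.DB_eval_ne_zero i hre.ge)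
      (fun j => M.DA_eval_neg_ne_zero j hre.le)
      (fun i j => (M.norm_H_le_one hre i j).trans M.one_lt_kap.le) hz)
  have hpc : PreconnectedSpace (Set.Icc 0 M.p₁) :=
    isPreconnected_iff_preconnectedSpace.1 isPreconnected_Icc
  have heq := PreconnectedSpace.constant hpc hc
    (x := ⟨M.p₁, M.p₁_pos.le, le_rfl⟩) (y := ⟨0, le_rfl, M.p₁_pos.le⟩)
  refine ⟨h0 ⟨M.p₁, M.p₁_pos.le, le_rfl⟩, ?_⟩
  change M.kernelDet.rightCount = _
  have hzero : (M.kernelAt 0).det = M.detDen := by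
    have : M.kernelAt 0 = Matrix.diagonal fun j => (M.DA j).comp (-X) * M.DB j := by
      ext j i : 2
      simp only [kernelAt, Matrix.of_apply, Matrix.diagonal_apply]
      by_cases hij : i = j
      · subst hij; simp
      · simp [hij, Ne.symm hij]
    rw [this, Matrix.det_diagonal, detDen, Finset.prod_mul_distrib]
  rw [← M.rightCount_detDen, ← hzero]
  exact heq

end ModelI

/-! ### One step of the recursion -/

/-- Growth on the set `S` of at most the order of a polynomial of degree `n`. -/
def PolyGrowth (n : ℕ) (S : Set ℂ) (f : ℂ → ℂ) : Prop :=
  ∃ C, ∀ s ∈ S, ‖f s‖ ≤ C * (1 + ‖s‖) ^ n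

namespace PolyGrowth

variable {n : ℕ} {S : Set ℂ} {f g : ℂ → ℂ}

theorem add (hf : PolyGrowth n S f) (hg : PolyGrowth n S g) :
    PolyGrowth n S fun s => f s + g s := by
  obtain ⟨C, hC⟩ := hf
  obtain ⟨D, hD⟩ := hg
  exact ⟨C + D, fun s hs => (norm_add_le _ _).trans (by
    rw [add_mul]; exact add_le_add (hC s hs) (hD s hs))⟩

theorem neg (hf : PolyGrowth n S f) : PolyGrowth n S fun s => -f s := by
  obtain ⟨C, hC⟩ := hf
  exact ⟨C, fun s hs => by rw [norm_neg]; exact hC s hs⟩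

theorem sub (hf : PolyGrowth n S f) (hg : PolyGrowth n S g) :
    PolyGrowth n S fun s => f s - g s := by
  simpa [sub_eq_add_neg] using hf.add hg.neg

theorem zero : PolyGrowth n S fun _ => 0 := ⟨0, fun s _ => by simp⟩

theorem sum {ι : Type*} (K : Finset ι) {f : ι → ℂ → ℂ} (h : ∀ i ∈ K, PolyGrowth n S (f i)) :
    PolyGrowth n S fun s => ∑ i ∈ K, f i s := by
  classical
  induction K using Finset.induction_on with
  | empty => simpa using zero
  | insert i K hi ih =>
    simp_rw [Finset.sum_insert hi]
    exact (h i (Finset.mem_insert_self _ _)).add (ih fun j hj => h j (Finset.mem_insert_of_mem hj))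

theorem eval_mul {p : ℂ[X]} (hp : p.natDegree ≤ n) {C : ℝ} (hf : ∀ s ∈ S, ‖f s‖ ≤ C) :
    PolyGrowth n S fun s => p.eval s * f s := by
  obtain ⟨D, hD0, hD⟩ := p.exists_norm_eval_le hp
  refine ⟨D * C, fun s hs => ?_⟩
  rw [norm_mul]
  calc ‖p.eval s‖ * ‖f s‖ ≤ (D * (1 + ‖s‖) ^ n) * C :=
        mul_le_mul (hD s) (hf s hs) (norm_nonneg _) (by positivity)
    _ = _ := by ring

end PolyGrowth

theorem exists_polynomial_of_polyGrowth {f g : ℂ → ℂ} {n : ℕ}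
    (hf : ContinuousOn f {s | 0 ≤ s.re}) (hf' : DifferentiableOn ℂ f {s | 0 < s.re})
    (hg : ContinuousOn g {s | s.re ≤ 0}) (hg' : DifferentiableOn ℂ g {s | s.re < 0})
    (hfg : ∀ s : ℂ, s.re = 0 → f s = g s)
    (hfC : PolyGrowth n {s | 0 ≤ s.re} f) (hgC : PolyGrowth n {s | s.re ≤ 0} g) :
    ∃ p : ℂ[X], p.natDegree ≤ n ∧ (∀ s : ℂ, 0 ≤ s.re → f s = p.eval s) ∧
      ∀ s : ℂ, s.re ≤ 0 → g s = p.eval s := by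
  obtain ⟨C, hC⟩ := hfC
  obtain ⟨D, hD⟩ := hgC
  refine Complex.exists_polynomial_of_halfPlanes (M := max C D) hf hf' hg hg' hfg
    (fun s hs => (hC s hs).trans ?_) (fun s hs => (hD s hs).trans ?_)
  · gcongr; exact le_max_left _ _
  · gcongr; exact le_max_right _ _

/-- The identity `e^{-s max(x,0)} = e^{-sx} + 1 - e^{-s min(x,0)}`, integrated. -/
theorem lst_map_max_zero (m : Measure ℝ) [IsFiniteMeasure m] {s : ℂ} (hs : s.re = 0) :
    lst (m.map (fun x => max x 0)) s
      = lst m s + m.real Set.univ - lst (m.map (fun x => min x 0)) s := by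
  have hi := integrable_exp_neg_mul (ae_re_mul_nonneg_of_re_eq_zero m hs)
  have hb : ∀ f : ℝ → ℝ, Measurable f →
      Integrable (fun x : ℝ => Complex.exp (-s * (f x : ℝ))) m := fun f hf =>
    Integrable.of_bound (C := 1) (Measurable.aestronglyMeasurable (by fun_prop))
      (Eventually.of_forall fun x => norm_exp_neg_mul_ofReal_le_one (by simp [hs]))
  have h1 : lst (m.map (fun x => max x 0)) s = ∫ x : ℝ, Complex.exp (-s * (max x 0 : ℝ)) ∂m := by
    rw [lst, integral_map (by fun_prop) (Continuous.aestronglyMeasurable (by fun_prop))]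
  have h2 : lst (m.map (fun x => min x 0)) s = ∫ x : ℝ, Complex.exp (-s * (min x 0 : ℝ)) ∂m := by
    rw [lst, integral_map (by fun_prop) (Continuous.aestronglyMeasurable (by fun_prop))]
  rw [eq_sub_iff_add_eq, h1, h2, ← integral_add (hb _ (by fun_prop)) (hb _ (by fun_prop)), lst]
  have h3 : ((m.real Set.univ : ℝ) : ℂ) = ∫ _x : ℝ, (1 : ℂ) ∂m := by simp
  rw [h3, ← integral_add hi (integrable_const _)]
  refine integral_congr_ae (Eventually.of_forall fun x => ?_)
  rcases le_total x 0 with h | h <;> simp [h, add_comm]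

theorem map_max_zero_Iio (m : Measure ℝ) : (m.map (fun x => max x 0)) (Set.Iio 0) = 0 := by
  rw [Measure.map_apply (by fun_prop) measurableSet_Iio]
  convert measure_empty (μ := m)
  ext x; simp

theorem map_min_zero_Ioi (m : Measure ℝ) : (m.map (fun x => min x 0)) (Set.Ioi 0) = 0 := by
  rw [Measure.map_apply (by fun_prop) measurableSet_Ioi]
  convert measure_empty (μ := m)
  ext x; simp

/-- The law of the product of two independent variables, with laws `κ` and `α`. -/
def mulLaw (κ α : Measure ℝ) : Measure ℝ := (κ.prod α).map fun w => w.1 * w.2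

instance (κ α : Measure ℝ) [IsFiniteMeasure κ] [IsFiniteMeasure α] :
    IsFiniteMeasure (mulLaw κ α) := by unfold mulLaw; infer_instance

theorem lst_mulLaw {κ α : Measure ℝ} [IsFiniteMeasure κ] [IsFiniteMeasure α] {s : ℂ}
    (h : ∀ᵐ v ∂κ, ∀ᵐ x ∂α, 0 ≤ s.re * (v * x)) :
    lst (mulLaw κ α) s = ∫ v : ℝ, lst α (s * v) ∂κ := by
  have hae : ∀ᵐ w ∂κ.prod α, 0 ≤ s.re * (w.1 * w.2) := by
    refine (Measure.ae_prod_iff_ae_ae ?_).2 h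
    exact measurableSet_le measurable_const (by fun_prop)
  have hint : Integrable (fun w : ℝ × ℝ => Complex.exp (-s * (w.1 * w.2 : ℝ))) (κ.prod α) :=
    Integrable.of_bound (C := 1) (Continuous.aestronglyMeasurable (by fun_prop))
      (hae.mono fun w hw => norm_exp_neg_mul_ofReal_le_one hw)
  rw [lst, mulLaw, integral_map (by fun_prop) (Continuous.aestronglyMeasurable (by fun_prop)),
    integral_prod _ hint]
  refine integral_congr_ae (Eventually.of_forall fun v => ?_)
  simp only [lst]
  congr 1
  funext x
  push_cast
  ring_nf

theorem mulLaw_Ioi {κ α : Measure ℝ} [IsFiniteMeasure κ] [IsFiniteMeasure α]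
    (hκ : κ (Set.Ici 0) = 0) (hα : α (Set.Iio 0) = 0) : mulLaw κ α (Set.Ioi 0) = 0 := by
  have hae : ∀ᵐ w ∂κ.prod α, w.1 * w.2 ≤ 0 := by
    refine (Measure.ae_prod_iff_ae_ae (measurableSet_le (by fun_prop) measurable_const)).2 ?_
    have : ∀ᵐ v ∂κ, v < 0 := by rw [ae_iff]; simpa [Set.Ici] using hκ
    filter_upwards [this] with v hv
    filter_upwards [ae_nonneg_of_Iio hα] with x hx
    exact mul_nonpos_of_nonpos_of_nonneg hv.le hx
  rw [mulLaw, Measure.map_apply (by fun_prop) measurableSet_Ioi]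
  rw [ae_iff] at hae
  simp only [not_le] at hae
  exact hae

namespace ModelI

variable {N : ℕ} (M : ModelI N)

instance : IsProbabilityMeasure M.lawV := M.lawV_prob
instance (i : Fin N) : IsProbabilityMeasure (M.lawS i) := M.lawS_prob i
instance (i : Fin N) : IsProbabilityMeasure (M.lawA i) := M.lawA_prob i

/-- The part of the law of the multiplier on the negative half-line; its mass is `p₃`. -/
def negV : Measure ℝ := M.lawV.restrict (Set.Iio 0)

/-- The part of the law of the multiplier on the positive half-line, which consists of two atoms. -/
def posV : Measure ℝ :=
  ENNReal.ofReal M.p₁ • Measure.dirac 1 + ENNReal.ofReal M.p₂ • Measure.dirac M.a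

instance : IsFiniteMeasure M.negV := by unfold negV; infer_instance

instance : IsFiniteMeasure M.posV := ⟨by simp [posV]⟩

theorem lawV_eq : M.lawV = M.posV + M.negV := by
  have ha : M.a ≠ 1 := M.a_lt.ne
  have hdisj : M.lawV ({1} ∪ {M.a} ∪ Set.Iio 0) = 1 := by
    rw [measure_union _ measurableSet_Iio, measure_union _ (measurableSet_singleton _), M.lawV_one,
      M.lawV_a, M.lawV_neg, ← ENNReal.ofReal_add M.p₁_pos.le M.p₂_pos.le, ← ENNReal.ofReal_add]
    · simp
    · exact (add_pos M.p₁_pos M.p₂_pos).le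
    · have := M.p_lt; linarith
    · simpa using ha.symm
    · rw [Set.disjoint_left]
      intro x hx h0
      have := M.a_pos
      simp at hx h0
      rcases hx with rfl | rfl <;> linarith
  have hmeas : MeasurableSet ({1} ∪ {M.a} ∪ Set.Iio 0 : Set ℝ) := by measurability
  have hae : ∀ᵐ v ∂M.lawV, v ∈ ({1} ∪ {M.a} ∪ Set.Iio 0 : Set ℝ) := by
    rw [← prob_compl_eq_zero_iff hmeas] at hdisj
    exact hdisj
  ext B hB
  have h1 : M.lawV B = M.lawV (B ∩ ({1} ∪ {M.a} ∪ Set.Iio 0)) := by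
    refine measure_congr ?_
    filter_upwards [hae] with v hv
    exact propext ⟨fun h => ⟨h, hv⟩, fun h => h.1⟩
  have hsingle : ∀ x : ℝ, M.lawV (B ∩ {x}) = M.lawV {x} * Measure.dirac x B := by
    intro x
    rw [Measure.dirac_apply' _ hB]
    by_cases hx : x ∈ B
    · rw [Set.inter_eq_right.2 (by simpa using hx)]; simp [hx]
    · have : B ∩ {x} = ∅ := by ext y; simp; rintro h rfl; exact hx h
      simp [this, hx]
  rw [h1, Set.inter_union_distrib_left, Set.inter_union_distrib_left,
    measure_union _ (hB.inter measurableSet_Iio),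
    measure_union _ (hB.inter (measurableSet_singleton _)), hsingle, hsingle, M.lawV_one, M.lawV_a]
  · simp [posV, negV, Measure.restrict_apply hB]
  · rw [Set.disjoint_left]
    rintro x ⟨_, hx⟩ ⟨_, hx'⟩
    simp at hx hx'
    exact ha (hx' ▸ hx)
  · rw [Set.disjoint_left]
    intro x hx h0
    have := M.a_pos
    have h2 := h0.2
    simp at hx h2
    rcases hx with ⟨_, rfl⟩ | ⟨_, rfl⟩ <;> linarith

theorem integral_posV (f : ℝ → ℂ) : ∫ v, f v ∂M.posV = M.p₁ * f 1 + M.p₂ * f M.a := by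
  rw [posV, integral_add_measure, integral_smul_measure, integral_smul_measure]
  · simp [ENNReal.toReal_ofReal M.p₁_pos.le, ENNReal.toReal_ofReal M.p₂_pos.le]
  · exact (integrable_dirac (by simp)).smul_measure ENNReal.ofReal_ne_top
  · exact (integrable_dirac (by simp)).smul_measure ENNReal.ofReal_ne_top

theorem lawV_Iio : M.lawV (Set.Iio 0) = ENNReal.ofReal M.p₃ := M.lawV_neg

theorem p₃_mul_integral_cond (f : ℝ → ℂ) :
    (M.p₃ : ℂ) * ∫ y, f y ∂(ProbabilityTheory.cond M.lawV (Set.Iio 0)) = ∫ y, f y ∂M.negV := by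
  rw [ProbabilityTheory.cond, integral_smul_measure, M.lawV_Iio, ENNReal.toReal_inv,
    ENNReal.toReal_ofReal M.p₃_pos.le, negV, Complex.real_smul]
  have : (M.p₃ : ℂ) ≠ 0 := by exact_mod_cast M.p₃_pos.ne'
  push_cast
  rw [mul_inv_cancel_left₀ this]

theorem negV_Ici : M.negV (Set.Ici 0) = 0 := by
  rw [negV, Measure.restrict_apply measurableSet_Ici]
  convert measure_empty (μ := M.lawV)
  ext x; simp

theorem ae_negV : ∀ᵐ y ∂M.negV, y < 0 := by
  rw [ae_iff]; simpa [Set.Ici] using M.negV_Ici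

/-- The joint law of the multiplier, the current value, the service time and the interarrival time,
for a transition from `i` to `j`. -/
def jointLaw (κ α : Measure ℝ) (i j : Fin N) : Measure (ℝ × ℝ × ℝ × ℝ) :=
  κ.prod (α.prod ((M.lawS i).prod (M.lawA j)))

/-- The image of the family of laws `α` under one step of the free (unreflected) recursion with
multiplier law `κ`; the family is indexed by the states of the Markov chain. -/
def step (κ : Measure ℝ) (α : Fin N → Measure ℝ) (j : Fin N) : Measure ℝ :=
  ∑ i, ENNReal.ofReal (M.P i j) •
    (M.jointLaw κ (α i) i j).map fun w => w.1 * w.2.1 + (w.2.2.1 - w.2.2.2)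

/-- The image of the family of laws `α` under one step of the recursion reflected at `0`. -/
def stepMax (κ : Measure ℝ) (α : Fin N → Measure ℝ) (j : Fin N) : Measure ℝ :=
  (M.step κ α j).map fun x => max x 0

instance (κ α : Measure ℝ) [IsFiniteMeasure κ] [IsFiniteMeasure α] (i j : Fin N) :
    IsFiniteMeasure (M.jointLaw κ α i j) := by unfold jointLaw; infer_instance

instance (κ : Measure ℝ) [IsFiniteMeasure κ] (α : Fin N → Measure ℝ) [∀ i, IsFiniteMeasure (α i)]
    (j : Fin N) : IsFiniteMeasure (M.step κ α j) := by
  unfold step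
  have : ∀ i, IsFiniteMeasure (ENNReal.ofReal (M.P i j) •
      (M.jointLaw κ (α i) i j).map fun w => w.1 * w.2.1 + (w.2.2.1 - w.2.2.2)) :=
    fun i => Measure.smul_finite _ ENNReal.ofReal_ne_top
  infer_instance

instance (κ : Measure ℝ) [IsFiniteMeasure κ] (α : Fin N → Measure ℝ) [∀ i, IsFiniteMeasure (α i)]
    (j : Fin N) : IsFiniteMeasure (M.stepMax κ α j) := by
  unfold stepMax; infer_instance

theorem lst_step (κ : Measure ℝ) [IsFiniteMeasure κ] (α : Fin N → Measure ℝ)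
    [∀ i, IsFiniteMeasure (α i)] (j : Fin N) {s : ℂ} (hs : s.re = 0) :
    lst (M.step κ α j) s = ∑ i, (M.P i j : ℂ) * M.H s i j * ∫ v : ℝ, lst (α i) (s * v) ∂κ := by
  have hmeas : Measurable fun w : ℝ × ℝ × ℝ × ℝ => w.1 * w.2.1 + (w.2.2.1 - w.2.2.2) := by fun_prop
  have hpart : ∀ i, IsFiniteMeasure (ENNReal.ofReal (M.P i j) •
      (M.jointLaw κ (α i) i j).map fun w => w.1 * w.2.1 + (w.2.2.1 - w.2.2.2)) :=
    fun i => Measure.smul_finite _ ENNReal.ofReal_ne_top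
  rw [lst, step, integral_finsetSum_measure fun i _ =>
    integrable_exp_neg_mul (ae_re_mul_nonneg_of_re_eq_zero _ hs)]
  refine Finset.sum_congr rfl fun i _ => ?_
  rw [integral_smul_measure, ENNReal.toReal_ofReal (M.P_nonneg i j), Complex.real_smul, mul_assoc]
  congr 1
  rw [integral_map hmeas.aemeasurable (Continuous.aestronglyMeasurable (by fun_prop)), jointLaw,
    integral_prod, M.H_eq_lst hs, ← integral_const_mul]
  · refine integral_congr_ae (Eventually.of_forall fun v => ?_)
    simp only
    have h1 : ∀ w : ℝ × ℝ × ℝ, Complex.exp (-s * (v * w.1 + (w.2.1 - w.2.2) : ℝ))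
        = Complex.exp (-(s * v) * w.1) * (Complex.exp (-s * w.2.1) * Complex.exp (-(-s) * w.2.2)) := by
      intro w
      rw [← Complex.exp_add, ← Complex.exp_add]
      congr 1
      push_cast
      ring
    simp_rw [h1]
    rw [integral_prod_mul (fun x : ℝ => Complex.exp (-(s * v) * x))
      (fun w : ℝ × ℝ => Complex.exp (-s * w.1) * Complex.exp (-(-s) * w.2)),
      integral_prod_mul (fun x : ℝ => Complex.exp (-s * x)) (fun x : ℝ => Complex.exp (-(-s) * x))]
    simp only [lst]
    ring
  · exact Integrable.of_bound (C := 1) (Continuous.aestronglyMeasurable (by fun_prop))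
      (Eventually.of_forall fun w => norm_exp_neg_mul_ofReal_le_one (by simp [hs]))

theorem measureReal_step (κ : Measure ℝ) [IsFiniteMeasure κ] (α : Fin N → Measure ℝ)
    [∀ i, IsFiniteMeasure (α i)] (j : Fin N) : (M.step κ α j).real Set.univ
      = κ.real Set.univ * ∑ i, M.P i j * (α i).real Set.univ := by
  have h := M.lst_step κ α j (s := 0) (by simp)
  simp only [zero_mul, lst_zero_arg, H_zero, mul_one, integral_const, Complex.real_smul] at h
  have h' : (M.step κ α j).real Set.univ
      = ∑ i, M.P i j * (κ.real Set.univ * (α i).real Set.univ) := by exact_mod_cast h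
  rw [h', Finset.mul_sum]
  exact Finset.sum_congr rfl fun i _ => by ring

theorem integral_lawV_lst (α : Measure ℝ) [IsFiniteMeasure α] {s : ℂ} (hs : s.re = 0) :
    ∫ v : ℝ, lst α (s * v) ∂M.lawV
      = M.p₁ * lst α s + M.p₂ * lst α (M.a * s) + lst (mulLaw M.negV α) s := by
  have hint : ∀ κ : Measure ℝ, IsFiniteMeasure κ → Integrable (fun v : ℝ => lst α (s * v)) κ := by
    intro κ _
    have hre : ∀ v : ℝ, (s * v).re = 0 := fun v => by simp [hs]
    refine Integrable.of_bound (C := α.real Set.univ) ?_ (Eventually.of_forall fun v =>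
      norm_lst_le (ae_re_mul_nonneg_of_re_eq_zero _ (hre v)))
    refine Continuous.aestronglyMeasurable ?_
    simp_rw [fun v : ℝ => lst_eq_charFun α (hre v)]
    exact (continuous_charFun (μ := α)).comp (by fun_prop)
  rw [lawV_eq, integral_add_measure (hint _ inferInstance) (hint _ inferInstance), integral_posV,
    lst_mulLaw (by simp [hs])]
  simp [mul_comm s]

/-- The common denominator `den j` as a polynomial. -/
def denPoly (j : Fin N) : ℂ[X] := (M.DA j).comp (-X) * ∏ k, M.DB k

/-- The entry `G j i` as a polynomial. -/
def GPoly (j i : Fin N) : ℂ[X] :=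
  C (M.P i j : ℂ) * (M.NB i * (M.NA j).comp (-X)) * ∏ k ∈ Finset.univ.erase i, M.DB k

theorem denPoly_eval (j : Fin N) (s : ℂ) : (M.denPoly j).eval s = M.den j s := by
  simp [denPoly, den, eval_prod, eval_comp]

theorem GPoly_eval (j i : Fin N) (s : ℂ) : (M.GPoly j i).eval s = M.G s j i := by
  simp [GPoly, G_apply, DBerase, eval_prod, eval_comp]

theorem denPoly_natDegree_le (j : Fin N) : (M.denPoly j).natDegree ≤ M.deg j := by
  refine natDegree_mul_le.trans ?_
  rw [natDegree_comp_neg_X, DA_natDegree, deg]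
  gcongr
  exact (natDegree_prod_le _ _).trans (by simp [DB_natDegree])

theorem GPoly_natDegree_le (j i : Fin N) : (M.GPoly j i).natDegree ≤ M.deg j := by
  refine natDegree_mul_le.trans ?_
  have h1 : (C (M.P i j : ℂ) * (M.NB i * (M.NA j).comp (-X))).natDegree ≤ M.m i + M.l j := by
    refine (natDegree_C_mul_le _ _).trans (natDegree_mul_le.trans ?_)
    rw [natDegree_comp_neg_X]
    exact add_le_add (M.NB_natDegree_le i) (M.NA_natDegree_le j)
  have h2 : (∏ k ∈ Finset.univ.erase i, M.DB k).natDegree ≤ ∑ k ∈ Finset.univ.erase i, M.m k :=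
    (natDegree_prod_le _ _).trans (by simp [DB_natDegree])
  have h3 := Finset.add_sum_erase Finset.univ M.m (Finset.mem_univ i)
  rw [deg, ← h3]
  omega

theorem continuousOn_comp_a {f : ℂ → ℂ} (hf : ContinuousOn f {s | 0 ≤ s.re}) :
    ContinuousOn (fun s => f (M.a * s)) {s | 0 ≤ s.re} :=
  hf.comp (by fun_prop) fun s (hs : 0 ≤ s.re) => by
    simpa using mul_nonneg M.a_pos.le hs

theorem differentiableOn_comp_a {f : ℂ → ℂ} (hf : DifferentiableOn ℂ f {s | 0 < s.re}) :
    DifferentiableOn ℂ (fun s => f (M.a * s)) {s | 0 < s.re} :=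
  hf.comp (by fun_prop) fun s (hs : 0 < s.re) => by
    simpa using mul_pos M.a_pos hs

theorem GPoly_eq_den_mul {s : ℂ} (hs : s ∈ M.regular) (j i : Fin N) :
    (M.GPoly j i).eval s = (M.denPoly j).eval s * (M.P i j * M.H s i j) := by
  rw [GPoly_eval, denPoly_eval, M.G_eq_den_mul_F (fun i => M.DB_eval_ne_zero i hs.1) hs.2, F_apply]

/-- The Wiener–Hopf argument for one step of the recursion. The equation of the step, multiplied by
`den j`, has a side that is holomorphic on the right and a side that is holomorphic on the left; so
both are one polynomial `p` of degree at most `deg j`. At a zero of `den j` on the left, only the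
contribution of the negative multipliers is left of it. -/
theorem exists_polynomial_stepMax (α : Fin N → Measure ℝ) [∀ i, IsFiniteMeasure (α i)]
    (hα : ∀ i, α i (Set.Iio 0) = 0) (j : Fin N) : ∃ p : ℂ[X], p.natDegree ≤ M.deg j ∧
      (∀ s : ℂ, 0 ≤ s.re → M.den j s * lst (M.stepMax M.lawV α j) s
        - ∑ i, M.G s j i * (M.p₁ * lst (α i) s + M.p₂ * lst (α i) (M.a * s)) = p.eval s) ∧
      ∀ s : ℂ, s.re ≤ 0 → M.den j s = 0 →
        ∑ i, M.G s j i * ∫ y : ℝ, lst (α i) (s * y) ∂M.negV = p.eval s := by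
  set β := M.step M.lawV α j with hβ
  set γ := β.map fun x => min x 0 with hγ
  have hγ0 : γ (Set.Ioi 0) = 0 := map_min_zero_Ioi β
  have hδ0 : M.stepMax M.lawV α j (Set.Iio 0) = 0 := map_max_zero_Iio β
  have hneg : ∀ i, mulLaw M.negV (α i) (Set.Ioi 0) = 0 := fun i => mulLaw_Ioi M.negV_Ici (hα i)
  refine (exists_polynomial_of_polyGrowth (n := M.deg j)
    (f := fun s => (M.denPoly j).eval s * lst (M.stepMax M.lawV α j) s
      - ∑ i, (M.GPoly j i).eval s * (M.p₁ * lst (α i) s + M.p₂ * lst (α i) (M.a * s)))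
    (g := fun s => ∑ i, (M.GPoly j i).eval s * lst (mulLaw M.negV (α i)) s
      + (M.denPoly j).eval s * (β.real Set.univ - lst γ s))
    ?_ ?_ ?_ ?_ ?_ ?_ ?_).imp fun p => ?_
  · refine ((M.denPoly j).continuous.continuousOn.mul (continuousOn_lst hδ0)).sub
      (continuousOn_finsetSum _ fun i _ => (M.GPoly j i).continuous.continuousOn.mul
        ((continuousOn_const.mul (continuousOn_lst (hα i))).add
          (continuousOn_const.mul (M.continuousOn_comp_a (continuousOn_lst (hα i))))))
  · refine ((M.denPoly j).differentiable.differentiableOn.mul (differentiableOn_lst hδ0)).sub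
      (DifferentiableOn.fun_sum fun i _ => (M.GPoly j i).differentiable.differentiableOn.mul
        (((differentiableOn_const _).mul (differentiableOn_lst (hα i))).add
          ((differentiableOn_const _).mul (M.differentiableOn_comp_a (differentiableOn_lst (hα i))))))
  · exact (continuousOn_finsetSum _ fun i _ => (M.GPoly j i).continuous.continuousOn.mul
      (continuousOn_lst_left (hneg i))).add ((M.denPoly j).continuous.continuousOn.mul
        (continuousOn_const.sub (continuousOn_lst_left hγ0)))
  · exact (DifferentiableOn.fun_sum fun i _ => (M.GPoly j i).differentiable.differentiableOn.mul
      (differentiableOn_lst_left (hneg i))).add ((M.denPoly j).differentiable.differentiableOn.mul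
        ((differentiableOn_const _).sub (differentiableOn_lst_left hγ0)))
  · intro s hs
    have hreg := M.regular_of_re_eq_zero hs
    have h1 : lst (M.stepMax M.lawV α j) s = _ := lst_map_max_zero β hs
    have h2 := M.lst_step M.lawV α j hs
    simp_rw [M.integral_lawV_lst _ hs] at h2
    simp only [h1]
    rw [h2]
    simp only [M.GPoly_eq_den_mul hreg, mul_assoc, ← Finset.mul_sum]
    simp only [← mul_sub, ← mul_add]
    congr 1
    simp only [mul_add, Finset.sum_add_distrib]
    ring
  · refine (PolyGrowth.eval_mul (C := (M.stepMax M.lawV α j).real Set.univ)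
      (M.denPoly_natDegree_le j) fun s hs => norm_lst_le (ae_re_mul_nonneg hδ0 hs)).sub
      (PolyGrowth.sum _ fun i _ => PolyGrowth.eval_mul
        (C := M.p₁ * (α i).real Set.univ + M.p₂ * (α i).real Set.univ)
        (M.GPoly_natDegree_le j i) fun s hs => ?_)
    refine (norm_add_le _ _).trans ?_
    rw [norm_mul, norm_mul, Complex.norm_real, Complex.norm_real, Real.norm_of_nonneg M.p₁_pos.le,
      Real.norm_of_nonneg M.p₂_pos.le]
    have := M.p₁_pos.le
    have := M.p₂_pos.le
    gcongr
    · exact norm_lst_le (ae_re_mul_nonneg (hα i) hs)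
    · exact norm_lst_le (ae_re_mul_nonneg (hα i) (by
        rw [re_mul_a]; exact mul_nonneg M.a_pos.le hs))
  · refine PolyGrowth.add (PolyGrowth.sum _ fun i _ => PolyGrowth.eval_mul
        (C := (mulLaw M.negV (α i)).real Set.univ)
        (M.GPoly_natDegree_le j i) fun s hs => norm_lst_le (ae_re_mul_nonneg_left (hneg i) hs)) ?_
    refine PolyGrowth.eval_mul (f := fun s => (β.real Set.univ : ℂ) - lst γ s)
      (C := β.real Set.univ + γ.real Set.univ)
      (M.denPoly_natDegree_le j) fun s hs => (norm_sub_le _ _).trans ?_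
    gcongr
    · rw [Complex.norm_real, Real.norm_of_nonneg measureReal_nonneg]
    · exact norm_lst_le (ae_re_mul_nonneg_left hγ0 hs)
  · rintro ⟨hp, hp1, hp2⟩
    refine ⟨hp, fun s hs => ?_, fun s hs hd => ?_⟩
    · rw [← hp1 s hs]; simp only [GPoly_eval, denPoly_eval]
    · rw [← hp2 s hs]
      simp only [GPoly_eval, denPoly_eval, hd, zero_mul, add_zero]
      refine Finset.sum_congr rfl fun i _ => ?_
      rw [lst_mulLaw]
      filter_upwards [M.ae_negV] with v hv
      filter_upwards [ae_nonneg_of_Iio (hα i)] with x hx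
      exact mul_nonneg_of_nonpos_of_nonpos hs (mul_nonpos_of_nonpos_of_nonneg hv.le hx)

end ModelI

/-! ### The laws of the realization -/

theorem MeasureTheory.Measure.ext_prod₄ {α β γ δ : Type*} [MeasurableSpace α] [MeasurableSpace β]
    [MeasurableSpace γ] [MeasurableSpace δ] {μ ν : Measure (α × β × γ × δ)} [IsFiniteMeasure μ]
    [IsFiniteMeasure ν]
    (h : ∀ (s : Set α) (t : Set β) (u : Set γ) (v : Set δ), MeasurableSet s → MeasurableSet t →
      MeasurableSet u → MeasurableSet v → μ (s ×ˢ t ×ˢ u ×ˢ v) = ν (s ×ˢ t ×ˢ u ×ˢ v)) : μ = ν := by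
  refine Measure.ext_prod fun {s T} hs hT => ?_
  have key : ∀ (m : Measure (α × β × γ × δ)) (T : Set (β × γ × δ)), MeasurableSet T →
      ((m.restrict (s ×ˢ Set.univ)).map Prod.snd) T = m (s ×ˢ T) := by
    intro m T hT
    rw [Measure.map_apply measurable_snd hT, Measure.restrict_apply (measurable_snd hT)]
    congr 1
    ext x; simp [and_comm]
  rw [← key μ T hT, ← key ν T hT]
  congr 1
  refine Measure.ext_prod₃ fun {t u v} ht hu hv => ?_
  rw [key _ _ (ht.prod (hu.prod hv)), key _ _ (ht.prod (hu.prod hv)), h s t u v hs ht hu hv]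

namespace ModelI

variable {N : ℕ} {M : ModelI N}

namespace Realization

variable {Ω : Type*} [mΩ : MeasurableSpace Ω] {μ : Measure Ω} (X : M.Realization μ)

theorem measurable_W_past (n : ℕ) : Measurable[X.past n] (X.W n) := by
  induction n with
  | zero => exact X.W_zero_meas
  | succ n ih =>
    have h1 : X.W (n + 1) = fun ω => max (X.V n ω * X.W n ω + (X.S n ω - X.A (n + 1) ω)) 0 :=
      funext (X.recursion n)
    rw [h1]
    have hW : Measurable[X.past (n + 1)] (X.W n) := ih.mono (X.past.mono n.le_succ) le_rfl
    have hV := X.V_meas n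
    have hS := X.S_meas n
    have hA := X.A_meas n
    exact Measurable.max ((hV.mul hW).add (hS.sub hA)) measurable_const

theorem measurable_W (n : ℕ) : Measurable (X.W n) :=
  (X.measurable_W_past n).mono (X.past.le n) le_rfl

theorem measurable_Z (n : ℕ) : Measurable (X.Z n) := (X.Z_meas n).mono (X.past.le n) le_rfl

theorem measurable_V (n : ℕ) : Measurable (X.V n) := (X.V_meas n).mono (X.past.le _) le_rfl

theorem measurable_S (n : ℕ) : Measurable (X.S n) := (X.S_meas n).mono (X.past.le _) le_rfl

theorem measurable_A (n : ℕ) : Measurable (X.A (n + 1)) := (X.A_meas n).mono (X.past.le _) le_rfl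

theorem W_nonneg (n : ℕ) (ω : Ω) : 0 ≤ X.W n ω := by
  cases n with
  | zero => exact X.W_zero_nonneg ω
  | succ n => rw [X.recursion]; exact le_max_right _ _

theorem measurableSet_Z (n : ℕ) (i : Fin N) : MeasurableSet {ω | X.Z n ω = i} :=
  X.measurable_Z n (measurableSet_singleton i)

/-- The law of `W n` on the event `Z n = i`. -/
def law (n : ℕ) (i : Fin N) : Measure ℝ := (μ.restrict {ω | X.Z n ω = i}).map (X.W n)

instance [IsFiniteMeasure μ] (n : ℕ) (i : Fin N) : IsFiniteMeasure (X.law n i) := by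
  unfold law; infer_instance

theorem law_Iio (n : ℕ) (i : Fin N) : X.law n i (Set.Iio 0) = 0 := by
  rw [law, Measure.map_apply (X.measurable_W n) measurableSet_Iio]
  convert measure_empty (μ := μ.restrict {ω | X.Z n ω = i})
  ext ω; simp [X.W_nonneg n ω]

theorem transform_eq_lst (n : ℕ) (s : ℂ) (i : Fin N) : X.transform n s i = lst (X.law n i) s := by
  rw [lst, law, integral_map (X.measurable_W n).aemeasurable
    (Continuous.aestronglyMeasurable (by fun_prop))]
  rfl

/-- The defining property of the realization, as an identity of laws on `ℝ⁴`. -/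
theorem joint_map_eq [IsFiniteMeasure μ] (n : ℕ) (i j : Fin N) :
    (μ.restrict {ω | X.Z n ω = i ∧ X.Z (n + 1) ω = j}).map
        (fun ω => (X.V n ω, X.W n ω, X.S n ω, X.A (n + 1) ω))
      = ENNReal.ofReal (M.P i j) • M.jointLaw M.lawV (X.law n i) i j := by
  have hmeas : Measurable fun ω => (X.V n ω, X.W n ω, X.S n ω, X.A (n + 1) ω) :=
    (X.measurable_V n).prodMk ((X.measurable_W n).prodMk
      ((X.measurable_S n).prodMk (X.measurable_A n)))
  have hfin : IsFiniteMeasure (ENNReal.ofReal (M.P i j) • M.jointLaw M.lawV (X.law n i) i j) :=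
    Measure.smul_finite _ ENNReal.ofReal_ne_top
  refine Measure.ext_prod₄ fun b₁ b₀ b₂ b₃ h₁ h₀ h₂ h₃ => ?_
  have hprod : MeasurableSet (b₁ ×ˢ b₀ ×ˢ b₂ ×ˢ b₃) := h₁.prod (h₀.prod (h₂.prod h₃))
  rw [Measure.map_apply hmeas hprod, Measure.restrict_apply (hmeas hprod)]
  have hset : (fun ω => (X.V n ω, X.W n ω, X.S n ω, X.A (n + 1) ω)) ⁻¹' (b₁ ×ˢ b₀ ×ˢ b₂ ×ˢ b₃) ∩
      {ω | X.Z n ω = i ∧ X.Z (n + 1) ω = j} =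
      {ω | ω ∈ X.W n ⁻¹' b₀ ∧ X.Z n ω = i ∧ X.V n ω ∈ b₁ ∧ X.S n ω ∈ b₂ ∧ X.A (n + 1) ω ∈ b₃ ∧
        X.Z (n + 1) ω = j} := by
    ext ω; simp; tauto
  have hW : MeasurableSet[X.past n] (X.W n ⁻¹' b₀) := X.measurable_W_past n h₀
  rw [hset, X.joint_law n _ hW i j b₁ b₂ b₃ h₁ h₂ h₃]
  have hlaw : μ {ω | ω ∈ X.W n ⁻¹' b₀ ∧ X.Z n ω = i} = X.law n i b₀ := by
    rw [law, Measure.map_apply (X.measurable_W n) h₀, Measure.restrict_apply (X.measurable_W n h₀)]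
    rfl
  rw [hlaw, Measure.smul_apply, jointLaw, Measure.prod_prod, Measure.prod_prod, Measure.prod_prod,
    smul_eq_mul]
  ring

theorem law_succ [IsFiniteMeasure μ] (n : ℕ) (j : Fin N) :
    X.law (n + 1) j = M.stepMax M.lawV (X.law n) j := by
  have hmeas : Measurable fun ω => (X.V n ω, X.W n ω, X.S n ω, X.A (n + 1) ω) :=
    (X.measurable_V n).prodMk ((X.measurable_W n).prodMk
      ((X.measurable_S n).prodMk (X.measurable_A n)))
  have hf : Measurable fun w : ℝ × ℝ × ℝ × ℝ => w.1 * w.2.1 + (w.2.2.1 - w.2.2.2) := by fun_prop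
  ext B hB
  have hB' : MeasurableSet ((fun x : ℝ => max x 0) ⁻¹' B) :=
    (by fun_prop : Measurable fun x : ℝ => max x 0) hB
  rw [stepMax, Measure.map_apply (by fun_prop) hB, step, Measure.finsetSum_apply]
  simp_rw [← Measure.map_smul, ← X.joint_map_eq n _ j]
  have hW1 : X.W (n + 1) ⁻¹' B = (fun ω => (X.V n ω, X.W n ω, X.S n ω, X.A (n + 1) ω)) ⁻¹'
      ((fun w : ℝ × ℝ × ℝ × ℝ => w.1 * w.2.1 + (w.2.2.1 - w.2.2.2)) ⁻¹'
        ((fun x : ℝ => max x 0) ⁻¹' B)) := by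
    ext ω; simp [X.recursion]
  have hterm : ∀ i, (((μ.restrict {ω | X.Z n ω = i ∧ X.Z (n + 1) ω = j}).map
      (fun ω => (X.V n ω, X.W n ω, X.S n ω, X.A (n + 1) ω))).map
      fun w : ℝ × ℝ × ℝ × ℝ => w.1 * w.2.1 + (w.2.2.1 - w.2.2.2)) ((fun x : ℝ => max x 0) ⁻¹' B)
      = μ ((X.W (n + 1) ⁻¹' B ∩ {ω | X.Z (n + 1) ω = j}) ∩ X.Z n ⁻¹' {i}) := by
    intro i
    rw [Measure.map_apply hf hB', Measure.map_apply hmeas (hf hB'), ← hW1,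
      Measure.restrict_apply (X.measurable_W _ hB)]
    congr 1
    ext ω; simp; tauto
  simp_rw [hterm]
  rw [law, Measure.map_apply (X.measurable_W _) hB, Measure.restrict_apply (X.measurable_W _ hB)]
  have := measure_biUnion_finset (μ := μ) (s := Finset.univ)
    (f := fun i : Fin N => (X.W (n + 1) ⁻¹' B ∩ {ω | X.Z (n + 1) ω = j}) ∩ X.Z n ⁻¹' {i})
    (by
      intro i _ i' _ hii
      refine Set.disjoint_left.2 fun ω h h' => hii ?_
      have h1 := h.2
      have h2 := h'.2
      simp at h1 h2
      exact h1.symm.trans h2)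
    (fun i _ => ((X.measurable_W _ hB).inter (X.measurableSet_Z _ j)).inter
      (X.measurable_Z n (measurableSet_singleton i)))
  rw [← this]
  congr 1
  ext ω; simp

theorem measureReal_law_le_one [IsProbabilityMeasure μ] (n : ℕ) (i : Fin N) :
    (X.law n i).real Set.univ ≤ 1 := by
  rw [law, map_measureReal_apply (X.measurable_W n) MeasurableSet.univ]
  simp

theorem sum_measureReal_law [IsProbabilityMeasure μ] (n : ℕ) :
    ∑ i, (X.law n i).real Set.univ = 1 := by
  have h : ∀ i, (X.law n i).real Set.univ = μ.real (X.Z n ⁻¹' {i}) := fun i => by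
    rw [law, map_measureReal_apply (X.measurable_W n) MeasurableSet.univ]
    simp; rfl
  simp_rw [h]
  rw [← measureReal_biUnion_finset]
  · have : (⋃ i ∈ (Finset.univ : Finset (Fin N)), X.Z n ⁻¹' {i}) = Set.univ := by ext ω; simp
    rw [this]; simp
  · intro i _ i' _ hii
    refine Set.disjoint_left.2 fun ω h h' => hii ?_
    simp at h h'
    exact h.symm.trans h'
  · exact fun i _ => X.measurable_Z n (measurableSet_singleton i)

end Realization

end ModelI

/-! ### The functional equation for the limit -/

namespace ModelI

variable {N : ℕ} (M : ModelI N)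

/-- A vector that is subinvariant for a stochastic matrix is invariant, since the totals agree. -/
theorem eq_vecMul_of_le {x : Fin N → ℝ} (h : ∀ j, x j ≤ (x ᵥ* M.P) j) : x ᵥ* M.P = x := by
  have hsum : ∑ j, (x ᵥ* M.P) j = ∑ j, x j := by
    simp only [Matrix.vecMul, dotProduct]
    rw [Finset.sum_comm]
    simp_rw [← Finset.mul_sum, M.P_row, mul_one]
  funext j
  exact ((Finset.sum_eq_sum_iff_of_le fun j _ => h j).1 hsum.symm j (Finset.mem_univ j)).symm

/-- A nonnegative invariant vector of an irreducible matrix is zero or positive. -/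
theorem pos_of_vecMul_eq {x : Fin N → ℝ} (h0 : ∀ i, 0 ≤ x i) (hx : x ᵥ* M.P = x) {i : Fin N}
    (hi : 0 < x i) (j : Fin N) : 0 < x j := by
  obtain ⟨k, -, hk⟩ := (Matrix.isIrreducible_iff_exists_pow_pos M.P_nonneg).1 M.P_irreducible i j
  have hpow : x ᵥ* M.P ^ k = x := by
    clear hk
    induction k with
    | zero => simp
    | succ k ih => rw [pow_succ, ← Matrix.vecMul_vecMul, ih, hx]
  have hnn : ∀ i j, 0 ≤ (M.P ^ k) i j := by
    clear hk hpow
    induction k with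
    | zero => intro i j; rw [pow_zero, Matrix.one_apply]; split_ifs <;> norm_num
    | succ k ih =>
      intro i j
      rw [pow_succ, Matrix.mul_apply]
      exact Finset.sum_nonneg fun l _ => mul_nonneg (ih i l) (M.P_nonneg l j)
  rw [← hpow]
  simp only [Matrix.vecMul, dotProduct]
  exact (mul_pos hi hk).trans_le (Finset.single_le_sum (f := fun i => x i * (M.P ^ k) i j)
    (fun i _ => mul_nonneg (h0 i) (hnn i j)) (Finset.mem_univ i))

/-- Uniqueness of the stationary vector, also among vectors that may change sign: with `d` the
difference, `|d| + d` is a nonnegative invariant vector, so it is zero or positive, and `∑ d = 0`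
excludes the latter. -/
theorem stationary_unique {x y : Fin N → ℝ} (hx : x ᵥ* M.P = x) (hy : y ᵥ* M.P = y)
    (hsum : ∑ i, x i = ∑ i, y i) : x = y := by
  set d : Fin N → ℝ := fun i => x i - y i with hd
  have hd0 : ∑ i, d i = 0 := by simp [hd, Finset.sum_sub_distrib, hsum]
  have hdP : d ᵥ* M.P = d := by
    have : d = x - y := rfl
    rw [this, Matrix.sub_vecMul, hx, hy]
  have habs : (fun i => |d i|) ᵥ* M.P = fun i => |d i| := by
    refine M.eq_vecMul_of_le fun j => ?_
    have h1 := congrFun hdP j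
    rw [← h1]
    simp only [Matrix.vecMul, dotProduct]
    refine (Finset.abs_sum_le_sum_abs _ _).trans (le_of_eq (Finset.sum_congr rfl fun i _ => ?_))
    rw [abs_mul, abs_of_nonneg (M.P_nonneg i j)]
  -- Twice the positive part of the difference is again invariant.
  have hz : (fun i => |d i| + d i) ᵥ* M.P = fun i => |d i| + d i := by
    have : (fun i => |d i| + d i) = (fun i => |d i|) + d := rfl
    rw [this, Matrix.add_vecMul, habs, hdP]
  have hle : ∀ i, d i ≤ 0 := by
    by_contra! hpos
    obtain ⟨i, hi⟩ := hpos
    have hall := M.pos_of_vecMul_eq (fun i => by linarith [neg_abs_le (d i)]) hz (i := i)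
      (by positivity)
    have : ∀ j, 0 < d j := fun j => by
      by_contra! h
      have := hall j
      rw [abs_of_nonpos h] at this
      linarith
    have h2 := Finset.sum_pos (s := Finset.univ) (fun j _ => this j) ⟨i, Finset.mem_univ i⟩
    linarith
  have h3 := (Finset.sum_eq_zero_iff_of_nonpos fun i _ => hle i).1 hd0
  funext i
  have := h3 i (Finset.mem_univ i)
  simp only [hd] at this
  linarith

/-- The coefficients of a family of polynomials of degree at most `deg j`; higher ones are dropped. -/
def coeffsOf (p : Fin N → ℂ[X]) : M.Coeffs := fun j w => (p j).coeff w

theorem num_coeffsOf {p : Fin N → ℂ[X]} {j : Fin N} (hp : (p j).natDegree ≤ M.deg j) (s : ℂ) :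
    M.num (M.coeffsOf p) j s = (p j).eval s := by
  rw [eval_eq_sum_range' (Nat.lt_succ_of_le hp), num]
  simp only [coeffsOf]
  rw [Fin.sum_univ_eq_sum_range (fun w => (p j).coeff w * s ^ w)]

/-- The functional equation with its denominators cleared; in this form it makes sense also at the
poles. -/
def FunctionalEq (c : M.Coeffs) (Φ : ℂ → Fin N → ℂ) : Prop :=
  ∀ s : ℂ, 0 ≤ s.re → ∀ j, M.den j s * Φ s j
    - ∑ i, M.G s j i * (M.p₁ * Φ s i + M.p₂ * Φ (M.a * s) i) = M.num c j s

variable {M}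

/-- The polynomials of `exists_polynomial_stepMax` converge along the recursion, as their values on the
right half-plane do. The limits are the numerators, and at the poles `t i k` the equation passes to
the limit under the integral. -/
theorem exists_coeffs {Ω : Type*} [MeasurableSpace Ω] {μ : Measure Ω} [IsProbabilityMeasure μ]
    (X : M.Realization μ) {Φ : ℂ → Fin N → ℂ}
    (hΦ : ∀ (s : ℂ) (i : Fin N), 0 ≤ s.re →
      Tendsto (fun n => X.transform n s i) atTop (𝓝 (Φ s i))) :
    ∃ c : M.Coeffs, M.FunctionalEq c Φ ∧ ∀ i k j, (M.p₃ : ℂ) * ∑ i', M.G (M.t i k) j i' *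
      ∫ y : ℝ, Φ (M.t i k * (y : ℂ)) i' ∂(ProbabilityTheory.cond M.lawV (Set.Iio 0))
        = M.num c j (M.t i k) := by
  simp_rw [X.transform_eq_lst] at hΦ
  have hb : ∀ n i (s : ℂ), 0 ≤ s.re → ‖lst (X.law n i) s‖ ≤ 1 := fun n i s hs =>
    (norm_lst_le (ae_re_mul_nonneg (X.law_Iio n i) hs)).trans (X.measureReal_law_le_one n i)
  choose p hp hp1 hp2 using fun n j => M.exists_polynomial_stepMax (X.law n) (X.law_Iio n) j
  simp_rw [← X.law_succ] at hp1
  have hlim : ∀ j (s : ℂ), 0 ≤ s.re → Tendsto (fun n => (p n j).eval s) atTop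
      (𝓝 (M.den j s * Φ s j - ∑ i, M.G s j i * (M.p₁ * Φ s i + M.p₂ * Φ (M.a * s) i))) := by
    intro j s hs
    have hs' : 0 ≤ ((M.a : ℂ) * s).re := by rw [re_mul_a]; exact mul_nonneg M.a_pos.le hs
    refine Tendsto.congr (fun n => hp1 n j s hs) ?_
    exact (((hΦ s j hs).comp (tendsto_add_atTop_nat 1)).const_mul _).sub
      (tendsto_finsetSum _ fun i _ => (((hΦ s i hs).const_mul _).add
        ((hΦ _ i hs').const_mul _)).const_mul _)
  choose q hq hq' using fun j => exists_tendsto_eval (fun n => hp n j) (hlim j)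
  refine ⟨M.coeffsOf q, fun s hs j => ?_, fun i k j => ?_⟩
  · rw [M.num_coeffsOf (hq j)]
    exact tendsto_nhds_unique (hlim j s hs) (hq' j s)
  · rw [M.num_coeffsOf (hq j), Finset.mul_sum]
    refine tendsto_nhds_unique (f := fun n => (p n j).eval (M.t i k)) ?_ (hq' j _)
    have hre := M.t_re i k
    have hden : M.den j (M.t i k) = 0 := by
      rw [den_eq, Finset.prod_eq_zero (i := i) (Finset.mem_univ _)
        (Finset.prod_eq_zero (i := k) (Finset.mem_univ _) (by simp)), mul_zero]
    refine Tendsto.congr (fun n => hp2 n j _ hre.le hden) ?_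
    refine tendsto_finsetSum _ fun i' _ => ?_
    rw [mul_left_comm, M.p₃_mul_integral_cond]
    refine Tendsto.const_mul _ ?_
    have hpos : ∀ y : ℝ, y < 0 → 0 ≤ (M.t i k * (y : ℂ)).re := fun y hy => by
      rw [Complex.re_mul_ofReal]; exact mul_nonneg_of_nonpos_of_nonpos hre.le hy.le
    refine tendsto_integral_of_dominated_convergence (fun _ => 1) (fun n => ?_) (integrable_const _)
      (fun n => M.ae_negV.mono fun y hy => hb n i' _ (hpos y hy))
      (M.ae_negV.mono fun y hy => hΦ _ i' (hpos y hy))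
    refine ContinuousOn.aestronglyMeasurable (s := Set.Iio 0) ?_ measurableSet_Iio
    exact (continuousOn_lst (X.law_Iio n i')).comp (by fun_prop) fun y hy => hpos y hy

/-- The masses `Φ i 0` form an invariant vector of total mass `1`. -/
theorem limit_zero_eq {Ω : Type*} [MeasurableSpace Ω] {μ : Measure Ω} [IsProbabilityMeasure μ]
    (X : M.Realization μ) {Φ : ℂ → Fin N → ℂ}
    (hΦ : ∀ (s : ℂ) (i : Fin N), 0 ≤ s.re →
      Tendsto (fun n => X.transform n s i) atTop (𝓝 (Φ s i)))
    {π : Fin N → ℝ} (hπ_sum : ∑ i, π i = 1) (hπ : π ᵥ* M.P = π) (i : Fin N) :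
    Φ 0 i = π i := by
  have h0 := fun i => hΦ 0 i (by simp)
  simp_rw [X.transform_eq_lst, lst_zero_arg] at h0
  have hre : ∀ i, Tendsto (fun n => (X.law n i).real Set.univ) atTop (𝓝 (Φ 0 i).re) := fun i =>
    (Complex.continuous_re.tendsto _).comp (h0 i)
  have him : ∀ i, (Φ 0 i).im = 0 := fun i =>
    tendsto_nhds_unique ((Complex.continuous_im.tendsto _).comp (h0 i))
      (by simp [Function.comp_def])
  have hsum : ∑ i, (Φ 0 i).re = 1 := by
    refine tendsto_nhds_unique (tendsto_finsetSum _ fun i _ => hre i) ?_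
    simp_rw [X.sum_measureReal_law]
    exact tendsto_const_nhds
  have hinv : (fun i => (Φ 0 i).re) ᵥ* M.P = fun i => (Φ 0 i).re := by
    funext j
    have h1 : ∀ n, (X.law (n + 1) j).real Set.univ
        = ∑ i, (X.law n i).real Set.univ * M.P i j := fun n => by
      rw [X.law_succ, stepMax, map_measureReal_apply (by fun_prop) MeasurableSet.univ,
        Set.preimage_univ, M.measureReal_step]
      simp [mul_comm]
    refine tendsto_nhds_unique (f := fun n => ∑ i, (X.law n i).real Set.univ * M.P i j)
      (tendsto_finsetSum _ fun i _ => (hre i).mul_const _) ?_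
    exact Tendsto.congr h1 ((hre j).comp (tendsto_add_atTop_nat 1))
  have := congrFun (M.stationary_unique hinv hπ (by rw [hsum, hπ_sum])) i
  exact Complex.ext (by simpa using this) (by simpa using him i)

variable {c : M.Coeffs} {Φ : ℂ → Fin N → ℂ}

theorem num_zero (c : M.Coeffs) (j : Fin N) : M.num c j 0 = c j 0 := by
  rw [num, Finset.sum_eq_single 0]
  · simp
  · intro w _ hw
    rw [zero_pow fun h => hw (Fin.ext h), mul_zero]
  · simp

namespace FunctionalEq

theorem coeff_zero (h : M.FunctionalEq c Φ) {π : Fin N → ℝ} (hπ : π ᵥ* M.P = π)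
    (hΦ : ∀ i, Φ 0 i = π i) (j : Fin N) : c j 0 = (π j : ℂ) * (M.p₃ : ℂ) * M.den j 0 := by
  have h0 := h 0 (by simp) j
  have hreg := M.regular_of_re_eq_zero (s := 0) (by simp)
  have hG : ∀ i, M.G 0 j i = M.den j 0 * M.P i j := fun i => by
    rw [M.G_eq_den_mul_F (fun i => M.DB_eval_ne_zero i hreg.1) hreg.2, F_apply, H_zero, mul_one]
  have hP : ∑ i, (π i : ℂ) * M.P i j = π j := by
    have := congrFun hπ j
    simp only [Matrix.vecMul, dotProduct] at this
    exact_mod_cast this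
  rw [num_zero, mul_zero] at h0
  rw [← h0]
  simp only [hG, hΦ]
  have : ∑ i, M.den j 0 * M.P i j * (M.p₁ * (π i : ℂ) + M.p₂ * π i)
      = M.den j 0 * (M.p₁ + M.p₂) * ∑ i, (π i : ℂ) * M.P i j := by
    rw [Finset.mul_sum]; exact Finset.sum_congr rfl fun i _ => by ring
  rw [this, hP, p₃]
  push_cast
  ring

theorem sub_eq (h : M.FunctionalEq c Φ) {s : ℂ} (hs : s ∈ M.regular) (j : Fin N) :
    Φ s j - ∑ i, M.F s j i * (M.p₁ * Φ s i + M.p₂ * Φ (M.a * s) i) = M.v c s j := by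
  have hd := M.den_ne_zero hs j
  rw [v, eq_div_iff hd, ← h s hs.1 j]
  simp only [M.G_eq_den_mul_F (fun i => M.DB_eval_ne_zero i hs.1) hs.2, mul_assoc,
    ← Finset.mul_sum]
  ring

theorem eq_mulVec (h : M.FunctionalEq c Φ) {s : ℂ} (hs : s ∈ M.regular) :
    Φ s = (M.p₁ : ℂ) • (M.F s *ᵥ Φ s) + (M.p₂ : ℂ) • (M.F s *ᵥ Φ (M.a * s)) + M.v c s := by
  funext j
  have := h.sub_eq hs j
  simp only [Pi.add_apply, Pi.smul_apply, smul_eq_mul, Matrix.mulVec, dotProduct, ← this,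
    mul_add, Finset.sum_add_distrib]
  rw [Finset.mul_sum, Finset.mul_sum]
  simp only [mul_left_comm]
  ring

theorem eq_R_mulVec (h : M.FunctionalEq c Φ) {s : ℂ} (hs : s ∈ M.Om) :
    Φ s = M.R s *ᵥ Φ (M.a * s) + M.Vt c s :=
  (M.eq_R_mulVec_add_iff hs.2).2 (h.eq_mulVec hs.1)

theorem null_vec (h : M.FunctionalEq c Φ) {δ : ℂ} (hδ : δ ∈ M.regular) {ζ : Fin N → ℂ}
    (hζ : ζ ᵥ* (1 - (M.p₁ : ℂ) • M.F δ) = 0) :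
    (M.p₂ : ℂ) * (ζ ⬝ᵥ (M.F δ *ᵥ Φ ((M.a : ℂ) * δ))) = -(ζ ⬝ᵥ M.v c δ) := by
  have h1 : (1 - (M.p₁ : ℂ) • M.F δ) *ᵥ Φ δ
      = (M.p₂ : ℂ) • (M.F δ *ᵥ Φ (M.a * δ)) + M.v c δ := by
    rw [Matrix.sub_mulVec, Matrix.one_mulVec, Matrix.smul_mulVec, sub_eq_iff_eq_add']
    conv_lhs => rw [h.eq_mulVec hδ]
    rw [add_assoc]
  have h2 := congrArg (fun x => ζ ⬝ᵥ x) h1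
  simp only [Matrix.dotProduct_mulVec, hζ, zero_dotProduct, dotProduct_add, dotProduct_smul,
    smul_eq_mul] at h2
  rw [Matrix.dotProduct_mulVec]
  linear_combination -h2

/-- The equation at a right root. Unlike `null_vec`, it is valid also at a pole of `F`. -/
theorem right (h : M.FunctionalEq c Φ) {δ : ℂ} (hδ : 0 ≤ δ.re) {ζ : Fin N → ℂ}
    (hζ : ζ ᵥ* (M.kernel.map (eval δ)) = 0) :
    (M.p₂ : ℂ) * (ζ ⬝ᵥ (M.G δ *ᵥ Φ ((M.a : ℂ) * δ))) = -(ζ ⬝ᵥ fun j => M.num c j δ) := by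
  have h1 : (fun j => M.num c j δ) = M.kernel.map (eval δ) *ᵥ (fun i => M.DBerase i δ * Φ δ i)
      - (M.p₂ : ℂ) • (M.G δ *ᵥ Φ (M.a * δ)) := by
    funext j
    simp only [Pi.sub_apply, Pi.smul_apply, smul_eq_mul, Matrix.mulVec, dotProduct, ← mul_assoc,
      M.kernel_mul_DBerase, ← h δ hδ j, sub_mul, Finset.sum_sub_distrib, ite_mul, zero_mul,
      Finset.sum_ite_eq', Finset.mem_univ, if_true, mul_add, Finset.sum_add_distrib, Finset.mul_sum]
    rw [← sub_sub]
    congr 1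
    · congr 1
      exact Finset.sum_congr rfl fun i _ => by ring
    · exact Finset.sum_congr rfl fun i _ => by ring
  rw [h1, dotProduct_sub, Matrix.dotProduct_mulVec ζ (M.kernel.map (eval δ)), hζ, zero_dotProduct,
    dotProduct_smul, smul_eq_mul]
  ring

end FunctionalEq

end ModelI

/-! ### Analytic continuation of the series -/

namespace ModelI

variable {N : ℕ} (M : ModelI N)

/-- The right-hand side of the functional equation after clearing denominators, with `x` in place of
`Φ(as)`. -/
def rhs (c : M.Coeffs) (x : Fin N → ℂ) (s : ℂ) (j : Fin N) : ℂ :=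
  M.num c j s + M.p₂ * ∑ i, M.G s j i * x i

/-- The numerator in Cramer's rule for the functional equation, with `Ψ(as)` as the known vector. -/
def cramerNum (c : M.Coeffs) (Ψ : ℂ → Fin N → ℂ) (i : Fin N) (s : ℂ) : ℂ :=
  ∑ j, (M.kernel.adjugate i j).eval s * M.rhs c (Ψ (M.a * s)) s j

/-- The solution of the functional equation by Cramer's rule, with `Ψ(as)` as the known vector. At a
zero of the determinant the value is the one of l'Hôpital's rule. -/
def nextIter (c : M.Coeffs) (Ψ : ℂ → Fin N → ℂ) (s : ℂ) (i : Fin N) : ℂ :=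
  (if M.kernelDet.eval s = 0 then deriv (M.cramerNum c Ψ i) s / M.kernelDet.derivative.eval s
    else M.cramerNum c Ψ i s / M.kernelDet.eval s) / M.DBerase i s

/-- All components are continuous on the closed half-disc `Re s ≥ 0`, `‖s‖ < r`, and holomorphic in its
interior. -/
structure RegularOn (r : ℝ) (Ψ : ℂ → Fin N → ℂ) : Prop where
  cont : ∀ i, ContinuousOn (fun s => Ψ s i) {s : ℂ | 0 ≤ s.re ∧ ‖s‖ < r}
  diff : ∀ i, DifferentiableOn ℂ (fun s => Ψ s i) {s : ℂ | 0 < s.re ∧ ‖s‖ < r}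

theorem isOpen_halfDisc (r : ℝ) : IsOpen {s : ℂ | 0 < s.re ∧ ‖s‖ < r} :=
  (isOpen_lt continuous_const Complex.continuous_re).inter (isOpen_lt continuous_norm continuous_const)

theorem kernelDet_ne_zero : M.kernelDet ≠ 0 := M.kernelDet_ne_zero_and_rightCount.1

theorem adjugate_eval (s : ℂ) (i j : Fin N) :
    (M.kernel.adjugate i j).eval s = (M.kernel.map (eval s)).adjugate i j := by
  have := RingHom.map_adjugate (evalRingHom s) M.kernel
  exact congrFun (congrFun this i) j

theorem cramerNum_eq (c : M.Coeffs) (Ψ : ℂ → Fin N → ℂ) (s : ℂ) :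
    (fun i => M.cramerNum c Ψ i s)
      = (M.kernel.map (eval s)).adjugate *ᵥ M.rhs c (Ψ (M.a * s)) s := by
  funext i
  simp only [cramerNum, adjugate_eval, Matrix.mulVec, dotProduct]

variable {M}

/-- Where the functional equation can be solved, Cramer's rule gives its solution. -/
theorem nextIter_eq (c : M.Coeffs) (Ψ : ℂ → Fin N → ℂ) {s : ℂ} (hs : s ∈ M.Om) :
    M.nextIter c Ψ s = M.R s *ᵥ Ψ (M.a * s) + M.Vt c s := by
  set y := M.R s *ᵥ Ψ (M.a * s) + M.Vt c s with hy
  have h1 := (M.eq_R_mulVec_add_iff hs.2).1 hy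
  have hK := M.kernelDet_eval_ne_zero hs
  have h2 : M.kernel.map (eval s) *ᵥ (fun i => M.DBerase i s * y i) = M.rhs c (Ψ (M.a * s)) s := by
    funext j
    have h3 := congrFun h1 j
    simp only [Pi.add_apply, Pi.smul_apply, smul_eq_mul, Matrix.mulVec, dotProduct] at h3
    have hd := M.den_ne_zero hs.1 j
    have hv : M.num c j s = M.den j s * M.v c s j := by rw [v]; field_simp
    have hG := M.G_eq_den_mul_F (fun i => M.DB_eval_ne_zero i hs.1.1) hs.1.2 j
    simp only [Matrix.mulVec, dotProduct, ← mul_assoc, M.kernel_mul_DBerase, rhs, hv, hG, sub_mul,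
      Finset.sum_sub_distrib, ite_mul, zero_mul, Finset.sum_ite_eq', Finset.mem_univ, if_true]
    simp only [mul_assoc, ← Finset.mul_sum, mul_left_comm (M.p₁ : ℂ) (M.den j s)]
    linear_combination M.den j s * h3
  funext i
  have h3 : (fun i => M.cramerNum c Ψ i s)
      = fun i => M.kernelDet.eval s * (M.DBerase i s * y i) := by
    rw [cramerNum_eq, ← h2, Matrix.mulVec_mulVec, Matrix.adjugate_mul, ← kernelDet_eval,
      Matrix.smul_mulVec, Matrix.one_mulVec]
    rfl
  have hD := M.DBerase_ne_zero i hs.1.1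
  rw [nextIter, if_neg hK, congrFun h3 i]
  field_simp

theorem RegularOn.mono {r r' : ℝ} {Ψ : ℂ → Fin N → ℂ} (h : RegularOn r Ψ) (hr : r' ≤ r) :
    RegularOn r' Ψ :=
  ⟨fun i => (h.cont i).mono fun _ hs => ⟨hs.1, hs.2.trans_le hr⟩,
    fun i => (h.diff i).mono fun _ hs => ⟨hs.1, hs.2.trans_le hr⟩⟩

theorem RegularOn.congr {r : ℝ} {Ψ Ψ' : ℂ → Fin N → ℂ} (h : RegularOn r Ψ)
    (he : ∀ s : ℂ, 0 ≤ s.re → ‖s‖ < r → Ψ' s = Ψ s) : RegularOn r Ψ' :=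
  ⟨fun i => (h.cont i).congr fun s hs => congrFun (he s hs.1 hs.2) i,
    fun i => (h.diff i).congr fun s hs => congrFun (he s hs.1.le hs.2) i⟩

theorem differentiable_num (c : M.Coeffs) (j : Fin N) : Differentiable ℂ (M.num c j) := by
  unfold num; fun_prop

theorem differentiable_DBerase (i : Fin N) : Differentiable ℂ (M.DBerase i) := by
  unfold DBerase
  exact Differentiable.fun_finsetProd fun k _ => (M.DB k).differentiable

theorem differentiable_G (j i : Fin N) : Differentiable ℂ (fun s => M.G s j i) := by
  simp_rw [← GPoly_eval]
  exact (M.GPoly j i).differentiable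

/-- One use of the functional equation enlarges the half-disc by the factor `1 / a`, if at each zero
of the determinant the numerators vanish and the zero is simple. -/
theorem RegularOn.nextIter {c : M.Coeffs} {r r' : ℝ} {Ψ : ℂ → Fin N → ℂ} (h : RegularOn r Ψ)
    (hr : M.a * r' ≤ r) (hz : ∀ z : ℂ, 0 < z.re → ‖z‖ < r' → M.kernelDet.eval z = 0 →
      M.kernelDet.rootMultiplicity z = 1 ∧ ∀ i, M.cramerNum c Ψ i z = 0) :
    RegularOn r' (M.nextIter c Ψ) := by
  have hmem : ∀ s : ℂ, ‖s‖ < r' → ‖(M.a : ℂ) * s‖ < r := fun s hs => by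
    rw [norm_mul_a]
    exact (mul_lt_mul_of_pos_left hs M.a_pos).trans_le hr
  have hcc : ∀ i, ContinuousOn (M.cramerNum c Ψ i) {s : ℂ | 0 ≤ s.re ∧ ‖s‖ < r'} := by
    intro i
    refine continuousOn_finsetSum _ fun j _ => (Polynomial.continuous _).continuousOn.mul
      ((differentiable_num c j).continuous.continuousOn.add (continuousOn_const.mul
        (continuousOn_finsetSum _ fun k _ => (differentiable_G j k).continuous.continuousOn.mul
          ((h.cont k).comp (by fun_prop) fun s hs => ⟨?_, hmem s hs.2⟩))))
    rw [re_mul_a]; exact mul_nonneg M.a_pos.le hs.1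
  have hcd : ∀ i, DifferentiableOn ℂ (M.cramerNum c Ψ i) {s : ℂ | 0 < s.re ∧ ‖s‖ < r'} := by
    intro i
    refine DifferentiableOn.fun_sum fun j _ => (Polynomial.differentiable _).differentiableOn.mul
      ((differentiable_num c j).differentiableOn.add ((differentiableOn_const _).mul
        (DifferentiableOn.fun_sum fun k _ => (differentiable_G j k).differentiableOn.mul
          ((h.diff k).comp (by fun_prop) fun s hs => ⟨?_, hmem s hs.2⟩))))
    rw [re_mul_a]; exact mul_pos M.a_pos hs.1
  have hdiff : ∀ i, DifferentiableOn ℂ (fun s => M.nextIter c Ψ s i)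
      {s : ℂ | 0 < s.re ∧ ‖s‖ < r'} := fun i =>
    (Complex.exists_differentiableOn_div (isOpen_halfDisc r') M.kernelDet_ne_zero (hcd i)
      fun z hz1 hz2 => ⟨(hz z hz1.1 hz1.2 hz2).1, (hz z hz1.1 hz1.2 hz2).2 i⟩).div
      (differentiable_DBerase i).differentiableOn fun s hs => M.DBerase_ne_zero i hs.1.le
  refine ⟨fun i s hs => ?_, hdiff⟩
  rcases hs.1.lt_or_eq with h0 | h0
  · exact (((hdiff i) s ⟨h0, hs.2⟩).differentiableAt
      ((isOpen_halfDisc r').mem_nhds ⟨h0, hs.2⟩)).continuousAt.continuousWithinAt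
  -- The determinant has no zero on the imaginary axis, so there the quotient is an ordinary one.
  · have hK := M.kernelDet_eval_ne_zero (M.Om_of_re_eq_zero h0.symm)
    have hq : ContinuousWithinAt
        (fun s => M.cramerNum c Ψ i s / M.kernelDet.eval s / M.DBerase i s)
        {s : ℂ | 0 ≤ s.re ∧ ‖s‖ < r'} s :=
      ((hcc i s hs).div M.kernelDet.continuous.continuousWithinAt hK).div
        (differentiable_DBerase i).continuous.continuousWithinAt (M.DBerase_ne_zero i hs.1)
    refine hq.congr_of_eventuallyEq ?_ (by rw [ModelI.nextIter, if_neg hK])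
    have := M.kernelDet.continuous.continuousAt.eventually_ne hK
    filter_upwards [nhdsWithin_le_nhds this] with w hw
    rw [ModelI.nextIter, if_neg hw]

theorem IsRadius.regularOn_series {c : M.Coeffs} {ρ B : ℝ} (hρ : M.IsRadius c ρ B) :
    RegularOn ρ (M.series c) := by
  set S : ℕ → ℂ → Fin N → ℂ := fun n s => ∑ k ∈ Finset.range n, M.term c s k with hS
  have hS0 : ∀ n s, S (n + 1) s = M.R s *ᵥ S n (M.a * s) + M.Vt c s := by
    intro n s
    simp only [hS]
    rw [Finset.sum_range_succ', term_zero, Matrix.mulVec_sum]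
    simp_rw [term_succ]
  have hreg : ∀ n, RegularOn ρ (S n) := by
    intro n
    induction n with
    | zero => exact ⟨fun i => by simp [hS, continuousOn_const],
        fun i => by simpa [hS] using differentiableOn_const _⟩
    | succ n ih =>
      refine (ih.nextIter (c := c) (r' := ρ)
        (mul_le_of_le_one_left hρ.pos.le M.a_lt.le) ?_).congr ?_
      · intro z hz hzr h0
        exact absurd h0 (M.kernelDet_eval_ne_zero (hρ.mem_Om hzr hz.le))
      · intro s hs hsr
        rw [nextIter_eq c _ (hρ.mem_Om hsr hs), hS0]
  have hunif : ∀ i, TendstoUniformlyOn (fun n s => S n s i) (fun s => M.series c s i) atTop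
      {s : ℂ | ‖s‖ < ρ} := by
    intro i
    have h1 := tendstoUniformlyOn_tsum_nat (f := fun k s => M.term c s k i) (s := {s : ℂ | ‖s‖ < ρ})
      (IsRadius.summable_bound (M := M) (B := B))
      (fun n s hs => (norm_le_pi_norm _ i).trans (hρ.norm_term_le hs n))
    refine (h1.congr (Eventually.of_forall fun n s _ => ?_)).congr_right fun s _ => ?_
    · simp [hS, Finset.sum_apply]
    · exact (tsum_apply (summable_term c s)).symm
  refine ⟨fun i => ?_, fun i => ?_⟩
  · exact ((hunif i).mono fun s hs => hs.2).continuousOn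
      (Frequently.of_forall fun n => (hreg n).cont i)
  · exact ((hunif i).mono fun s hs => hs.2).tendstoLocallyUniformlyOn.differentiableOn
      (Eventually.of_forall fun n => (hreg n).diff i) (isOpen_halfDisc ρ)

/-- The successive continuations of the series, from the disc of convergence outwards. -/
def iter (c : M.Coeffs) : ℕ → ℂ → Fin N → ℂ
  | 0 => M.series c
  | n + 1 => M.nextIter c (iter c n)

theorem iter_eq_series (c : M.Coeffs) (n : ℕ) {s : ℂ} (hs : M.Good s) :
    iter c n s = M.series c s := by
  induction n generalizing s with
  | zero => rfl
  | succ n ih => rw [iter, nextIter_eq c _ hs.mem_Om, ih hs.mul, series_eq c s]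

/-- At a right root the rows of the adjugate are left null vectors of the kernel, so the equations of
the system say that the numerators in Cramer's rule vanish. -/
theorem cramerNum_eq_zero {c : M.Coeffs} {Ψ : ℂ → Fin N → ℂ} {δ : ℂ}
    (hK : M.kernelDet.eval δ = 0) (hright : ∀ ζ : Fin N → ℂ, ζ ᵥ* (M.kernel.map (eval δ)) = 0 →
      (M.p₂ : ℂ) * (ζ ⬝ᵥ (M.G δ *ᵥ Ψ ((M.a : ℂ) * δ))) = -(ζ ⬝ᵥ fun j => M.num c j δ))
    (i : Fin N) : M.cramerNum c Ψ i δ = 0 := by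
  have hζ : (M.kernel.map (eval δ)).adjugate i ᵥ* (M.kernel.map (eval δ)) = 0 := by
    have h1 : (M.kernel.map (eval δ)).adjugate * M.kernel.map (eval δ) = 0 := by
      rw [Matrix.adjugate_mul, ← kernelDet_eval, hK, zero_smul]
    exact congrFun h1 i
  have h2 := hright _ hζ
  rw [congrFun (M.cramerNum_eq c Ψ δ) i]
  have h3 : M.rhs c (Ψ (M.a * δ)) δ
      = (fun j => M.num c j δ) + (M.p₂ : ℂ) • (M.G δ *ᵥ Ψ (M.a * δ)) := by
    funext j; simp [rhs, Matrix.mulVec, dotProduct]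
  rw [h3]
  change (M.kernel.map (eval δ)).adjugate i ⬝ᵥ _ = 0
  rw [dotProduct_add, dotProduct_smul, smul_eq_mul, h2]
  ring

end ModelI

namespace ModelI

variable {N : ℕ} (M : ModelI N)

theorem denPoly_natDegree (j : Fin N) : (M.denPoly j).natDegree = M.deg j := by
  have h1 : (∏ k, M.DB k).Monic := monic_prod_of_monic _ _ fun k _ => M.DB_monic k
  rw [denPoly, natDegree_mul (M.DA_comp_ne_zero j) h1.ne_zero, natDegree_comp_neg_X, DA_natDegree, deg,
    natDegree_prod_of_monic _ _ fun k _ => M.DB_monic k]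
  simp [DB_natDegree]

theorem denPoly_ne_zero (j : Fin N) : M.denPoly j ≠ 0 :=
  mul_ne_zero (M.DA_comp_ne_zero j) (Finset.prod_ne_zero_iff.2 fun k _ => (M.DB_monic k).ne_zero)

/-- The `j`-th numerator as a polynomial. -/
def numPoly (c : M.Coeffs) (j : Fin N) : ℂ[X] := ∑ w, C (c j w) * X ^ (w : ℕ)

variable {M}

theorem numPoly_eval (c : M.Coeffs) (j : Fin N) (s : ℂ) :
    (M.numPoly c j).eval s = M.num c j s := by
  simp [numPoly, num, eval_finsetSum]

theorem numPoly_natDegree_le (c : M.Coeffs) (j : Fin N) : (M.numPoly c j).natDegree ≤ M.deg j :=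
  natDegree_sum_le_of_forall_le _ _ fun w _ =>
    (natDegree_C_mul_X_pow_le _ _).trans (Nat.lt_succ_iff.1 w.2)

theorem tendsto_v (c : M.Coeffs) (j : Fin N) : ∃ L : ℂ,
    Tendsto (fun s => M.v c s j) (Bornology.cobounded ℂ) (𝓝 L) := by
  have h1 := (M.numPoly c j).tendsto_eval_div_pow (numPoly_natDegree_le c j)
  have h2 := (M.denPoly j).tendsto_eval_div_pow (M.denPoly_natDegree_le j)
  have h3 : (M.denPoly j).coeff (M.deg j) ≠ 0 := by
    rw [← M.denPoly_natDegree j]; exact leadingCoeff_ne_zero.2 (M.denPoly_ne_zero j)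
  refine ⟨_, (h1.div h2 h3).congr' ?_⟩
  filter_upwards [Bornology.eventually_ne_cobounded (0 : ℂ)] with s hs
  rw [Pi.div_apply, numPoly_eval, denPoly_eval, v, div_div_div_cancel_right₀ (pow_ne_zero _ hs)]

theorem exists_eventually_v_le (c : M.Coeffs) :
    ∃ D : ℝ, 0 ≤ D ∧ ∀ᶠ s : ℂ in Bornology.cobounded ℂ, ∑ j, ‖M.v c s j‖ ≤ D := by
  choose L hL using tendsto_v c
  have h := tendsto_finsetSum Finset.univ fun j _ => (hL j).norm
  refine ⟨∑ j, ‖L j‖ + 1, by positivity, ?_⟩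
  exact (h.eventually_lt_const (lt_add_one _)).mono fun _ h => h.le

theorem norm_lt_div_of_mul {ρ : ℝ} {n : ℕ} {s : ℂ} (hs : ‖s‖ < ρ / M.a ^ (n + 1)) :
    ‖(M.a : ℂ) * s‖ < ρ / M.a ^ n := by
  have ha := M.a_pos
  rw [norm_mul_a]
  calc M.a * ‖s‖ < M.a * (ρ / M.a ^ (n + 1)) := mul_lt_mul_of_pos_left hs ha
    _ = ρ / M.a ^ n := by field_simp; ring

theorem IsRadius.regularOn_iter {c : M.Coeffs} {ρ B : ℝ} (hρ : M.IsRadius c ρ B) (hG : M.Generic)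
    (hright : ∀ δ, M.IsRightRoot δ → ∀ ζ : Fin N → ℂ, ζ ᵥ* (M.kernel.map (eval δ)) = 0 →
      (M.p₂ : ℂ) * (ζ ⬝ᵥ (M.G δ *ᵥ M.series c ((M.a : ℂ) * δ))) = -(ζ ⬝ᵥ fun j => M.num c j δ))
    (n : ℕ) : RegularOn (ρ / M.a ^ n) (iter c n) := by
  have ha := M.a_pos
  induction n with
  | zero => simpa [iter] using hρ.regularOn_series
  | succ n ih =>
    refine ih.nextIter (le_of_eq (by field_simp; ring)) fun z hz _ hK =>
      ⟨hG.simple_roots z ⟨hz, hK⟩, cramerNum_eq_zero hK ?_⟩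
    rw [iter_eq_series c n (hG.right_Om z ⟨hz, hK⟩)]
    exact hright z ⟨hz, hK⟩

/-- The continuations agree on their common domain, also at the zeros of the determinant, where the
derivatives in l'Hôpital's rule agree. -/
theorem IsRadius.iter_succ_eq {c : M.Coeffs} {ρ B : ℝ} (hρ : M.IsRadius c ρ B)
    (n : ℕ) {s : ℂ} (hs : 0 ≤ s.re) (hsr : ‖s‖ < ρ / M.a ^ n) : iter c (n + 1) s = iter c n s := by
  induction n generalizing s with
  | zero =>
    have : M.Good s := hρ.good (by simpa using hsr) hs
    rw [iter_eq_series c _ this, iter_eq_series c _ this]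
  | succ n ih =>
    have hcr : ∀ w : ℂ, 0 ≤ w.re → ‖w‖ < ρ / M.a ^ (n + 1) → ∀ i,
        M.cramerNum c (iter c (n + 1)) i w = M.cramerNum c (iter c n) i w := by
      intro w hw hwr i
      rw [cramerNum, cramerNum, ih (by rw [re_mul_a]; exact mul_nonneg M.a_pos.le hw)
        (norm_lt_div_of_mul hwr)]
    rw [iter, iter]
    funext i
    rw [nextIter, nextIter]
    split_ifs with hK
    · have h0 : 0 < s.re := lt_of_le_of_ne hs fun h =>
        M.kernelDet_eval_ne_zero (M.Om_of_re_eq_zero h.symm) hK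
      have : M.cramerNum c (iter c (n + 1)) i =ᶠ[𝓝 s] M.cramerNum c (iter c n) i := by
        filter_upwards [(isOpen_halfDisc _).mem_nhds ⟨h0, hsr⟩] with w hw
        exact hcr w hw.1.le hw.2 i
      rw [← this.deriv_eq, ModelI.iter]
    · rw [← hcr s hs hsr i, ModelI.iter]

theorem IsRadius.iter_eq_of_le {c : M.Coeffs} {ρ B : ℝ} (hρ : M.IsRadius c ρ B)
    {n m : ℕ} (hnm : n ≤ m) {s : ℂ} (hs : 0 ≤ s.re) (hsr : ‖s‖ < ρ / M.a ^ n) :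
    iter c m s = iter c n s := by
  induction m, hnm using Nat.le_induction with
  | base => rfl
  | succ m hm ih =>
    rw [hρ.iter_succ_eq m hs (hsr.trans_le ?_), ih]
    exact div_le_div_of_nonneg_left hρ.pos.le (pow_pos M.a_pos _)
      (pow_le_pow_of_le_one M.a_pos.le M.a_lt.le hm)

/-- In the generic case, if the coefficients satisfy the equations at the right roots, then the series
continues to a function that is holomorphic in the whole right half-plane. -/
theorem exists_extension {c : M.Coeffs} (hG : M.Generic)
    (hright : ∀ δ, M.IsRightRoot δ → ∀ ζ : Fin N → ℂ, ζ ᵥ* (M.kernel.map (eval δ)) = 0 →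
      (M.p₂ : ℂ) * (ζ ⬝ᵥ (M.G δ *ᵥ M.series c ((M.a : ℂ) * δ))) = -(ζ ⬝ᵥ fun j => M.num c j δ)) :
    ∃ Ψ : ℂ → Fin N → ℂ, (∀ r, RegularOn r Ψ) ∧ (∀ s, M.Good s → Ψ s = M.series c s) ∧
      ∀ s ∈ M.Om, Ψ s = M.R s *ᵥ Ψ (M.a * s) + M.Vt c s := by
  obtain ⟨ρ, B, hρ⟩ := exists_isRadius c
  have hex : ∀ r : ℝ, ∃ n : ℕ, r < ρ / M.a ^ n := by
    intro r
    obtain ⟨n, hn⟩ := M.exists_pow_mul_lt hρ.pos (r : ℂ)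
    refine ⟨n, ?_⟩
    rw [norm_mul, norm_pow, Complex.norm_real, Complex.norm_real,
      Real.norm_of_nonneg M.a_pos.le] at hn
    rw [lt_div_iff₀ (pow_pos M.a_pos _), mul_comm]
    exact (mul_le_mul_of_nonneg_left (le_abs_self r) (pow_pos M.a_pos _).le).trans_lt hn
  choose n hn using hex
  have heq : ∀ m : ℕ, ∀ s : ℂ, 0 ≤ s.re → ‖s‖ < ρ / M.a ^ m →
      iter c (n ‖s‖) s = iter c m s := by
    intro m s hs hsr
    rcases le_total m (n ‖s‖) with h | h
    · exact hρ.iter_eq_of_le h hs hsr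
    · exact (hρ.iter_eq_of_le h hs (hn _)).symm
  refine ⟨fun s => iter c (n ‖s‖) s, fun r => ?_, fun s hs => iter_eq_series c _ hs, ?_⟩
  · refine ((hρ.regularOn_iter hG hright (n r)).congr (heq _)).mono (hn r).le
  · intro s hs
    have h0 : 0 ≤ ((M.a : ℂ) * s).re := by
      rw [re_mul_a]; exact mul_nonneg M.a_pos.le hs.1.1
    have h2 : ‖(M.a : ℂ) * s‖ < ρ / M.a ^ n ‖s‖ := (M.norm_mul_a_le s).trans_lt (hn _)
    simp only
    rw [heq _ _ h0 h2, ← nextIter_eq c _ hs]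
    exact (hρ.iter_succ_eq _ hs.1.1 (hn _)).symm

theorem RegularOn.continuousOn {Ψ : ℂ → Fin N → ℂ} (h : ∀ r, RegularOn r Ψ) (i : Fin N) :
    ContinuousOn (fun s => Ψ s i) {s | 0 ≤ s.re} := by
  intro s hs
  have h1 := (h (‖s‖ + 1)).cont i s ⟨hs, lt_add_one _⟩
  refine h1.mono_of_mem_nhdsWithin ?_
  filter_upwards [self_mem_nhdsWithin, nhdsWithin_le_nhds
    ((isOpen_lt continuous_norm continuous_const).mem_nhds (lt_add_one ‖s‖))] with w h2 h3
  exact ⟨h2, h3⟩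

theorem RegularOn.differentiableOn {Ψ : ℂ → Fin N → ℂ} (h : ∀ r, RegularOn r Ψ) (i : Fin N) :
    DifferentiableOn ℂ (fun s => Ψ s i) {s | 0 < s.re} := fun s hs =>
  (((h (‖s‖ + 1)).diff i).differentiableAt
    ((isOpen_halfDisc _).mem_nhds ⟨hs, lt_add_one _⟩)).differentiableWithinAt

/-- A continuous solution of the functional equation is bounded: far from `0` the equation contracts,
so a bound on a large half-disc propagates outwards. -/
theorem exists_bound_of_recursion {c : M.Coeffs} {Ψ : ℂ → Fin N → ℂ}
    (hc : ∀ i, ContinuousOn (fun s => Ψ s i) {s | 0 ≤ s.re})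
    (h : ∀ s ∈ M.Om, Ψ s = M.R s *ᵥ Ψ (M.a * s) + M.Vt c s) :
    ∃ C : ℝ, ∀ s : ℂ, 0 ≤ s.re → ∑ j, ‖Ψ s j‖ ≤ C := by
  obtain ⟨D, hD, hv⟩ := exists_eventually_v_le c
  obtain ⟨r₀, hr₀⟩ := exists_bound_of_eventually_cobounded
    (M.eventually_H_le.and (M.eventually_DA_ne_zero.and hv))
  obtain ⟨r, hrpos, hr⟩ : ∃ r > 0, ∀ s : ℂ, r < ‖s‖ → (∀ i j, ‖M.H s i j‖ ≤ M.kap) ∧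
      (∀ j, (M.DA j).eval (-s) ≠ 0) ∧ ∑ j, ‖M.v c s j‖ ≤ D :=
    ⟨max r₀ 1, by positivity, fun s hs => hr₀ s ((le_max_left _ _).trans_lt hs)⟩
  have hK : IsCompact {s : ℂ | 0 ≤ s.re ∧ ‖s‖ ≤ r} := by
    refine (isCompact_closedBall (0 : ℂ) r).of_isClosed_subset
      ((isClosed_le continuous_const Complex.continuous_re).inter
        (isClosed_le continuous_norm continuous_const)) fun s hs => by simpa using hs.2
  have hcs : ContinuousOn (fun s => ∑ j, ‖Ψ s j‖) {s : ℂ | 0 ≤ s.re ∧ ‖s‖ ≤ r} :=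
    continuousOn_finsetSum _ fun j _ => ((hc j).mono fun s hs => hs.1).norm
  obtain ⟨C₁, hC₁⟩ := hK.exists_bound_of_continuousOn hcs
  set E := (1 - M.kap * M.p₁)⁻¹ * D with hE
  have hq : 0 < 1 - M.ratio := sub_pos.2 M.ratio_lt_one
  set C := max C₁ (E / (1 - M.ratio)) with hCdef
  have hCE : M.ratio * C + E ≤ C := by
    have : E / (1 - M.ratio) ≤ C := le_max_right _ _
    rw [div_le_iff₀ hq] at this
    linarith
  have hcpt : ∀ s : ℂ, 0 ≤ s.re → ‖s‖ ≤ r → ∑ j, ‖Ψ s j‖ ≤ C := fun s hs hsr =>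
    ((le_abs_self _).trans (hC₁ s ⟨hs, hsr⟩)).trans (le_max_left _ _)
  have hstep : ∀ s : ℂ, (0 ≤ ((M.a : ℂ) * s).re → ∑ j, ‖Ψ (M.a * s) j‖ ≤ C) →
      0 ≤ s.re → ∑ j, ‖Ψ s j‖ ≤ C := by
    intro s ih hs
    rcases le_or_gt ‖s‖ r with hsr | hsr
    · exact hcpt s hs hsr
    · obtain ⟨h1, h2, h3⟩ := hr s hsr
      rw [h s (M.Om_of_norm_H_le ⟨hs, h2⟩ h1)]
      have h4 := M.sum_norm_R_mulVec_add_le h1 (Ψ (M.a * s)) (M.v c s)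
      have h5 := ih (by rw [re_mul_a]; exact mul_nonneg M.a_pos.le hs)
      have h6 : 0 ≤ (1 - M.kap * M.p₁)⁻¹ := inv_nonneg.2 (by linarith [M.kap_mul_p₁_lt])
      refine h4.trans (le_trans ?_ hCE)
      exact add_le_add (mul_le_mul_of_nonneg_left h5 M.ratio_nonneg)
        (mul_le_mul_of_nonneg_left h3 h6)
  refine ⟨C, fun s hs => ?_⟩
  exact M.orbit_induction hrpos (p := fun s => 0 ≤ s.re → ∑ j, ‖Ψ s j‖ ≤ C)
    (fun s hsr hs => hcpt s hs hsr.le) hstep s hs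

end ModelI

/-! ### Uniqueness of the invariant law -/

/-- The Jordan decomposition `α - β = p - n`, stated for positive measures. -/
theorem MeasureTheory.Measure.exists_add_eq_add_of_finite {X : Type*} [MeasurableSpace X]
    (α β : Measure X) [IsFiniteMeasure α] [IsFiniteMeasure β] :
    ∃ (p n : Measure X) (E : Set X), MeasurableSet E ∧ p ≤ α ∧ n ≤ β ∧ α + n = β + p ∧
      p Eᶜ = 0 ∧ n E = 0 := by
  obtain ⟨E, hE, h1, h2⟩ := hahn_decomposition α β
  have h3 : β.restrict E ≤ α.restrict E := Measure.le_iff.2 fun s hs => by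
    rw [Measure.restrict_apply hs, Measure.restrict_apply hs]
    exact h1 _ (hs.inter hE) Set.inter_subset_right
  have h4 : α.restrict Eᶜ ≤ β.restrict Eᶜ := Measure.le_iff.2 fun s hs => by
    rw [Measure.restrict_apply hs, Measure.restrict_apply hs]
    exact h2 _ (hs.inter hE.compl) Set.inter_subset_right
  have h5 := Measure.sub_add_cancel_of_le h3
  have h6 := Measure.sub_add_cancel_of_le h4
  have hle1 : α.restrict E - β.restrict E ≤ α.restrict E := Measure.sub_le
  have hle2 : β.restrict Eᶜ - α.restrict Eᶜ ≤ β.restrict Eᶜ := Measure.sub_le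
  refine ⟨α.restrict E - β.restrict E, β.restrict Eᶜ - α.restrict Eᶜ, E, hE,
    hle1.trans Measure.restrict_le_self, hle2.trans Measure.restrict_le_self, ?_, ?_, ?_⟩
  · have hα : α.restrict E - β.restrict E + β.restrict E + α.restrict Eᶜ = α := by
      rw [h5, Measure.restrict_add_restrict_compl hE]
    have hβ : β.restrict E + (β.restrict Eᶜ - α.restrict Eᶜ + α.restrict Eᶜ) = β := by
      rw [h6, Measure.restrict_add_restrict_compl hE]
    generalize α.restrict E - β.restrict E = p at hα ⊢
    generalize β.restrict Eᶜ - α.restrict Eᶜ = n at hβ ⊢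
    generalize α.restrict Eᶜ = γ at hα hβ
    generalize β.restrict E = δ at hα hβ
    rw [← hα, ← hβ]
    simp only [add_comm, add_left_comm]
  · refine le_antisymm ((hle1 _).trans (le_of_eq ?_)) bot_le
    rw [Measure.restrict_apply hE.compl]; simp
  · refine le_antisymm ((hle2 _).trans (le_of_eq ?_)) bot_le
    rw [Measure.restrict_apply hE]; simp

theorem MeasureTheory.Measure.eq_of_le_of_measureReal_univ_eq {X : Type*} [MeasurableSpace X]
    {α β : Measure X} [IsFiniteMeasure α] [IsFiniteMeasure β] (h : α ≤ β)
    (hm : α.real Set.univ = β.real Set.univ) : α = β :=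
  Measure.eq_of_le_of_measure_univ_eq h ((measureReal_eq_measureReal_iff).1 hm)

namespace ModelI

variable {N : ℕ} (M : ModelI N)

theorem step_add (κ : Measure ℝ) [IsFiniteMeasure κ] (α β : Fin N → Measure ℝ)
    [∀ i, IsFiniteMeasure (α i)] [∀ i, IsFiniteMeasure (β i)] (j : Fin N) :
    M.step κ (fun i => α i + β i) j = M.step κ α j + M.step κ β j := by
  have hmeas : Measurable fun w : ℝ × ℝ × ℝ × ℝ => w.1 * w.2.1 + (w.2.2.1 - w.2.2.2) := by fun_prop
  simp only [step, jointLaw, Measure.add_prod, Measure.prod_add, Measure.map_add _ _ hmeas, smul_add,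
    Finset.sum_add_distrib]

theorem stepMax_add (κ : Measure ℝ) [IsFiniteMeasure κ] (α β : Fin N → Measure ℝ)
    [∀ i, IsFiniteMeasure (α i)] [∀ i, IsFiniteMeasure (β i)] (j : Fin N) :
    M.stepMax κ (fun i => α i + β i) j = M.stepMax κ α j + M.stepMax κ β j := by
  rw [stepMax, step_add, Measure.map_add _ _ (by fun_prop), stepMax, stepMax]

theorem measureReal_stepMax (α : Fin N → Measure ℝ) [∀ i, IsFiniteMeasure (α i)] (j : Fin N) :
    (M.stepMax M.lawV α j).real Set.univ = ((fun i => (α i).real Set.univ) ᵥ* M.P) j := by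
  have h := M.measureReal_step M.lawV α j
  simp only [probReal_univ, one_mul] at h
  rw [stepMax, map_measureReal_apply (by fun_prop) MeasurableSet.univ, Set.preimage_univ, h]
  simp [Matrix.vecMul, dotProduct, mul_comm]

/-- A rectangle of positive mass that is mapped into `B` shows that `B` is charged. -/
theorem stepMax_ne_zero {κ : Measure ℝ} [IsFiniteMeasure κ] {α : Fin N → Measure ℝ}
    [∀ i, IsFiniteMeasure (α i)] {i j : Fin N} (hP : 0 < M.P i j) {B U Y : Set ℝ} {T : Set (ℝ × ℝ)}
    (hB : MeasurableSet B) (hU : κ U ≠ 0) (hY : α i Y ≠ 0)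
    (hT : ((M.lawS i).prod (M.lawA j)) T ≠ 0)
    (h : ∀ v ∈ U, ∀ x ∈ Y, ∀ z ∈ T, max (v * x + (z.1 - z.2)) 0 ∈ B) : M.stepMax κ α j B ≠ 0 := by
  have h1 : M.jointLaw κ (α i) i j (U ×ˢ Y ×ˢ T) ≠ 0 := by
    rw [jointLaw, Measure.prod_prod, Measure.prod_prod]
    exact mul_ne_zero hU (mul_ne_zero hY hT)
  have h2 : (M.jointLaw κ (α i) i j).map (fun w => w.1 * w.2.1 + (w.2.2.1 - w.2.2.2))
      ((fun x => max x 0) ⁻¹' B) ≠ 0 := by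
    rw [Measure.map_apply (by fun_prop) (hB.preimage (by fun_prop))]
    exact (pos_iff_ne_zero.1 ((pos_iff_ne_zero.2 h1).trans_le
      (measure_mono fun w hw => h _ hw.1 _ hw.2.1 _ hw.2.2)))
  rw [stepMax, Measure.map_apply (by fun_prop) hB, step, Measure.finsetSum_apply]
  refine fun h0 => ?_
  have h3 := (Finset.sum_eq_zero_iff.1 h0) i (Finset.mem_univ i)
  rw [Measure.smul_apply, smul_eq_mul, mul_eq_zero] at h3
  rcases h3 with h3 | h3
  · exact absurd (ENNReal.ofReal_eq_zero.1 h3) (not_le.2 hP)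
  · exact h2 h3

theorem exists_P_pos (i : Fin N) : ∃ j, 0 < M.P i j := by
  by_contra! h
  have := M.P_row i
  linarith [Finset.sum_nonpos fun j (_ : j ∈ Finset.univ) => h j]

/-- A law with rational transform charges every neighbourhood of `0`, for otherwise its transform would
decay exponentially. -/
theorem lawS_Iio_ne_zero (i : Fin N) {ε : ℝ} (hε : 0 < ε) : M.lawS i (Set.Iio ε) ≠ 0 := by
  intro h0
  have hb : ∀ r : ℝ, 0 ≤ r → ‖lst (M.lawS i) r‖ ≤ Real.exp (-ε * r) := by
    intro r hr
    have hae : ∀ᵐ x ∂M.lawS i, ε ≤ x := by rw [ae_iff]; simpa [Set.Iio] using h0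
    have := norm_integral_le_of_norm_le_const (μ := M.lawS i)
      (f := fun x : ℝ => Complex.exp (-(r : ℂ) * x)) (C := Real.exp (-ε * r)) (by
        filter_upwards [hae] with x hx
        rw [Complex.norm_exp, Real.exp_le_exp, neg_mul, ← Complex.ofReal_mul, Complex.neg_re,
          Complex.ofReal_re]
        nlinarith)
    simpa [lst] using this
  have hNB : M.NB i = 0 := by
    refine eq_zero_of_tendsto_zero ?_
    have hle : ∀ᶠ r : ℝ in atTop, ‖(M.NB i).eval (r : ℂ)‖
        ≤ ‖(M.DB i).eval (r : ℂ) / (r : ℂ) ^ M.m i‖ * (r ^ M.m i * Real.exp (-ε * r)) := by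
      filter_upwards [eventually_gt_atTop 0] with r hr
      have hd := M.DB_eval_ne_zero i (s := r) (by simpa using hr.le)
      have h1 := hb r hr.le
      rw [M.lst_lawS i (by simpa using hr.le), norm_div, div_le_iff₀ (norm_pos_iff.2 hd)] at h1
      refine h1.trans (le_of_eq ?_)
      rw [norm_div, norm_pow, Complex.norm_real, Real.norm_of_nonneg hr.le]
      field_simp
    have h2 := ((M.DB i).tendsto_eval_div_pow (M.DB_natDegree i).le).comp
      Complex.tendsto_ofReal_cobounded
    have h3 : Tendsto (fun r : ℝ => r ^ M.m i * Real.exp (-ε * r)) atTop (𝓝 0) := by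
      have := tendsto_rpow_mul_exp_neg_mul_atTop_nhds_zero (M.m i : ℝ) ε hε
      simpa using this
    have h4 := h2.norm.mul h3
    rw [mul_zero] at h4
    exact squeeze_zero' (Eventually.of_forall fun _ => norm_nonneg _) hle h4
  have h1 := M.lst_lawS i (s := 0) (by simp)
  rw [hNB, lst_zero_arg] at h1
  simp at h1

theorem exists_lawV_Iio_neg : ∃ η > 0, M.lawV (Set.Iio (-η)) ≠ 0 := by
  by_contra! h
  have hU : Set.Iio (0 : ℝ) = ⋃ n : ℕ, Set.Iio (-(1 / ((n : ℝ) + 1))) := by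
    ext x
    simp only [Set.mem_Iio, Set.mem_iUnion]
    refine ⟨fun hx => ?_, fun ⟨n, hn⟩ => hn.trans (neg_neg_of_pos (by positivity))⟩
    obtain ⟨n, hn⟩ := exists_nat_one_div_lt (neg_pos.2 hx)
    exact ⟨n, by linarith⟩
  have h0 : M.lawV (Set.Iio 0) = 0 := by
    rw [hU]; exact measure_iUnion_null fun n => h _ (by positivity)
  rw [M.lawV_Iio, ENNReal.ofReal_eq_zero] at h0
  exact absurd M.p₃_pos (not_lt.2 h0)

theorem exists_Ioi_ne_zero {α : Measure ℝ} (h : α (Set.Ioi 0) ≠ 0) :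
    ∃ δ > 0, α (Set.Ioi δ) ≠ 0 := by
  by_contra! h'
  have hU : Set.Ioi (0 : ℝ) = ⋃ n : ℕ, Set.Ioi (1 / ((n : ℝ) + 1)) := by
    ext x
    simp only [Set.mem_Ioi, Set.mem_iUnion]
    exact ⟨fun hx => exists_nat_one_div_lt hx, fun ⟨n, hn⟩ => lt_trans (by positivity) hn⟩
  exact h (by rw [hU]; exact measure_iUnion_null fun n => h' _ (by positivity))

theorem measure_Ici_ne_zero {α : Measure ℝ} (h0 : α (Set.Iio 0) = 0) (h : 0 < α.real Set.univ) :
    α (Set.Ici 0) ≠ 0 := by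
  intro h1
  have h2 : α Set.univ = 0 := by
    rw [← Set.Iio_union_Ici (a := (0 : ℝ))]; exact measure_union_null h0 h1
  rw [Measure.real, h2] at h
  simp at h

theorem lawS_prod_lawA_ne_zero (i j : Fin N) {ε : ℝ} (hε : 0 < ε) :
    ((M.lawS i).prod (M.lawA j)) (Set.Iio ε ×ˢ Set.Ici 0) ≠ 0 := by
  rw [Measure.prod_prod]
  exact mul_ne_zero (M.lawS_Iio_ne_zero i hε) (measure_Ici_ne_zero (M.lawA_nonneg j) (by simp))

/-- There is a state in which every nontrivial invariant family has an atom at `0`. If `S - A` is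
positive with positive probability, then a step with multiplier `1` leads into `(0, ∞)`, and a step
with a negative multiplier and a small `S` leads from there to `0`. Otherwise a negative multiplier
alone leads to `0`. -/
theorem exists_atom [Nonempty (Fin N)] : ∃ k, ∀ α : Fin N → Measure ℝ,
    (∀ i, IsFiniteMeasure (α i)) → (∀ i, α i (Set.Iio 0) = 0) → (∀ i, 0 < (α i).real Set.univ) →
    (∀ j, α j = M.stepMax M.lawV α j) → α k {0} ≠ 0 := by
  by_cases hcase : ∃ i j, 0 < M.P i j ∧ ((M.lawS i).prod (M.lawA j)) {z | z.2 < z.1} ≠ 0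
  · obtain ⟨i, j, hP, hSA⟩ := hcase
    obtain ⟨k, hk⟩ := M.exists_P_pos j
    refine ⟨k, fun α hfin hα hpos hinv => ?_⟩
    have h1 : α j (Set.Ioi 0) ≠ 0 := by
      rw [hinv j]
      refine M.stepMax_ne_zero hP measurableSet_Ioi (U := {1}) ?_
        (measure_Ici_ne_zero (hα i) (hpos i)) hSA ?_
      · rw [M.lawV_one]; simpa using M.p₁_pos
      · rintro v hv x hx z hz
        rw [Set.mem_singleton_iff.1 hv]
        have hz' : z.2 < z.1 := hz
        have hx' : 0 ≤ x := hx
        exact Set.mem_Ioi.2 (lt_max_of_lt_left (by linarith))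
    obtain ⟨δ, hδ, h2⟩ := exists_Ioi_ne_zero h1
    obtain ⟨η, hη, h3⟩ := M.exists_lawV_Iio_neg
    rw [hinv k]
    refine M.stepMax_ne_zero hk (measurableSet_singleton 0) h3 h2
      (M.lawS_prod_lawA_ne_zero j k (mul_pos hη hδ)) ?_
    rintro v hv x hx z ⟨hz1, hz2⟩
    simp only [Set.mem_Iio, Set.mem_Ioi, Set.mem_Ici] at hv hx hz1 hz2
    refine max_eq_right ?_
    nlinarith
  · push Not at hcase
    obtain ⟨i⟩ := ‹Nonempty (Fin N)›
    obtain ⟨k, hk⟩ := M.exists_P_pos i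
    refine ⟨k, fun α hfin hα hpos hinv => ?_⟩
    have hT : ((M.lawS i).prod (M.lawA k)) {z | z.1 ≤ z.2} ≠ 0 := by
      intro h0
      have h1 : ((M.lawS i).prod (M.lawA k)) Set.univ = 0 := by
        have : (Set.univ : Set (ℝ × ℝ)) = {z | z.1 ≤ z.2} ∪ {z | z.2 < z.1} := by
          ext z; simp [le_or_gt]
        rw [this]
        exact measure_union_null h0 (hcase i k hk)
      simp at h1
    rw [hinv k]
    refine M.stepMax_ne_zero hk (measurableSet_singleton 0) (U := Set.Iio 0) ?_
      (measure_Ici_ne_zero (hα i) (hpos i)) hT ?_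
    · rw [M.lawV_Iio]; simpa using M.p₃_pos
    · rintro v hv x hx z hz
      have hz' : z.1 ≤ z.2 := hz
      simp only [Set.mem_Iio, Set.mem_Ici] at hv hx
      refine max_eq_right ?_
      nlinarith

/-- The positive part of a solution of the difference equation is subinvariant, hence invariant, as
the step preserves total mass. -/
theorem eq_stepMax_of_singular {p n : Fin N → Measure ℝ} [∀ i, IsFiniteMeasure (p i)]
    [∀ i, IsFiniteMeasure (n i)] {E : Fin N → Set ℝ} (hE : ∀ j, MeasurableSet (E j))
    (hpE : ∀ j, p j (E j)ᶜ = 0) (hnE : ∀ j, n j (E j) = 0)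
    (h : ∀ j, p j + M.stepMax M.lawV n j = n j + M.stepMax M.lawV p j) (j : Fin N) :
    p j = M.stepMax M.lawV p j := by
  have hle : ∀ j, p j ≤ M.stepMax M.lawV p j := by
    intro j
    refine Measure.le_iff.2 fun B hB => ?_
    calc p j B ≤ p j (B ∩ E j) + p j (B \ E j) := by
          rw [measure_inter_add_sdiff B (hE j)]
      _ = p j (B ∩ E j) := by
          rw [measure_mono_null (s := B \ E j) (fun x hx => hx.2) (hpE j), add_zero]
      _ ≤ (p j + M.stepMax M.lawV n j) (B ∩ E j) := by
          rw [Measure.add_apply]; exact le_self_add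
      _ = M.stepMax M.lawV p j (B ∩ E j) := by
          rw [h, Measure.add_apply, measure_mono_null Set.inter_subset_right (hnE j), zero_add]
      _ ≤ M.stepMax M.lawV p j B := measure_mono Set.inter_subset_left
  have hmass := M.eq_vecMul_of_le (x := fun i => (p i).real Set.univ) fun j => by
    rw [← measureReal_stepMax]
    exact ENNReal.toReal_mono (measure_ne_top _ _) (hle j _)
  refine Measure.eq_of_le_of_measureReal_univ_eq (hle j) ?_
  rw [measureReal_stepMax, hmass]

/-- The reflected recursion determines an invariant signed family by its masses. The positive and the
negative part of a difference are both invariant and mutually singular in every state; if they did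
not vanish, both would have an atom at `0` in the state of `exists_atom`. -/
theorem eq_of_add_stepMax_eq {α β : Fin N → Measure ℝ} [∀ i, IsFiniteMeasure (α i)]
    [∀ i, IsFiniteMeasure (β i)] (hα : ∀ i, α i (Set.Iio 0) = 0) (hβ : ∀ i, β i (Set.Iio 0) = 0)
    (hmass : ∀ i, (α i).real Set.univ = (β i).real Set.univ)
    (h : ∀ j, α j + M.stepMax M.lawV β j = β j + M.stepMax M.lawV α j) : α = β := by
  choose p n E hE hpα hnβ hsum hpE hnE using fun j =>
    Measure.exists_add_eq_add_of_finite (α j) (β j)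
  have : ∀ i, IsFiniteMeasure (p i) := fun i => isFiniteMeasure_of_le _ (hpα i)
  have : ∀ i, IsFiniteMeasure (n i) := fun i => isFiniteMeasure_of_le _ (hnβ i)
  have hT : ∀ j, M.stepMax M.lawV α j + M.stepMax M.lawV n j
      = M.stepMax M.lawV β j + M.stepMax M.lawV p j := fun j => by
    rw [← stepMax_add, ← stepMax_add]; simp_rw [hsum]
  have hreal : ∀ (B : Set ℝ) {m₁ m₂ m₃ m₄ : Measure ℝ} [IsFiniteMeasure m₁] [IsFiniteMeasure m₂]
      [IsFiniteMeasure m₃] [IsFiniteMeasure m₄], m₁ + m₂ = m₃ + m₄ →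
      m₁.real B + m₂.real B = m₃.real B + m₄.real B := by
    intro B m₁ m₂ m₃ m₄ _ _ _ _ he
    rw [← measureReal_add_apply, ← measureReal_add_apply, he]
  have hpn : ∀ j, p j + M.stepMax M.lawV n j = n j + M.stepMax M.lawV p j := by
    intro j
    ext B hB
    have h1 := hreal B (h j)
    have h2 := hreal B (hsum j)
    have h3 := hreal B (hT j)
    refine (measureReal_eq_measureReal_iff).1 ?_
    rw [measureReal_add_apply, measureReal_add_apply]
    linarith
  have hp := M.eq_stepMax_of_singular hE hpE hnE hpn
  have hn := M.eq_stepMax_of_singular (E := fun j => (E j)ᶜ) (fun j => (hE j).compl)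
    (fun j => by simpa using hnE j) hpE fun j => (hpn j).symm
  have hpn_mass : ∀ j, (p j).real Set.univ = (n j).real Set.univ := fun j => by
    have h2 := hreal Set.univ (hsum j)
    linarith [hmass j]
  have hzero : ∀ j, (p j).real Set.univ = 0 := by
    by_contra! hne
    obtain ⟨i, hi⟩ := hne
    have hstat : (fun i => (p i).real Set.univ) ᵥ* M.P = fun i => (p i).real Set.univ := by
      funext j; rw [← measureReal_stepMax, ← hp j]
    have hpos : ∀ j, 0 < (p j).real Set.univ := M.pos_of_vecMul_eq
      (fun i => measureReal_nonneg) hstat (lt_of_le_of_ne measureReal_nonneg hi.symm)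
    have : Nonempty (Fin N) := ⟨i⟩
    obtain ⟨k, hk⟩ := M.exists_atom
    have hpk := hk p inferInstance (fun i => le_antisymm ((hpα i _).trans (hα i).le) bot_le) hpos hp
    have hnk := hk n inferInstance (fun i => le_antisymm ((hnβ i _).trans (hβ i).le) bot_le)
      (fun j => by rw [← hpn_mass]; exact hpos j) hn
    by_cases h0 : (0 : ℝ) ∈ E k
    · exact hnk (measure_mono_null (by simpa using h0) (hnE k))
    · exact hpk (measure_mono_null (by simpa using h0) (hpE k))
  funext j
  have h1 : p j = 0 := by
    have := hzero j
    rwa [measureReal_eq_zero_iff, Measure.measure_univ_eq_zero] at this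
  have h2 : n j = 0 := by
    have := hzero j
    rw [hpn_mass] at this
    rwa [measureReal_eq_zero_iff, Measure.measure_univ_eq_zero] at this
  simpa [h1, h2] using hsum j

end ModelI

/-! ### Bounded solutions as transforms of measures -/

namespace ModelI

variable {N : ℕ} (M : ModelI N)

theorem exists_quadLst_v (c : M.Coeffs) (j : Fin N) : ∃ q : Fin 4 → Measure ℝ,
    (∀ k, IsFiniteMeasure (q k)) ∧ ∀ s : ℂ, s.re = 0 → M.v c s j = quadLst q s := by
  obtain ⟨q, hq, h⟩ := exists_quadLst_of_rational
    (Finset.univ : Finset (Fin (M.l j) ⊕ Σ i, Fin (M.m i)))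
    (Sum.elim (fun r => -M.u j r) fun x => M.t x.1 x.2)
    (by
      rintro (r | x) -
      · simpa using (M.u_re j r).ne
      · simpa using (M.t_re x.1 x.2).ne)
    (C ((-1) ^ M.l j) * M.numPoly c j)
    ((natDegree_C_mul_le _ _).trans ((numPoly_natDegree_le c j).trans (by simp [deg])))
  refine ⟨q, hq, fun s hs => ?_⟩
  rw [← h s hs, v, den, DA_eval, Fintype.prod_sum_type, Fintype.prod_sigma, eval_mul, eval_C,
    numPoly_eval]
  simp only [Sum.elim_inl, Sum.elim_inr, DB_eval]
  -- The factors `-s - u` of the denominator have the wrong sign; hence the constant in front.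
  have h1 : ∏ r, (-s - M.u j r) = (-1) ^ M.l j * ∏ r, (s - -M.u j r) := by
    have : (-1 : ℂ) ^ M.l j = ∏ _r : Fin (M.l j), (-1 : ℂ) := by simp
    rw [this, ← Finset.prod_mul_distrib]
    exact Finset.prod_congr rfl fun r _ => by ring
  have h2 : ((-1 : ℂ) ^ M.l j)⁻¹ = (-1) ^ M.l j := by rw [← inv_pow]; norm_num
  rw [h1, mul_assoc, ← div_div, div_eq_mul_inv (M.num c j s), h2, mul_comm (M.num c j s)]

/-- The iterates of the free step with positive multipliers, applied to the family `q`. -/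
def posIter (q : Fin N → Measure ℝ) : ℕ → Fin N → Measure ℝ
  | 0 => q
  | n + 1 => M.step M.posV (posIter q n)

/-- The potential of the family `q` under the free step with positive multipliers. It is finite, since
these have total mass `p₁ + p₂ < 1`. -/
def posSum (q : Fin N → Measure ℝ) (j : Fin N) : Measure ℝ :=
  Measure.sum fun n => M.posIter q n j

section

variable (q : Fin N → Measure ℝ) [hq : ∀ i, IsFiniteMeasure (q i)]

instance (n : ℕ) (i : Fin N) : IsFiniteMeasure (M.posIter q n i) := by
  induction n generalizing i with
  | zero => exact hq i
  | succ n ih => unfold posIter; infer_instance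

theorem measureReal_posV : M.posV.real Set.univ = M.p₁ + M.p₂ := by
  rw [measureReal_def]
  simp [posV, ENNReal.toReal_add, ENNReal.toReal_ofReal M.p₁_pos.le,
    ENNReal.toReal_ofReal M.p₂_pos.le]

theorem sum_measureReal_posIter (n : ℕ) : ∑ j, (M.posIter q n j).real Set.univ
    = (M.p₁ + M.p₂) ^ n * ∑ j, (q j).real Set.univ := by
  induction n with
  | zero => simp [posIter]
  | succ n ih =>
    simp_rw [posIter, measureReal_step, measureReal_posV, ← Finset.mul_sum]
    rw [Finset.sum_comm, pow_succ', mul_assoc, ← ih]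
    simp_rw [← Finset.sum_mul, M.P_row, one_mul]

theorem measureReal_posIter_le (n : ℕ) (j : Fin N) : (M.posIter q n j).real Set.univ
    ≤ (M.p₁ + M.p₂) ^ n * ∑ j, (q j).real Set.univ := by
  rw [← sum_measureReal_posIter]
  exact Finset.single_le_sum (f := fun j => (M.posIter q n j).real Set.univ)
    (fun _ _ => measureReal_nonneg) (Finset.mem_univ j)

theorem summable_posIter_bound (D : ℝ) : Summable fun n => (M.p₁ + M.p₂) ^ n * D :=
  (summable_geometric_of_lt_one (add_pos M.p₁_pos M.p₂_pos).le M.p_lt).mul_right _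

instance (j : Fin N) : IsFiniteMeasure (M.posSum q j) := by
  refine ⟨?_⟩
  rw [posSum, Measure.sum_apply _ MeasurableSet.univ]
  have h1 : ∀ n, M.posIter q n j Set.univ
      = ENNReal.ofReal ((M.posIter q n j).real Set.univ) := fun n => by simp
  simp_rw [h1]
  rw [← ENNReal.ofReal_tsum_of_nonneg (fun _ => measureReal_nonneg)]
  · exact ENNReal.ofReal_lt_top
  · exact Summable.of_nonneg_of_le (fun _ => measureReal_nonneg)
      (fun n => M.measureReal_posIter_le q n j) (M.summable_posIter_bound _)

theorem hasSum_lst_posIter (j : Fin N) {s : ℂ} (hs : s.re = 0) :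
    HasSum (fun n => lst (M.posIter q n j) s) (lst (M.posSum q j) s) :=
  have : IsFiniteMeasure (Measure.sum fun n => M.posIter q n j) :=
    inferInstanceAs (IsFiniteMeasure (M.posSum q j))
  hasSum_integral_measure (integrable_exp_neg_mul (ae_re_mul_nonneg_of_re_eq_zero _ hs))

/-- The potential solves the functional equation on the imaginary axis. -/
theorem lst_posSum (j : Fin N) {s : ℂ} (hs : s.re = 0) :
    lst (M.posSum q j) s = ∑ i, (M.P i j : ℂ) * M.H s i j *
      (M.p₁ * lst (M.posSum q i) s + M.p₂ * lst (M.posSum q i) (M.a * s)) + lst (q j) s := by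
  have h1 := (hasSum_nat_add_iff' 1).2 (M.hasSum_lst_posIter q j hs)
  have has : ((M.a : ℂ) * s).re = 0 := by rw [re_mul_a, hs, mul_zero]
  have h2 : ∀ n, lst (M.posIter q (n + 1) j) s = ∑ i, (M.P i j : ℂ) * M.H s i j *
      (M.p₁ * lst (M.posIter q n i) s + M.p₂ * lst (M.posIter q n i) (M.a * s)) := fun n => by
    rw [posIter, M.lst_step _ _ _ hs]
    simp_rw [integral_posV]
    simp [mul_comm s]
  have h3 := hasSum_sum (s := Finset.univ) fun i _ =>
    (((M.hasSum_lst_posIter q i hs).mul_left (M.p₁ : ℂ)).add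
      ((M.hasSum_lst_posIter q i has).mul_left (M.p₂ : ℂ))).mul_left ((M.P i j : ℂ) * M.H s i j)
  simp_rw [h2] at h1
  have h4 := h1.unique h3
  simp only [Finset.sum_range_one, posIter] at h4
  rw [← h4]; ring

end

variable {M}

theorem eq_zero_of_contraction {d : ℂ → Fin N → ℂ} {D : ℝ}
    (hD : ∀ s : ℂ, s.re = 0 → ∑ j, ‖d s j‖ ≤ D)
    (h : ∀ s : ℂ, s.re = 0 → ∑ j, ‖d s j‖ ≤ M.ratio * ∑ j, ‖d (M.a * s) j‖) {s : ℂ}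
    (hs : s.re = 0) : d s = 0 := by
  have key : ∀ k : ℕ, ∀ s : ℂ, s.re = 0 → ∑ j, ‖d s j‖ ≤ M.ratio ^ k * D := by
    intro k
    induction k with
    | zero => simpa using hD
    | succ k ih =>
      intro s hs
      rw [pow_succ', mul_assoc]
      exact (h s hs).trans (mul_le_mul_of_nonneg_left (ih _ (by rw [re_mul_a, hs, mul_zero]))
        M.ratio_nonneg)
  have hlim := (tendsto_pow_atTop_nhds_zero_of_lt_one M.ratio_nonneg M.ratio_lt_one).mul_const D
  rw [zero_mul] at hlim
  have h0 := ge_of_tendsto hlim (Eventually.of_forall fun k => key k s hs)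
  have h1 := (Finset.sum_eq_zero_iff_of_nonneg fun _ _ => norm_nonneg _).1
    (le_antisymm h0 (Finset.sum_nonneg fun _ _ => norm_nonneg _))
  funext j
  exact norm_eq_zero.1 (h1 j (Finset.mem_univ j))

theorem norm_H_le_kap {s : ℂ} (hs : s.re = 0) (i j : Fin N) : ‖M.H s i j‖ ≤ M.kap :=
  (M.norm_H_le_one hs i j).trans M.one_lt_kap.le

/-- A solution of the functional equation that is bounded on the imaginary axis is, on this axis, the
transform of a complex measure, namely of the potential of the inhomogeneity. -/
theorem exists_quadLst_of_recursion {c : M.Coeffs} {Ψ : ℂ → Fin N → ℂ} {C : ℝ}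
    (hC : ∀ s : ℂ, s.re = 0 → ∑ j, ‖Ψ s j‖ ≤ C)
    (h : ∀ s ∈ M.Om, Ψ s = M.R s *ᵥ Ψ (M.a * s) + M.Vt c s) :
    ∃ α : Fin N → Fin 4 → Measure ℝ, (∀ j k, IsFiniteMeasure (α j k)) ∧
      ∀ s : ℂ, s.re = 0 → ∀ j, Ψ s j = quadLst (α j) s := by
  choose q hq hv using M.exists_quadLst_v c
  set α : Fin N → Fin 4 → Measure ℝ := fun j k => M.posSum (fun i => q i k) j with hα
  have hfin : ∀ j k, IsFiniteMeasure (α j k) := fun j k => by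
    have : ∀ i, IsFiniteMeasure (q i k) := fun i => hq i k
    rw [hα]; infer_instance
  refine ⟨α, hfin, fun s hs j => ?_⟩
  have hy : ∀ s : ℂ, s.re = 0 → (fun j => quadLst (α j) s)
      = M.R s *ᵥ (fun j => quadLst (α j) (M.a * s)) + M.Vt c s := by
    intro s hs
    refine (M.eq_R_mulVec_add_iff (M.Om_of_re_eq_zero hs).2).2 ?_
    funext j
    simp only [Pi.add_apply, Pi.smul_apply, smul_eq_mul, Matrix.mulVec, dotProduct, F_apply]
    rw [hv j s hs]
    have hq' : ∀ k i, IsFiniteMeasure (q i k) := fun k i => hq i k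
    have h1 : ∀ k, lst (α j k) s = _ := fun k => M.lst_posSum (fun i => q i k) j hs
    simp only [quadLst, h1, mul_add, Finset.sum_add_distrib, Finset.mul_sum]
    congr 1
    congr 1
    · rw [Finset.sum_comm]
      exact Finset.sum_congr rfl fun i _ => Finset.sum_congr rfl fun k _ => by ring
    · rw [Finset.sum_comm]
      exact Finset.sum_congr rfl fun i _ => Finset.sum_congr rfl fun k _ => by ring
  have hz := eq_zero_of_contraction (M := M) (d := fun s j => Ψ s j - quadLst (α j) s)
    (D := C + ∑ j, ∑ k, (α j k).real Set.univ) (fun s hs => ?_) (fun s hs => ?_) hs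
  · exact sub_eq_zero.1 (congrFun hz j)
  · calc ∑ j, ‖Ψ s j - quadLst (α j) s‖ ≤ ∑ j, (‖Ψ s j‖ + ∑ k, (α j k).real Set.univ) :=
        Finset.sum_le_sum fun j _ => (norm_sub_le _ _).trans (by
          gcongr; exact norm_quadLst_le fun k => ae_re_mul_nonneg_of_re_eq_zero _ hs)
      _ ≤ _ := by rw [Finset.sum_add_distrib]; gcongr; exact hC s hs
  · have h1 : (fun j => Ψ s j - quadLst (α j) s)
        = M.R s *ᵥ (fun j => Ψ (M.a * s) j - quadLst (α j) (M.a * s)) := by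
      have h2 : (fun j => Ψ s j - quadLst (α j) s) = Ψ s - fun j => quadLst (α j) s := rfl
      have h3 : (fun j => Ψ (M.a * s) j - quadLst (α j) (M.a * s))
        = Ψ (M.a * s) - fun j => quadLst (α j) (M.a * s) := rfl
      rw [h2, h3, hy s hs, h s (M.Om_of_re_eq_zero hs), Matrix.mulVec_sub]
      abel
    have h4 := M.sum_norm_R_mulVec_le (norm_H_le_kap hs)
      (fun j => Ψ (M.a * s) j - quadLst (α j) (M.a * s))
    rw [← h1] at h4
    exact h4

theorem restrict_Iio_compl_null (m : Measure ℝ) : m.restrict (Set.Iio 0)ᶜ (Set.Iio 0) = 0 := by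
  rw [Measure.restrict_apply measurableSet_Iio, Set.inter_compl_self, measure_empty]

/-- A bounded solution that is holomorphic in the right half-plane is the transform of a complex
measure on `[0, ∞)`. -/
theorem exists_quadLst_nonneg {c : M.Coeffs} {Ψ : ℂ → Fin N → ℂ} {C : ℝ}
    (hcont : ∀ i, ContinuousOn (fun s => Ψ s i) {s | 0 ≤ s.re})
    (hdiff : ∀ i, DifferentiableOn ℂ (fun s => Ψ s i) {s | 0 < s.re})
    (hC : ∀ s : ℂ, 0 ≤ s.re → ∑ j, ‖Ψ s j‖ ≤ C)
    (h : ∀ s ∈ M.Om, Ψ s = M.R s *ᵥ Ψ (M.a * s) + M.Vt c s) :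
    ∃ β : Fin N → Fin 4 → Measure ℝ, (∀ j k, IsFiniteMeasure (β j k)) ∧
      (∀ j k, β j k (Set.Iio 0) = 0) ∧ ∀ s : ℂ, 0 ≤ s.re → ∀ j, Ψ s j = quadLst (β j) s := by
  obtain ⟨α, hα, hΨ⟩ := exists_quadLst_of_recursion (fun s hs => hC s hs.ge) h
  have hC' : ∀ j, ∀ s : ℂ, 0 ≤ s.re → ‖Ψ s j‖ ≤ C := fun j s hs =>
    (Finset.single_le_sum (f := fun j => ‖Ψ s j‖) (fun _ _ => norm_nonneg _)
      (Finset.mem_univ j)).trans (hC s hs)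
  set β : Fin N → Fin 4 → Measure ℝ := fun j k => (α j k).restrict (Set.Iio 0)ᶜ with hβdef
  have hβ : ∀ j k, IsFiniteMeasure (β j k) := fun j k => by rw [hβdef]; infer_instance
  have hβ0 : ∀ j k, β j k (Set.Iio 0) = 0 := fun j k => restrict_Iio_compl_null _
  refine ⟨β, hβ, hβ0, fun s hs j => ?_⟩
  obtain ⟨h1, h2⟩ := restrict_Iio_eq_of_quadLst_eq (q := α j) (hcont j) (hdiff j) (hC' j)
    fun s hs => (hΨ s hs j).symm
  refine eqOn_rightHalfPlane (M := max C (∑ k, (β j k).real Set.univ)) (hcont j) (hdiff j)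
    (continuousOn_quadLst (hβ0 j)) (differentiableOn_quadLst (hβ0 j))
    (fun s hs => (hC' j s hs).trans (le_max_left _ _))
    (fun s hs => (norm_quadLst_le fun k => ae_re_mul_nonneg (hβ0 j k) hs).trans (le_max_right _ _))
    (fun s hs => ?_) s hs
  have h3 : quadLst (fun k => (α j k).restrict (Set.Iio 0)) s = 0 := by
    rw [quadLst_eq, h1, h2]; ring
  rw [hΨ s hs j, quadLst_eq_restrict_add _ hs measurableSet_Iio, h3, zero_add]

variable (M)

theorem rootMultiplicity_denPoly
    (hinj : Function.Injective fun q : Σ i, Fin (M.m i) => M.t q.1 q.2) (j : Fin N) {z : ℂ}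
    (hz : z.re ≤ 0) (h0 : M.den j z = 0) :
    (∃ i k, z = M.t i k) ∧ (M.denPoly j).rootMultiplicity z = 1 := by
  have hDA : ¬ ((M.DA j).comp (-X)).IsRoot z := by
    simpa [IsRoot, eval_comp] using M.DA_eval_neg_ne_zero j hz
  have hprod : ∏ k, M.DB k
      = (((Finset.univ : Finset (Σ i, Fin (M.m i))).val.map fun q => M.t q.1 q.2).map
          fun a => X - C a).prod := by
    rw [Multiset.map_map]
    change _ = ∏ q : Σ i, Fin (M.m i), (X - C (M.t q.1 q.2))
    rw [Fintype.prod_sigma]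
    rfl
  have hroots : (∏ k, M.DB k).roots
      = (Finset.univ : Finset (Σ i, Fin (M.m i))).val.map fun q => M.t q.1 q.2 := by
    rw [hprod, roots_multiset_prod_X_sub_C]
  have hne : (∏ k, M.DB k) ≠ 0 := Finset.prod_ne_zero_iff.2 fun k _ => (M.DB_monic k).ne_zero
  have hmem : z ∈ (∏ k, M.DB k).roots := by
    rw [mem_roots hne, IsRoot, eval_prod]
    exact (mul_eq_zero.1 h0).resolve_left (M.DA_eval_neg_ne_zero j hz)
  have hcount : (∏ k, M.DB k).rootMultiplicity z = 1 := by
    rw [← count_roots]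
    refine Multiset.count_eq_one_of_mem ?_ hmem
    rw [hroots]
    exact (Multiset.nodup_map_iff_of_injective hinj).2 Finset.univ.nodup
  refine ⟨?_, ?_⟩
  · rw [hroots] at hmem
    obtain ⟨q, -, hq⟩ := Multiset.mem_map.1 hmem
    exact ⟨q.1, q.2, hq.symm⟩
  · rw [denPoly, rootMultiplicity_mul (M.denPoly_ne_zero j), hcount,
      rootMultiplicity_eq_zero hDA]

variable {M}

/-- A function on the left half-plane that vanishes at the (simple) poles `t i k` may be divided by
`den j`. -/
theorem exists_bounded_quotient
    (hinj : Function.Injective fun q : Σ i, Fin (M.m i) => M.t q.1 q.2) (j : Fin N) {h : ℂ → ℂ}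
    (hc : ContinuousOn h {s | s.re ≤ 0}) (hd : DifferentiableOn ℂ h {s | s.re < 0})
    (h0 : ∀ i k, h (M.t i k) = 0) {r B : ℝ}
    (hB : ∀ s : ℂ, s.re ≤ 0 → r < ‖s‖ → M.den j s ≠ 0 ∧ ‖h s / M.den j s‖ ≤ B) :
    ∃ (g : ℂ → ℂ) (C : ℝ), ContinuousOn g {s | s.re ≤ 0} ∧ DifferentiableOn ℂ g {s | s.re < 0} ∧
      (∀ s : ℂ, s.re ≤ 0 → ‖g s‖ ≤ C) ∧ ∀ s : ℂ, s.re = 0 → g s = h s / M.den j s := by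
  set g : ℂ → ℂ := fun z => if (M.denPoly j).eval z = 0
    then deriv h z / (M.denPoly j).derivative.eval z else h z / (M.denPoly j).eval z with hg
  have hopen : IsOpen {s : ℂ | s.re < 0} := isOpen_lt Complex.continuous_re continuous_const
  have hgd : DifferentiableOn ℂ g {s | s.re < 0} := by
    refine Complex.exists_differentiableOn_div hopen (M.denPoly_ne_zero j) hd fun z hz hz0 => ?_
    rw [denPoly_eval] at hz0
    obtain ⟨⟨i, k, rfl⟩, hm⟩ := M.rootMultiplicity_denPoly hinj j (le_of_lt hz) hz0
    exact ⟨hm, h0 i k⟩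
  have hax : ∀ s : ℂ, s.re = 0 → (M.denPoly j).eval s ≠ 0 := fun s hs => by
    rw [denPoly_eval]; exact M.den_ne_zero (M.regular_of_re_eq_zero hs) j
  have hgc : ContinuousOn g {s | s.re ≤ 0} := by
    intro s hs
    rcases (show s.re ≤ 0 from hs).lt_or_eq with hlt | heq
    · exact (hgd.differentiableAt (hopen.mem_nhds hlt)).continuousAt.continuousWithinAt
    · have hne := hax s heq
      refine ((hc s hs).div (M.denPoly j).continuous.continuousWithinAt
        hne).congr_of_eventuallyEq ?_ (by rw [hg]; simp [hne])
      filter_upwards [nhdsWithin_le_nhds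
        ((M.denPoly j).continuous.continuousAt.eventually_ne hne)] with w hw
      simp [hg, hw]
  have hcomp : IsCompact {s : ℂ | s.re ≤ 0 ∧ ‖s‖ ≤ r} :=
    (isCompact_closedBall (0 : ℂ) r).of_isClosed_subset
      ((isClosed_le Complex.continuous_re continuous_const).inter
        (isClosed_le continuous_norm continuous_const)) fun s hs => by simpa using hs.2
  obtain ⟨C, hC⟩ := hcomp.exists_bound_of_continuousOn (hgc.mono fun s hs => hs.1)
  refine ⟨g, max B C, hgc, hgd, fun s hs => ?_, fun s hs => ?_⟩
  · rcases le_or_gt ‖s‖ r with hr | hr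
    · exact (hC s ⟨hs, hr⟩).trans (le_max_right _ _)
    · obtain ⟨h1, h2⟩ := hB s hs hr
      refine le_trans (le_of_eq ?_) (h2.trans (le_max_left _ _))
      simp [hg, denPoly_eval, h1]
  · have := hax s hs
    rw [hg]; simp only [if_neg this]; rw [denPoly_eval]

end ModelI

/-! ### The homogeneous system -/

namespace ModelI

variable {N : ℕ} {M : ModelI N}

theorem eq_zero_of_num_eq_zero {e : M.Coeffs}
    (h : ∀ s : ℂ, s.re = 0 → ∀ j, M.num e j s = 0) : e = 0 := by
  funext j w
  have h1 : M.numPoly e j = 0 := by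
    refine eq_zero_of_infinite_isRoot _ (Set.Infinite.mono (s := Set.range fun x : ℝ =>
      (x : ℂ) * Complex.I) ?_ (Set.infinite_range_of_injective fun x y hxy => ?_))
    · rintro _ ⟨x, rfl⟩
      change (M.numPoly e j).eval _ = 0
      rw [numPoly_eval]; exact h _ (by simp) j
    · simpa using hxy
  have h2 := congrArg (fun p : ℂ[X] => p.coeff w) h1
  simpa [numPoly, finsetSum_coeff, coeff_C_mul, coeff_X_pow, Fin.val_inj] using h2

theorem apply_zero_eq_zero {e : M.Coeffs} {Ψ : ℂ → Fin N → ℂ} (he : ∀ j, e j 0 = 0)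
    (h : ∀ s ∈ M.Om, Ψ s = M.R s *ᵥ Ψ (M.a * s) + M.Vt e s) : Ψ 0 = 0 := by
  have hv : M.v e 0 = 0 := by
    funext j; rw [v, num_zero, he]; simp
  have h1 := h 0 (M.Om_of_re_eq_zero (by simp))
  rw [mul_zero, Vt, hv, Matrix.mulVec_zero, add_zero] at h1
  have h2 := M.sum_norm_R_mulVec_le (s := 0) (norm_H_le_kap (by simp)) (Ψ 0)
  rw [← h1] at h2
  have h3 : ∑ j, ‖Ψ 0 j‖ = 0 := by
    have h4 : 0 ≤ ∑ j, ‖Ψ 0 j‖ := Finset.sum_nonneg fun _ _ => norm_nonneg _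
    nlinarith [M.ratio_lt_one]
  funext j
  exact norm_eq_zero.1 ((Finset.sum_eq_zero_iff_of_nonneg fun _ _ => norm_nonneg _).1 h3 j
    (Finset.mem_univ j))

theorem quadLst_mulLaw {β : Fin 4 → Measure ℝ} [∀ k, IsFiniteMeasure (β k)]
    (h0 : ∀ k, β k (Set.Iio 0) = 0) {s : ℂ} (hs : s.re ≤ 0) :
    quadLst (fun k => mulLaw M.negV (β k)) s = ∫ y : ℝ, quadLst β (s * y) ∂M.negV := by
  have hre : ∀ y : ℝ, y < 0 → 0 ≤ (s * (y : ℂ)).re := fun y hy => by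
    simpa using mul_nonneg_of_nonpos_of_nonpos hs hy.le
  have hint : ∀ k, Integrable (fun y : ℝ => quadCoeff k * lst (β k) (s * y)) M.negV := by
    intro k
    refine Integrable.const_mul (Integrable.of_bound (C := (β k).real Set.univ) ?_ ?_) _
    · refine ContinuousOn.aestronglyMeasurable ?_ measurableSet_Iio
      exact (continuousOn_lst (h0 k)).comp (by fun_prop) fun y hy => hre y hy
    · filter_upwards [M.ae_negV] with y hy
      exact norm_lst_le (ae_re_mul_nonneg (h0 k) (hre y hy))
  simp only [quadLst]
  rw [integral_finsetSum _ fun k _ => hint k]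
  refine Finset.sum_congr rfl fun k _ => ?_
  rw [integral_const_mul, lst_mulLaw]
  filter_upwards [M.ae_negV] with y hy
  filter_upwards [ae_nonneg_of_Iio (h0 k)] with x hx
  exact mul_nonneg_of_nonpos_of_nonpos hs (mul_nonpos_of_nonpos_of_nonneg hy.le hx)

theorem stepMax_restrict_Ioi (κ : Measure ℝ) (α : Fin N → Measure ℝ) (j : Fin N) :
    (M.stepMax κ α j).restrict (Set.Ioi 0) = (M.step κ α j).restrict (Set.Ioi 0) := by
  ext B hB
  rw [Measure.restrict_apply hB, Measure.restrict_apply hB, stepMax,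
    Measure.map_apply (by fun_prop) (hB.inter measurableSet_Ioi)]
  congr 1
  ext x
  rcases le_or_gt x 0 with h | h
  · simp [h, h.not_gt]
  · simp [h, h.le]

theorem _root_.MeasureTheory.Measure.eq_of_restrict_Ioi_eq {m n : Measure ℝ} [IsFiniteMeasure m]
    [IsFiniteMeasure n] (hm : m (Set.Iio 0) = 0) (hn : n (Set.Iio 0) = 0)
    (h : m.restrict (Set.Ioi 0) = n.restrict (Set.Ioi 0))
    (hmass : m.real Set.univ = n.real Set.univ) : m = n := by
  have hres : ∀ l : Measure ℝ, l (Set.Iio 0) = 0 →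
      l = l.restrict (Set.Ioi 0) + l {0} • Measure.dirac 0 := by
    intro l hl
    rw [← Measure.restrict_singleton, add_comm, ← Measure.restrict_union _ measurableSet_Ioi]
    · refine (Measure.restrict_eq_self_of_ae_mem ?_).symm
      filter_upwards [ae_nonneg_of_Iio hl] with x hx
      rcases hx.eq_or_lt with h | h
      · exact Or.inl h.symm
      · exact Or.inr h
    · simp
  have hatom : ∀ l : Measure ℝ, IsFiniteMeasure l → l (Set.Iio 0) = 0 →
      l.real {0} = l.real Set.univ - (l.restrict (Set.Ioi 0)).real Set.univ := by
    intro l _ hl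
    have := congrArg (fun m : Measure ℝ => m Set.univ) (hres l hl)
    simp only [Measure.add_apply, Measure.smul_apply, measure_univ, smul_eq_mul, mul_one] at this
    have h2 := congrArg ENNReal.toReal this
    rw [ENNReal.toReal_add (measure_ne_top _ _) (measure_ne_top _ _)] at h2
    simp only [measureReal_def]
    linarith
  have h0 : m {0} = n {0} := by
    refine (measureReal_eq_measureReal_iff).1 ?_
    rw [hatom m inferInstance hm, hatom n inferInstance hn, h, hmass]
  rw [hres m hm, hres n hn, h, h0]

theorem mass_eq_of_quadLst_zero {β : Fin 4 → Measure ℝ} (h : quadLst β 0 = 0) :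
    (β 0).real Set.univ = (β 1).real Set.univ ∧ (β 2).real Set.univ = (β 3).real Set.univ := by
  rw [quadLst_eq] at h
  simp only [lst_zero_arg] at h
  have h1 := congrArg Complex.re h
  have h2 := congrArg Complex.im h
  simp at h1 h2
  exact ⟨by linarith, by linarith⟩

/-- The homogeneous system has only the zero solution. The solution `Ψ` is the transform of a complex
measure on `[0, ∞)` in every state, given by quadruples `β j`. The equations at the poles make
the difference between its image under the free step and itself have a transform that is bounded and
holomorphic in the left half-plane, so they agree on `(0, ∞)`. As `Ψ 0 = 0`, the total masses vanish;
hence the measure is invariant under the reflected step, and it vanishes by `eq_of_add_stepMax_eq`. -/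
theorem coeffs_eq_zero_of_homogeneous
    (hinj : Function.Injective fun q : Σ i, Fin (M.m i) => M.t q.1 q.2)
    {e : M.Coeffs} {Ψ : ℂ → Fin N → ℂ} {C : ℝ}
    (hcont : ∀ i, ContinuousOn (fun s => Ψ s i) {s | 0 ≤ s.re})
    (hdiff : ∀ i, DifferentiableOn ℂ (fun s => Ψ s i) {s | 0 < s.re})
    (hC : ∀ s : ℂ, 0 ≤ s.re → ∑ j, ‖Ψ s j‖ ≤ C)
    (h : ∀ s ∈ M.Om, Ψ s = M.R s *ᵥ Ψ (M.a * s) + M.Vt e s)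
    (he : ∀ j, e j 0 = 0)
    (hleft : ∀ i k j, ∑ i', M.G (M.t i k) j i' * ∫ y : ℝ, Ψ (M.t i k * (y : ℂ)) i' ∂M.negV
      = M.num e j (M.t i k)) : e = 0 := by
  obtain ⟨β, hβ, hβ0, hΨ⟩ := exists_quadLst_nonneg hcont hdiff hC h
  have hmass : ∀ j, (β j 0).real Set.univ = (β j 1).real Set.univ ∧
      (β j 2).real Set.univ = (β j 3).real Set.univ := fun j =>
    mass_eq_of_quadLst_zero (by
      rw [← hΨ 0 (by simp) j, apply_zero_eq_zero he h, Pi.zero_apply])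
  set γ : Fin N → Fin 4 → Measure ℝ := fun i k => mulLaw M.negV (β i k) with hlam
  have hγ0 : ∀ i k, γ i k (Set.Ioi 0) = 0 := fun i k => mulLaw_Ioi M.negV_Ici (hβ0 i k)
  have hγb : ∀ i, ∀ s : ℂ, s.re ≤ 0 → ‖quadLst (γ i) s‖ ≤ ∑ k, (γ i k).real Set.univ :=
    fun i s hs => norm_quadLst_le fun k => ae_re_mul_nonneg_left (hγ0 i k) hs
  obtain ⟨D, hD, hv⟩ := exists_eventually_v_le e
  obtain ⟨r, hr⟩ := exists_bound_of_eventually_cobounded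
    (M.eventually_H_le.and (M.eventually_DA_ne_zero.and (M.eventually_DB_ne_zero.and hv)))
  have hstep : ∀ j,
      (M.step M.lawV (fun i => β i 0) j + β j 1).restrict (Set.Ioi 0)
        = (M.step M.lawV (fun i => β i 1) j + β j 0).restrict (Set.Ioi 0) ∧
      (M.step M.lawV (fun i => β i 2) j + β j 3).restrict (Set.Ioi 0)
        = (M.step M.lawV (fun i => β i 3) j + β j 2).restrict (Set.Ioi 0) := by
    intro j
    set hj : ℂ → ℂ := fun s => ∑ i, M.G s j i * quadLst (γ i) s - M.num e j s with hhj
    have hquot : ∀ s : ℂ, (∀ i, (M.DB i).eval s ≠ 0) → (∀ j, (M.DA j).eval (-s) ≠ 0) →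
        M.den j s ≠ 0 ∧ hj s / M.den j s = ∑ i, M.F s j i * quadLst (γ i) s - M.v e s j := by
      intro s hB hA
      have hden : M.den j s ≠ 0 :=
        mul_ne_zero (hA j) (Finset.prod_ne_zero_iff.2 fun k _ => hB k)
      refine ⟨hden, ?_⟩
      rw [hhj, sub_div, Finset.sum_div, v]
      congr 1
      refine Finset.sum_congr rfl fun i _ => ?_
      rw [M.G_eq_den_mul_F hB hA]
      field_simp
    -- By the equations at the poles, `hj` vanishes there, so `hj / den j` extends to the left.
    obtain ⟨g, B, hgc, hgd, hgB, hg⟩ := exists_bounded_quotient hinj j (h := hj)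
      (r := r) (B := ∑ i, M.kap * (∑ k, (γ i k).real Set.univ) + D)
      ((continuousOn_finsetSum _ fun i _ => (differentiable_G j i).continuous.continuousOn.mul
        (continuousOn_quadLst_left (hγ0 i))).sub (differentiable_num e j).continuous.continuousOn)
      ((DifferentiableOn.fun_sum fun i _ => (differentiable_G j i).differentiableOn.mul
        (differentiableOn_quadLst_left (hγ0 i))).sub (differentiable_num e j).differentiableOn)
      (fun i k => by
        rw [hhj, sub_eq_zero, ← hleft i k j]
        refine Finset.sum_congr rfl fun i' _ => ?_
        congr 1
        rw [hlam, quadLst_mulLaw (hβ0 i') (M.t_re i k).le]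
        refine integral_congr_ae ?_
        filter_upwards [M.ae_negV] with y hy
        rw [hΨ _ _ i']
        simpa using mul_nonneg_of_nonpos_of_nonpos (M.t_re i k).le hy.le)
      (fun s hs hsr => by
        obtain ⟨hH, hA, hB, hv⟩ := hr s hsr
        refine ⟨(hquot s hB hA).1, ?_⟩
        rw [(hquot s hB hA).2]
        refine (norm_sub_le _ _).trans (add_le_add ((norm_sum_le _ _).trans
          (Finset.sum_le_sum fun i _ => ?_)) ?_)
        · rw [norm_mul, F_apply, norm_mul, Complex.norm_real, Real.norm_of_nonneg (M.P_nonneg i j)]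
          have h1 : M.P i j ≤ 1 := by
            rw [← M.P_row i]
            exact Finset.single_le_sum (fun k _ => M.P_nonneg i k) (Finset.mem_univ j)
          refine mul_le_mul ?_ (hγb i s hs) (norm_nonneg _) (zero_le_one.trans M.one_lt_kap.le)
          calc M.P i j * ‖M.H s i j‖ ≤ 1 * M.kap :=
                mul_le_mul h1 (hH i j) (norm_nonneg _) zero_le_one
            _ = M.kap := one_mul _
        · exact (Finset.single_le_sum (f := fun j => ‖M.v e s j‖) (fun _ _ => norm_nonneg _)
            (Finset.mem_univ j)).trans hv)
    have hβi : ∀ k i, IsFiniteMeasure (β i k) := fun k i => hβ i k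
    -- On the axis the quotient is the transform of the free step of `β` minus that of `β`.
    have hq : ∀ s : ℂ, s.re = 0 →
        quadLst (fun k => M.step M.lawV (fun i => β i k) j) s - quadLst (β j) s = g s := by
      intro s hs
      have hreg := M.regular_of_re_eq_zero hs
      rw [hg s hs, (hquot s (fun i => M.DB_eval_ne_zero i hreg.1) hreg.2).2]
      have has : 0 ≤ ((M.a : ℂ) * s).re := by rw [re_mul_a, hs, mul_zero]
      have h1 := congrFun ((M.eq_R_mulVec_add_iff (M.Om_of_re_eq_zero hs).2).1
        (h s (M.Om_of_re_eq_zero hs))) j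
      simp only [Pi.add_apply, Pi.smul_apply, smul_eq_mul, Matrix.mulVec, dotProduct,
        hΨ s hs.ge, hΨ _ has] at h1
      have h2 : quadLst (fun k => M.step M.lawV (fun i => β i k) j) s
          = ∑ i, M.F s j i * (M.p₁ * quadLst (β i) s + M.p₂ * quadLst (β i) (M.a * s)
            + quadLst (γ i) s) := by
        simp only [quadLst, M.lst_step _ _ _ hs, M.integral_lawV_lst _ hs, ← F_apply,
          Finset.mul_sum, ← Finset.sum_add_distrib]
        rw [Finset.sum_comm]
        exact Finset.sum_congr rfl fun i _ => Finset.sum_congr rfl fun k _ => by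
          rw [hlam]; ring
      rw [h2, h1]
      simp only [mul_add, Finset.sum_add_distrib, Finset.mul_sum]
      have h3 : ∀ p : ℂ, ∀ f : Fin N → ℂ, ∑ i, M.F s j i * (p * f i)
          = ∑ i, p * (M.F s j i * f i) := fun p f =>
        Finset.sum_congr rfl fun i _ => by ring
      rw [h3, h3]
      ring
    have hfin : ∀ k, IsFiniteMeasure ((![M.step M.lawV (fun i => β i 0) j + β j 1,
        M.step M.lawV (fun i => β i 1) j + β j 0, M.step M.lawV (fun i => β i 2) j + β j 3,
        M.step M.lawV (fun i => β i 3) j + β j 2] : Fin 4 → Measure ℝ) k) := by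
      intro k; fin_cases k <;> simp <;> infer_instance
    -- The differences are rearranged so that all four entries are positive measures.
    refine restrict_Ioi_eq_of_quadLst_eq (q := ![M.step M.lawV (fun i => β i 0) j + β j 1,
        M.step M.lawV (fun i => β i 1) j + β j 0, M.step M.lawV (fun i => β i 2) j + β j 3,
        M.step M.lawV (fun i => β i 3) j + β j 2]) hgc hgd hgB fun s hs => ?_
    have hadd : ∀ (m n : Measure ℝ) [IsFiniteMeasure m] [IsFiniteMeasure n],
        lst (m + n) s = lst m s + lst n s := fun m n _ _ =>
      lst_add (ae_re_mul_nonneg_of_re_eq_zero _ hs) (ae_re_mul_nonneg_of_re_eq_zero _ hs)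
    rw [← hq s hs, quadLst_eq, quadLst_eq, quadLst_eq]
    simp only [Matrix.cons_val]
    rw [hadd, hadd, hadd, hadd]
    ring
  -- The real part is the pair `(0, 1)`, the imaginary part the pair `(2, 3)`.
  have hpair : ∀ k l : Fin 4, (∀ j, (β j k).real Set.univ = (β j l).real Set.univ) →
      (∀ j, (M.step M.lawV (fun i => β i k) j + β j l).restrict (Set.Ioi 0)
        = (M.step M.lawV (fun i => β i l) j + β j k).restrict (Set.Ioi 0)) →
      (fun j => β j k) = fun j => β j l := by
    intro k l hm hst
    have hk : ∀ i, IsFiniteMeasure (β i k) := fun i => hβ i k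
    have hl : ∀ i, IsFiniteMeasure (β i l) := fun i => hβ i l
    refine M.eq_of_add_stepMax_eq (fun i => hβ0 i k) (fun i => hβ0 i l) hm fun j => ?_
    refine Measure.eq_of_restrict_Ioi_eq ?_ ?_ ?_ ?_
    · rw [Measure.add_apply, hβ0, stepMax, map_max_zero_Iio, add_zero]
    · rw [Measure.add_apply, hβ0, stepMax, map_max_zero_Iio, add_zero]
    · have := hst j
      rw [Measure.restrict_add, Measure.restrict_add] at this
      rw [Measure.restrict_add, Measure.restrict_add, stepMax_restrict_Ioi, stepMax_restrict_Ioi,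
        add_comm, add_comm ((β j l).restrict _)]
      exact this.symm
    · rw [measureReal_add_apply, measureReal_add_apply, measureReal_stepMax, measureReal_stepMax]
      simp only [hm]
  have h01 := hpair 0 1 (fun j => (hmass j).1) fun j => (hstep j).1
  have h23 := hpair 2 3 (fun j => (hmass j).2) fun j => (hstep j).2
  have hΨ0 : ∀ s : ℂ, 0 ≤ s.re → Ψ s = 0 := fun s hs => by
    funext j
    rw [hΨ s hs j, quadLst_eq, congrFun h01 j, congrFun h23 j]
    simp
  refine eq_zero_of_num_eq_zero fun s hs j => ?_
  have h1 := congrFun ((M.eq_R_mulVec_add_iff (M.Om_of_re_eq_zero hs).2).1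
        (h s (M.Om_of_re_eq_zero hs))) j
  rw [hΨ0 s hs.ge, hΨ0 _ (by rw [re_mul_a, hs, mul_zero])] at h1
  simp only [Matrix.mulVec_zero, smul_zero, add_zero, zero_add, Pi.zero_apply] at h1
  have h2 := M.den_ne_zero (M.regular_of_re_eq_zero hs) j
  rw [v, eq_comm, div_eq_zero_iff] at h1
  exact h1.resolve_right h2

end ModelI

/-! ### Uniqueness of the coefficients -/

namespace ModelI

variable {N : ℕ} {M : ModelI N}

theorem Generic.ae_good (hG : M.Generic) (i : Fin N) (k : Fin (M.m i)) :
    ∀ᵐ y : ℝ ∂M.negV, M.Good (M.t i k * y) :=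
  (ae_restrict_iff' measurableSet_Iio).2 (hG.left_Om i k)

theorem System.left_negV {π : Fin N → ℝ} {Ψ : ℂ → Fin N → ℂ} {c : M.Coeffs}
    (h : M.System π Ψ c) (i : Fin N) (k : Fin (M.m i)) (j : Fin N) :
    ∑ i', M.G (M.t i k) j i' * ∫ y : ℝ, Ψ (M.t i k * (y : ℂ)) i' ∂M.negV
      = M.num c j (M.t i k) := by
  rw [← h.left i k j, Finset.mul_sum]
  refine Finset.sum_congr rfl fun i' _ => ?_
  rw [mul_left_comm, M.p₃_mul_integral_cond]

/-- In the generic case the system sees its second argument only at points of `Good`. -/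
theorem System.congr_good (hG : M.Generic) {π : Fin N → ℝ} {Ψ Ψ' : ℂ → Fin N → ℂ} {c : M.Coeffs}
    (h : M.System π Ψ c) (he : ∀ s, M.Good s → Ψ' s = Ψ s) : M.System π Ψ' c where
  zero := h.zero
  right δ hδ ζ hζ := by
    rw [he _ (hG.right_Om δ hδ)]
    exact h.right δ hδ ζ hζ
  left i k j := by
    rw [← h.left_negV i k j, Finset.mul_sum]
    refine Finset.sum_congr rfl fun i' _ => ?_
    rw [mul_left_comm, M.p₃_mul_integral_cond]
    congr 1
    refine integral_congr_ae ?_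
    filter_upwards [hG.ae_good i k] with y hy
    rw [he _ hy]

theorem num_sub (c c' : M.Coeffs) (j : Fin N) (s : ℂ) :
    M.num (c - c') j s = M.num c j s - M.num c' j s := by
  simp [num, sub_mul, Finset.sum_sub_distrib]

theorem Vt_sub (c c' : M.Coeffs) (s : ℂ) : M.Vt (c - c') s = M.Vt c s - M.Vt c' s := by
  have : M.v (c - c') s = M.v c s - M.v c' s := by
    funext j; simp [v, num_sub, sub_div]
  rw [Vt, this, Matrix.mulVec_sub]; rfl

/-- Two solutions of the system give two holomorphic solutions of the functional equation, and their
difference solves the homogeneous problem. -/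
theorem System.unique (hG : M.Generic) {π : Fin N → ℝ} {c c' : M.Coeffs}
    (h : M.System π (M.series c) c) (h' : M.System π (M.series c') c') : c = c' := by
  obtain ⟨Ψ, hreg, hgood, hrec⟩ := exists_extension hG h.right
  obtain ⟨Ψ', hreg', hgood', hrec'⟩ := exists_extension hG h'.right
  have hc := fun i => RegularOn.continuousOn hreg i
  have hc' := fun i => RegularOn.continuousOn hreg' i
  obtain ⟨C, hC⟩ := exists_bound_of_recursion hc hrec
  obtain ⟨C', hC'⟩ := exists_bound_of_recursion hc' hrec'
  have hint : ∀ {Ψ : ℂ → Fin N → ℂ} {C : ℝ},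
      (∀ i, ContinuousOn (fun s => Ψ s i) {s | 0 ≤ s.re}) →
      (∀ s : ℂ, 0 ≤ s.re → ∑ j, ‖Ψ s j‖ ≤ C) → ∀ i k i',
      Integrable (fun y : ℝ => Ψ (M.t i k * y) i') M.negV := by
    intro Ψ C hc hC i k i'
    have hpos : ∀ y : ℝ, y < 0 → 0 ≤ (M.t i k * (y : ℂ)).re := fun y hy => by
      simpa using mul_nonneg_of_nonpos_of_nonpos (M.t_re i k).le hy.le
    refine Integrable.of_bound (C := C) ?_ ?_
    · refine ContinuousOn.aestronglyMeasurable (s := Set.Iio 0) ?_ measurableSet_Iio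
      exact (hc i').comp (by fun_prop) fun y hy => hpos y hy
    · filter_upwards [M.ae_negV] with y hy
      exact (Finset.single_le_sum (f := fun j => ‖Ψ (M.t i k * y) j‖)
        (fun _ _ => norm_nonneg _) (Finset.mem_univ i')).trans (hC _ (hpos y hy))
  have hS := h.congr_good hG hgood
  have hS' := h'.congr_good hG hgood'
  rw [← sub_eq_zero]
  refine coeffs_eq_zero_of_homogeneous (Ψ := fun s => Ψ s - Ψ' s) (C := C + C')
    hG.simple_poles (fun i => (hc i).sub (hc' i))
    (fun i => (RegularOn.differentiableOn hreg i).sub (RegularOn.differentiableOn hreg' i))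
    (fun s hs => ?_) (fun s hs => ?_) (fun j => ?_) (fun i k j => ?_)
  · refine (Finset.sum_le_sum fun j _ => norm_sub_le _ _).trans ?_
    rw [Finset.sum_add_distrib]
    exact add_le_add (hC s hs) (hC' s hs)
  · rw [hrec s hs, hrec' s hs, Vt_sub, Matrix.mulVec_sub]
    abel
  · change c j 0 - c' j 0 = 0
    rw [h.zero, h'.zero, sub_self]
  · rw [num_sub, ← hS.left_negV i k j, ← hS'.left_negV i k j, ← Finset.sum_sub_distrib]
    refine Finset.sum_congr rfl fun i' _ => ?_
    rw [← mul_sub, ← integral_sub (hint hc hC i k i') (hint hc' hC' i k i')]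
    rfl

end ModelI

end

theorem theorem1 {N : ℕ} (M : ModelI N)
    {Ω : Type*} [MeasurableSpace Ω] (μ : Measure Ω) [IsProbabilityMeasure μ] (X : M.Realization μ)
    (π : Fin N → ℝ) (hπ_nonneg : ∀ i, 0 ≤ π i) (hπ_sum : ∑ i, π i = 1) (hπ : π ᵥ* M.P = π)
    (Φ : ℂ → Fin N → ℂ)
    (hΦ : ∀ (s : ℂ) (i : Fin N), 0 ≤ s.re →
      Tendsto (fun n => X.transform n s i) atTop (𝓝 (Φ s i))) :
    (M.kernelDet ≠ 0 ∧
      (M.kernelDet.roots.filter (fun δ => 0 < δ.re)).card = ∑ j, M.l j) ∧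
    ∃ c : M.Coeffs,
      (∀ j, c j 0 = (π j : ℂ) * (M.p₃ : ℂ) * M.den j 0) ∧
      (∀ s ∈ M.regular, ∀ j,
        Φ s j - ∑ i, (M.P i j : ℂ) * M.H s i j *
            ((M.p₁ : ℂ) * Φ s i + (M.p₂ : ℂ) * Φ ((M.a : ℂ) * s) i)
          = (∑ w : Fin (M.deg j + 1), c j w * s ^ (w : ℕ)) / M.den j s) ∧
      (∀ s ∈ M.Om, Φ s = M.R s *ᵥ Φ ((M.a : ℂ) * s) + M.Vt c s) ∧
      (∀ s : ℂ, (∀ k : ℕ, (M.a : ℂ) ^ k * s ∈ M.Om) →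
        HasSum (fun k : ℕ => M.prodR s k *ᵥ M.Vt c ((M.a : ℂ) ^ k * s)) (Φ s)) ∧
      (∀ δ ∈ M.regular, ∀ ζ : Fin N → ℂ, ζ ᵥ* (1 - (M.p₁ : ℂ) • M.F δ) = 0 →
        (M.p₂ : ℂ) * (ζ ⬝ᵥ (M.F δ *ᵥ Φ ((M.a : ℂ) * δ))) = -(ζ ⬝ᵥ M.v c δ)) ∧
      M.System π Φ c ∧
      (M.Generic → ∀ c' : M.Coeffs, M.System π (M.series c') c' ↔ c' = c) := by
  obtain ⟨c, hc, hleft⟩ := ModelI.exists_coeffs X hΦ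
  have hbound : ∀ s : ℂ, 0 ≤ s.re → ∀ j, ‖Φ s j‖ ≤ 1 := fun s hs j => by
    refine le_of_tendsto (hΦ s j hs).norm (Eventually.of_forall fun n => ?_)
    rw [X.transform_eq_lst]
    exact (norm_lst_le (ae_re_mul_nonneg (X.law_Iio n j) hs)).trans (X.measureReal_law_le_one n j)
  have hzero := hc.coeff_zero hπ (ModelI.limit_zero_eq X hΦ hπ_sum hπ)
  have hseries : ∀ s, M.Good s → Φ s = M.series c s := fun s hs =>
    ModelI.eq_series_of_bounded hbound (fun s hs => hc.eq_R_mulVec hs) hs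
  have hsys : M.System π Φ c := ⟨hzero, fun δ hδ ζ hζ => hc.right hδ.1.le hζ, hleft⟩
  refine ⟨M.kernelDet_ne_zero_and_rightCount, c, hzero, fun s hs j => ?_,
    fun s hs => hc.eq_R_mulVec hs, fun s hs => ?_, fun δ hδ ζ hζ => hc.null_vec hδ hζ, hsys,
    fun hG c' => ⟨fun h => ?_, ?_⟩⟩
  · have h := hc.sub_eq hs j
    simp only [M.F_apply] at h
    exact h
  · rw [hseries s hs]
    exact (ModelI.summable_term c s).hasSum
  · exact h.unique hG (hsys.congr_good hG fun s hs => (hseries s hs).symm)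
  · rintro rfl
    exact hsys.congr_good hG fun s hs => (hseries s hs).symm
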